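/- **Setting.** Let $U\subset\mathbb{R}^d$ be bounded, open and convex, let $S\ge 2$, and let $F=\{f_1,\dots,f_S\}$ be a conformal iterated function system on $U$: each $f_i$ is continuous on $\overline U$ with $f_i(\overline U)\subset U$, is injective and $C^1$ on $U$, its differential $f_i'(x)$ is a (non-zero) similarity for every $x\in U$ and is Hölder continuous in $x$, and $\sup_{x\in U}|f_i'(x)|<1$. Assume the open set condition: there is a non-empty open $O\subset U$ with $f_i(O)\subset O$ for all $i$ and $f_i(O)\cap f_j(O)=\emptyset$ for $i\ne j$. Let $\Lambda\subset \overline U$ be the attractor, i.e. the non-empty compact set with $\Lambda=\bigcup_i f_i(\Lambda)$. Write $\Sigma=\{1,\dots,S\}$ and, for a finite word $\mathbf i=i_1\cdots i_n$, $f_{\mathbf i}=f_{i_1}\circ\cdots\circ f_{i_n}$ and $\|f'_{\mathbf i}\|=\sup_{x\in U}|f'_{\mathbf i}(x)|$. Let $\mathbf e|_m^n$ be the word $e_m\cdots e_n$, let $\pi:\Sigma^{\mathbb N}\to\Lambda$ be the coding map, $\{\pi(\mathbf e)\}=\bigcap_n f_{\mathbf e|_1^n}(\Lambda)$, and let $\sigma$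 be the left shift. For $\mathbf e,\mathbf t\in\Sigma^{\mathbb N}$ let $v_s(\mathbf e,\mathbf t)\in[0,\infty]$ be the supremum of the $u\ge0$ such that $\sigma^n\mathbf e$ begins with $\mathbf t|_1^{\lfloor un\rfloor}$ for infinitely many $n$, and let $v_e(\mathbf e,\mathbf t)\in[0,\infty]$ be the supremum of the $u\ge 0$ such that for all large $n$ there is $0\le m\le n$ for which $\sigma^m\mathbf e$ begins with $\mathbf t|_1^{\lfloor un\rfloor}$. Let $G$ be the set of $\mathbf t\in\Sigma^{\mathbb N}$ for which there is $N$ such that for all $n>N$, all $1\le m<n$ and all digits $j\neq t_n$, the word $t_m\cdots t_{n-1}j$ is not the initial word of $\mathbf t$ of length $n-m+1$. For $\theta>1$, $v\in(0,1)$ and large $M$ let $p$ be the largest integer with $vM/\theta^p\ge1$, and let $G(M)$ be the concatenation $\mathbf t|_1^{\lfloor vM/\theta^p\rfloor}\cdots\mathbf t|_1^{\lfloor vM/\theta\rfloor}\,\mathbf t|_1^{\lfloor vM\rfloor}\,\mathbf t|_1^{\lfloor\theta vM\rfloor}$. Put $$\Omega^+=\limsup_{M\to\infty}\tfrac1M\log\|f'_{G(M)}\|,\qquad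 \Omega^-=\liminf_{M\to\infty}\tfrac1M\log\|f'_{G(M)}\|,\qquad P(s)=\lim_{n\to\infty}\tfrac1n\log\sum_{\mathbf i\in\Sigma^n}\|f'_{\mathbf i}\|^s\quad (s\ge0),$$ and for $\theta\ge\frac1{1-v}$ let $s^\pm(\mathbf t,v,\theta)$ be the unique solution $s\ge0$ of $$(\theta-\theta v-1)\,P(s)=-s(\theta-1)\,\Omega^\pm$$ (so $P(s)=-s\frac{\theta-1}{\theta-\theta v-1}\Omega^\pm$ if $\theta>\frac1{1-v}$, and $s^\pm=0$ if $\theta=\frac1{1-v}$). **Theorem 2.** Let $v\in(0,1)$ and $\mathbf t\in G$. (1) If $0<\theta<\frac1{1-v}$, then no $\mathbf e\in\Sigma^{\mathbb N}$ satisfies both $v_e(\mathbf e,\mathbf t)\ge v$ and $v_s(\mathbf e,\mathbf t)=\theta v$. (2) If $\theta\ge\frac1{1-v}$, then $s^\pm(\mathbf t,v,\theta)$ exist and are unique, and the following holds. (2.1) There are $c\in\mathbb R$ and $\delta_0>0$ such that, for every $\delta\in(0,\delta_0)$, the set $\Upsilon=\{\mathbf e: v_e(\mathbf e,\mathbf t)\ge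 v,\ (\theta-\delta)v\le v_s(\mathbf e,\mathbf t)\le(\theta+\delta)v\}$ satisfies $$\dim_H\pi(\Upsilon)\le\min\{s^+(\mathbf t,v,\theta)+c\,\delta,\ \dim_H\Lambda\}.$$ (2.2) The set $\Delta=\{\mathbf e:v_e(\mathbf e,\mathbf t)\ge v,\ v_s(\mathbf e,\mathbf t)\ge\theta v\}$ satisfies $$\dim_H\pi(\Delta)\ge\min\{s^-(\mathbf t,v,\theta),\ \dim_H\Lambda\}.$$ -/

import Mathlib

open Filter Topology Set

noncomputable section

namespace ConformalIFS

/-! ### Recurrence sets of a dynamical system -/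

/-- Points whose orbit visits `B n` at time `n` for infinitely many `n`. -/
def shrinkingTargetSet {X : Type*} (T : X → X) (B : ℕ → Set X) : Set X :=
  {x | ∀ N : ℕ, ∃ n ≥ N, T^[n] x ∈ B n}

/-- Points for which, for all large `n`, one of the first iterates (times `m ≤ n`) visits `B n`. -/
def eventuallyAlwaysHittingSet {X : Type*} (T : X → X) (B : ℕ → Set X) : Set X :=
  {x | ∃ N : ℕ, ∀ n ≥ N, ∃ m ≤ n, T^[m] x ∈ B n}

/-! ### The symbolic space `ℕ → Fin S` (sequences are indexed from `0`) -/

/-- The left shift. -/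
def shift {S : ℕ} (e : ℕ → Fin S) : ℕ → Fin S := fun n => e (n + 1)

/-- The word `e_m e_{m+1} ⋯ e_{m+l-1}` of length `l`. -/
def subword {S : ℕ} (e : ℕ → Fin S) (m l : ℕ) : List (Fin S) :=
  List.ofFn fun i : Fin l => e (m + i)

/-- The initial word of length `l` of `e`. -/
def initialWord {S : ℕ} (e : ℕ → Fin S) (l : ℕ) : List (Fin S) := subword e 0 l

/-- `R_s(v, t)`: shrinking target set for the cylinders `[t|_1^{⌊v n⌋}]`. -/
def Rs {S : ℕ} (v : ℝ) (t : ℕ → Fin S) : Set (ℕ → Fin S) :=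
  shrinkingTargetSet shift fun n => PiNat.cylinder t ⌊v * n⌋₊

/-- `R_e(v, t)`: eventually always hitting set for the cylinders `[t|_1^{⌊v n⌋}]`. -/
def Re {S : ℕ} (v : ℝ) (t : ℕ → Fin S) : Set (ℕ → Fin S) :=
  eventuallyAlwaysHittingSet shift fun n => PiNat.cylinder t ⌊v * n⌋₊

/-- The maximal shrinking target rate `v_s(e, t) ∈ [0, ∞]`. -/
def vs {S : ℕ} (e t : ℕ → Fin S) : EReal :=
  sSup ((fun v : ℝ => (v : EReal)) '' {v : ℝ | 0 ≤ v ∧ e ∈ Rs v t})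

/-- The maximal eventually always hitting rate `v_e(e, t) ∈ [0, ∞]`. -/
def ve {S : ℕ} (e t : ℕ → Fin S) : EReal :=
  sSup ((fun v : ℝ => (v : EReal)) '' {v : ℝ | 0 ≤ v ∧ e ∈ Re v t})

/-- The set `G` of admissible targets: from some position on, changing the digit at position `n`
never creates an occurrence of an initial word of `t` that starts before `n` and ends at `n`. -/
def admissibleTargets (S : ℕ) : Set (ℕ → Fin S) :=
  {t | ∃ N : ℕ, ∀ n > N, ∀ m < n, ∀ j : Fin S, j ≠ t n →
    subword (Function.update t n j) m (n - m + 1) ≠ initialWord t (n - m + 1)}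

/-- `Δ(t, θ, v)`. -/
def Delta {S : ℕ} (t : ℕ → Fin S) (θ v : ℝ) : Set (ℕ → Fin S) :=
  {e | (v : EReal) ≤ ve e t} ∩ {e | ((θ * v : ℝ) : EReal) ≤ vs e t}

/-- `Υ(t, θ, v, δ)`. -/
def Upsilon {S : ℕ} (t : ℕ → Fin S) (θ v δ : ℝ) : Set (ℕ → Fin S) :=
  {e | (v : EReal) ≤ ve e t} ∩
    {e | (((θ - δ) * v : ℝ) : EReal) ≤ vs e t ∧ vs e t ≤ (((θ + δ) * v : ℝ) : EReal)}

/-! ### Conformal iterated function systems -/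

/-- `f` is a conformal `C^1` map on `U`: its differential is a similarity at every point
and a Hölder continuous function of the point. -/
structure IsConformalOn {d : ℕ}
    (f : EuclideanSpace ℝ (Fin d) → EuclideanSpace ℝ (Fin d))
    (U : Set (EuclideanSpace ℝ (Fin d))) : Prop where
  contDiffOn : ContDiffOn ℝ 1 f U
  similarity : ∀ x ∈ U, ∀ y : EuclideanSpace ℝ (Fin d), y ≠ 0 →
    ‖fderiv ℝ f x y‖ = ‖fderiv ℝ f x‖ * ‖y‖ ∧ ‖fderiv ℝ f x‖ * ‖y‖ ≠ 0
  holder : ∃ α > (0 : ℝ), ∃ c > (0 : ℝ), ∀ x ∈ U, ∀ y ∈ U,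
    ‖fderiv ℝ f x - fderiv ℝ f y‖ ≤ c * ‖x - y‖ ^ α

/-- `f_0, …, f_{S-1}` is a conformal iterated function system on the bounded open convex set `U`.
Only the values of the maps on the closure of `U` matter. -/
structure IsConformalIFS {d S : ℕ}
    (f : Fin S → EuclideanSpace ℝ (Fin d) → EuclideanSpace ℝ (Fin d))
    (U : Set (EuclideanSpace ℝ (Fin d))) : Prop where
  two_le : 2 ≤ S
  isOpen : IsOpen U
  convex : Convex ℝ U
  bounded : Bornology.IsBounded U
  continuousOn : ∀ i, ContinuousOn (f i) (closure U)
  mapsTo : ∀ i, MapsTo (f i) (closure U) U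
  injOn : ∀ i, InjOn (f i) U
  conformal : ∀ i, IsConformalOn (f i) U
  contracting : ∃ r < (1 : ℝ), ∀ i, ∀ x ∈ U, ‖fderiv ℝ (f i) x‖ ≤ r

/-- The open set condition. -/
def OpenSetCondition {d S : ℕ}
    (f : Fin S → EuclideanSpace ℝ (Fin d) → EuclideanSpace ℝ (Fin d))
    (U : Set (EuclideanSpace ℝ (Fin d))) : Prop :=
  ∃ O : Set (EuclideanSpace ℝ (Fin d)), IsOpen O ∧ O.Nonempty ∧ O ⊆ U ∧
    (∀ i, f i '' O ⊆ O) ∧ ∀ i j, i ≠ j → Disjoint (f i '' O) (f j '' O)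

/-- `Λ` is the attractor: the (unique) non-empty compact subset of the closure of `U` with
`Λ = ⋃ i, f i (Λ)`. -/
structure IsAttractor {d S : ℕ}
    (f : Fin S → EuclideanSpace ℝ (Fin d) → EuclideanSpace ℝ (Fin d))
    (U Λ : Set (EuclideanSpace ℝ (Fin d))) : Prop where
  nonempty : Λ.Nonempty
  isCompact : IsCompact Λ
  subset : Λ ⊆ closure U
  eq_iUnion : Λ = ⋃ i, f i '' Λ

/-- The composition `f_{i_1} ∘ ⋯ ∘ f_{i_n}` along the word `i_1 ⋯ i_n`. -/
def wordMap {X : Type*} {S : ℕ} (f : Fin S → X → X) (w : List (Fin S)) : X → X :=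
  w.foldr (fun i g => f i ∘ g) id

/-- The coding map `π`: `π(e)` is the point of the decreasing intersection of the compact sets
`f_{e_1} ∘ ⋯ ∘ f_{e_n} (Λ)`, whose diameters tend to zero. -/
def coding {d S : ℕ}
    (f : Fin S → EuclideanSpace ℝ (Fin d) → EuclideanSpace ℝ (Fin d))
    (Λ : Set (EuclideanSpace ℝ (Fin d))) (e : ℕ → Fin S) : EuclideanSpace ℝ (Fin d) :=
  Classical.epsilon fun x => ∀ n : ℕ, x ∈ wordMap f (initialWord e n) '' Λ

/-- `‖f'_w‖ = sup_{x ∈ U} |f'_w(x)|`. -/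
def derivNorm {d S : ℕ}
    (f : Fin S → EuclideanSpace ℝ (Fin d) → EuclideanSpace ℝ (Fin d))
    (U : Set (EuclideanSpace ℝ (Fin d))) (w : List (Fin S)) : ℝ :=
  ⨆ x : U, ‖fderiv ℝ (wordMap f w) (x : EuclideanSpace ℝ (Fin d))‖

/-- The pressure `P(s) = lim (1/n) log ∑_{|w| = n} ‖f'_w‖ ^ s`. -/
def pressure {d S : ℕ}
    (f : Fin S → EuclideanSpace ℝ (Fin d) → EuclideanSpace ℝ (Fin d))
    (U : Set (EuclideanSpace ℝ (Fin d))) (s : ℝ) : ℝ :=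
  limUnder atTop fun n : ℕ =>
    (1 / (n : ℝ)) * Real.log (∑ w : Fin n → Fin S, derivNorm f U (List.ofFn w) ^ s)

/-! ### The exponents -/

/-- The largest `p ∈ ℕ` with `v M / θ ^ p ≥ 1`. -/
def maxPower (θ v M : ℝ) : ℕ := sSup {p : ℕ | 1 ≤ v * M / θ ^ p}

/-- The word `G(M, t, θ, v)`, the concatenation of the initial words of `t` of lengths
`⌊v M / θ ^ p⌋, …, ⌊v M / θ⌋, ⌊v M⌋, ⌊θ v M⌋`, in this order, with `p = maxPower θ v M`. -/
def targetWord {S : ℕ} (M : ℝ) (t : ℕ → Fin S) (θ v : ℝ) : List (Fin S) :=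
  (List.range (maxPower θ v M + 1)).reverse.flatMap (fun q => initialWord t ⌊v * M / θ ^ q⌋₊) ++
    initialWord t ⌊θ * v * M⌋₊

/-- `Ω⁺(t, θ, v)`. -/
def OmegaPlus {d S : ℕ}
    (f : Fin S → EuclideanSpace ℝ (Fin d) → EuclideanSpace ℝ (Fin d))
    (U : Set (EuclideanSpace ℝ (Fin d))) (t : ℕ → Fin S) (θ v : ℝ) : ℝ :=
  limsup (fun M : ℝ => Real.log (derivNorm f U (targetWord M t θ v)) / M) atTop

/-- `Ω⁻(t, θ, v)`. -/
def OmegaMinus {d S : ℕ}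
    (f : Fin S → EuclideanSpace ℝ (Fin d) → EuclideanSpace ℝ (Fin d))
    (U : Set (EuclideanSpace ℝ (Fin d))) (t : ℕ → Fin S) (θ v : ℝ) : ℝ :=
  liminf (fun M : ℝ => Real.log (derivNorm f U (targetWord M t θ v)) / M) atTop

/-- `s ≥ 0` solves `P(s) = - s (θ - 1) / (θ - θ v - 1) Ω`. The equation is multiplied by
`θ - θ v - 1`, so that it makes sense (with the only solution `s = 0`, as `Ω < 0 < θ - 1`) for
`θ = 1 / (1 - v)` too. -/
def IsExponent {d S : ℕ}
    (f : Fin S → EuclideanSpace ℝ (Fin d) → EuclideanSpace ℝ (Fin d))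
    (U : Set (EuclideanSpace ℝ (Fin d))) (v θ Ω s : ℝ) : Prop :=
  0 ≤ s ∧ (θ - θ * v - 1) * pressure f U s = -s * (θ - 1) * Ω

/-- `s⁺(t, v, θ)`, the unique solution of the equation with `Ω⁺`. -/
def sPlus {d S : ℕ}
    (f : Fin S → EuclideanSpace ℝ (Fin d) → EuclideanSpace ℝ (Fin d))
    (U : Set (EuclideanSpace ℝ (Fin d))) (t : ℕ → Fin S) (v θ : ℝ) : ℝ :=
  sSup {s : ℝ | IsExponent f U v θ (OmegaPlus f U t θ v) s}

/-- `s⁻(t, v, θ)`, the unique solution of the equation with `Ω⁻`. -/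
def sMinus {d S : ℕ}
    (f : Fin S → EuclideanSpace ℝ (Fin d) → EuclideanSpace ℝ (Fin d))
    (U : Set (EuclideanSpace ℝ (Fin d))) (t : ℕ → Fin S) (v θ : ℝ) : ℝ :=
  sSup {s : ℝ | IsExponent f U v θ (OmegaMinus f U t θ v) s}

end ConformalIFS

end

open Filter Topology Set

noncomputable section

namespace ConformalIFS

/-! ### Derivatives of the word maps -/

section WordMap

variable {d S : ℕ} {f : Fin S → EuclideanSpace ℝ (Fin d) → EuclideanSpace ℝ (Fin d)}
  {U : Set (EuclideanSpace ℝ (Fin d))}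

/-! The geometry enters through the function D(w) = ‖f'_w‖ on words. Bounded distortion on a compact
set containing every f_i(closure U) makes D multiplicative up to a constant, with D(w) between κ^|w|
and r^|w| (`IsQuasiMultiplicative`). Fekete's lemma, applied to the partition sums from both sides,
puts them between e^{nP(s)} and C^s e^{nP(s)}; the pressure is continuous and strictly decreasing,
whence the exponents (`existsUnique_exponent`).

Let v_e ≥ v and v_s ≈ θv. Call M a record if the occurrence of t starting at M ends later than all
occurrences starting earlier. Admissibility of t prevents a long earlier occurrence from overlapping
a record (`IsRecord.add_le`). Up to small errors, v_e ≥ v provides before a late record M another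
record m with an occurrence of length at least vM, and v_s ≤ θv forces m ≥ M/θ
(`exists_previous_record`). Hence M/θ + vM ≤ M, which is part (1).

Upper bound: going back through J records, the first M letters of e contain disjoint initial words
of t of lengths about vM, vM/θ, vM/θ², …, with free letters elsewhere, and t|θvM follows. There are
at most (M+1)^J arrangements. Put A = 1 - vθ/(θ-1), the asymptotic proportion of free letters. The
sum of D^s over these words grows at rate at most P(s)A + sΩ⁺ plus an error linear in δ
(`sum_targetFamily_le`, `exponent_le`). The main term vanishes at s⁺ and decreases with slope at
most Ω⁺ < 0, so s = s⁺ + cδ makes the covering sums converge (`dimH_le_of_summable`).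

Lower bound: place t|⌊vθ^{k+1}⌋ at position ⌊θ^k⌋ for all large k, and fill the gaps by independent
random blocks with weights proportional to D^s. For s < s⁻ the cylinder w has probability at most a
constant times D(w)^s (`measure_cylinder_le`), because the rate P(s)A + sΩ⁻ is positive. The open
set condition bounds the number of cylinders of a given size meeting a small set (`exists_card_le`),
so the mass distribution principle applies (`le_dimH_coding`). Comparison with dim Λ is trivial in
both directions. -/

theorem wordMap_nil {X : Type*} (f : Fin S → X → X) : wordMap f [] = id := rfl

theorem wordMap_cons {X : Type*} (f : Fin S → X → X) (i : Fin S) (w : List (Fin S)) :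
    wordMap f (i :: w) = f i ∘ wordMap f w := rfl

theorem wordMap_append {X : Type*} (f : Fin S → X → X) (u w : List (Fin S)) :
    wordMap f (u ++ w) = wordMap f u ∘ wordMap f w := by
  induction u with
  | nil => rfl
  | cons i u ih => rw [List.cons_append, wordMap_cons, wordMap_cons, ih, Function.comp_assoc]

theorem mapsTo_wordMap {X : Type*} {f : Fin S → X → X} {A : Set X} (h : ∀ i, MapsTo (f i) A A)
    (w : List (Fin S)) : MapsTo (wordMap f w) A A := by
  induction w with
  | nil => exact mapsTo_id A
  | cons i w ih => exact (h i).comp ih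

namespace IsConformalIFS

theorem mapsTo_self (hf : IsConformalIFS f U) (i : Fin S) : MapsTo (f i) U U :=
  fun _ hx => hf.mapsTo i (subset_closure hx)

theorem differentiableAt (hf : IsConformalIFS f U) (i : Fin S) {x : EuclideanSpace ℝ (Fin d)}
    (hx : x ∈ U) : DifferentiableAt ℝ (f i) x :=
  ((hf.conformal i).contDiffOn.differentiableOn one_ne_zero).differentiableAt
    (hf.isOpen.mem_nhds hx)

theorem differentiableAt_wordMap (hf : IsConformalIFS f U) (w : List (Fin S))
    {x : EuclideanSpace ℝ (Fin d)} (hx : x ∈ U) : DifferentiableAt ℝ (wordMap f w) x := by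
  induction w with
  | nil => exact differentiableAt_id
  | cons i w ih => exact (hf.differentiableAt i (mapsTo_wordMap hf.mapsTo_self w hx)).comp x ih

theorem norm_fderiv_apply (hf : IsConformalIFS f U) (i : Fin S) {x : EuclideanSpace ℝ (Fin d)}
    (hx : x ∈ U) (y : EuclideanSpace ℝ (Fin d)) :
    ‖fderiv ℝ (f i) x y‖ = ‖fderiv ℝ (f i) x‖ * ‖y‖ := by
  rcases eq_or_ne y 0 with rfl | hy
  · simp
  · exact ((hf.conformal i).similarity x hx y hy).1

variable [Nontrivial (EuclideanSpace ℝ (Fin d))]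

theorem norm_fderiv_pos (hf : IsConformalIFS f U) (i : Fin S) {x : EuclideanSpace ℝ (Fin d)}
    (hx : x ∈ U) : 0 < ‖fderiv ℝ (f i) x‖ := by
  obtain ⟨y, hy⟩ := exists_ne (0 : EuclideanSpace ℝ (Fin d))
  exact lt_of_le_of_ne (norm_nonneg _)
    (left_ne_zero_of_mul ((hf.conformal i).similarity x hx y hy).2).symm

/-- Similarities compose to similarities, so the chain rule is an equality of norms. Reading the
ratio as an operator norm needs a nontrivial space. -/
theorem wordMap_fderiv (hf : IsConformalIFS f U) (w : List (Fin S))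
    {x : EuclideanSpace ℝ (Fin d)} (hx : x ∈ U) :
    (∀ y, ‖fderiv ℝ (wordMap f w) x y‖ = ‖fderiv ℝ (wordMap f w) x‖ * ‖y‖) ∧
      ∀ i, ‖fderiv ℝ (wordMap f (i :: w)) x‖ =
        ‖fderiv ℝ (f i) (wordMap f w x)‖ * ‖fderiv ℝ (wordMap f w) x‖ := by
  have key : ∀ w : List (Fin S),
      (∀ y, ‖fderiv ℝ (wordMap f w) x y‖ = ‖fderiv ℝ (wordMap f w) x‖ * ‖y‖) →
      ∀ i, (∀ y, ‖fderiv ℝ (wordMap f (i :: w)) x y‖ =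
        ‖fderiv ℝ (f i) (wordMap f w x)‖ * ‖fderiv ℝ (wordMap f w) x‖ * ‖y‖) := by
    intro w hw i y
    have hwx := mapsTo_wordMap hf.mapsTo_self w hx
    rw [wordMap_cons, fderiv_comp x (hf.differentiableAt i hwx) (hf.differentiableAt_wordMap w hx),
      ContinuousLinearMap.comp_apply, hf.norm_fderiv_apply i hwx, hw, mul_assoc]
  have hall : ∀ w : List (Fin S),
      ∀ y, ‖fderiv ℝ (wordMap f w) x y‖ = ‖fderiv ℝ (wordMap f w) x‖ * ‖y‖ := by
    intro w
    induction w with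
    | nil => intro y; rw [wordMap_nil]; simp
    | cons i w ih =>
      have h := key w ih i
      intro y
      rw [h y, ContinuousLinearMap.homothety_norm _ h]
  exact ⟨hall w, fun i => ContinuousLinearMap.homothety_norm _ (key w (hall w) i)⟩

theorem norm_fderiv_wordMap_cons (hf : IsConformalIFS f U) (i : Fin S) (w : List (Fin S))
    {x : EuclideanSpace ℝ (Fin d)} (hx : x ∈ U) :
    ‖fderiv ℝ (wordMap f (i :: w)) x‖ =
        ‖fderiv ℝ (f i) (wordMap f w x)‖ * ‖fderiv ℝ (wordMap f w) x‖ :=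
  (hf.wordMap_fderiv w hx).2 i

theorem norm_fderiv_wordMap_append (hf : IsConformalIFS f U) (u w : List (Fin S))
    {x : EuclideanSpace ℝ (Fin d)} (hx : x ∈ U) :
    ‖fderiv ℝ (wordMap f (u ++ w)) x‖ =
        ‖fderiv ℝ (wordMap f u) (wordMap f w x)‖ * ‖fderiv ℝ (wordMap f w) x‖ := by
  induction u with
  | nil => rw [List.nil_append, wordMap_nil]; simp
  | cons i u ih =>
    rw [List.cons_append, hf.norm_fderiv_wordMap_cons i _ hx, ih,
      hf.norm_fderiv_wordMap_cons i u (mapsTo_wordMap hf.mapsTo_self w hx), wordMap_append,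
      Function.comp_apply, mul_assoc]

theorem norm_fderiv_wordMap_pos (hf : IsConformalIFS f U) (w : List (Fin S))
    {x : EuclideanSpace ℝ (Fin d)} (hx : x ∈ U) : 0 < ‖fderiv ℝ (wordMap f w) x‖ := by
  induction w with
  | nil => rw [wordMap_nil]; simp
  | cons i w ih =>
    rw [hf.norm_fderiv_wordMap_cons i w hx]
    exact mul_pos (hf.norm_fderiv_pos i (mapsTo_wordMap hf.mapsTo_self w hx)) ih

omit [Nontrivial (EuclideanSpace ℝ (Fin d))] in
theorem exists_contraction_ratio (hf : IsConformalIFS f U) :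
    ∃ r : ℝ, 0 < r ∧ r < 1 ∧ ∀ i, ∀ x ∈ U, ‖fderiv ℝ (f i) x‖ ≤ r := by
  obtain ⟨r, hr, h⟩ := hf.contracting
  -- The maximum with 1/2 makes the ratio positive.
  exact ⟨max r (1 / 2), by positivity, max_lt hr (by norm_num),
    fun i x hx => (h i x hx).trans (le_max_left _ _)⟩

theorem norm_fderiv_wordMap_le_pow (hf : IsConformalIFS f U) {r : ℝ} (hr : 0 < r)
    (h : ∀ i, ∀ x ∈ U, ‖fderiv ℝ (f i) x‖ ≤ r) (w : List (Fin S))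
    {x : EuclideanSpace ℝ (Fin d)} (hx : x ∈ U) :
    ‖fderiv ℝ (wordMap f w) x‖ ≤ r ^ w.length := by
  induction w with
  | nil => rw [wordMap_nil]; simp
  | cons i w ih =>
    rw [hf.norm_fderiv_wordMap_cons i w hx, List.length_cons, pow_succ']
    exact mul_le_mul (h i _ (mapsTo_wordMap hf.mapsTo_self w hx)) ih (norm_nonneg _) hr.le

theorem bddAbove_norm_fderiv (hf : IsConformalIFS f U) (w : List (Fin S)) :
    BddAbove (range fun x : U => ‖fderiv ℝ (wordMap f w) (x : EuclideanSpace ℝ (Fin d))‖) := by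
  obtain ⟨r, hr, -, h⟩ := hf.exists_contraction_ratio
  refine ⟨r ^ w.length, ?_⟩
  rintro _ ⟨x, rfl⟩
  exact hf.norm_fderiv_wordMap_le_pow hr h w x.2

theorem norm_fderiv_le_derivNorm (hf : IsConformalIFS f U) (w : List (Fin S))
    {x : EuclideanSpace ℝ (Fin d)} (hx : x ∈ U) :
    ‖fderiv ℝ (wordMap f w) x‖ ≤ derivNorm f U w :=
  le_ciSup (hf.bddAbove_norm_fderiv w) (⟨x, hx⟩ : U)

omit [Nontrivial (EuclideanSpace ℝ (Fin d))] in
theorem derivNorm_le (hU : U.Nonempty) {w : List (Fin S)} {c : ℝ}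
    (h : ∀ x ∈ U, ‖fderiv ℝ (wordMap f w) x‖ ≤ c) : derivNorm f U w ≤ c := by
  have : Nonempty U := hU.to_subtype
  exact ciSup_le fun x => h x x.2

theorem dist_wordMap_le (hf : IsConformalIFS f U) (w : List (Fin S))
    {x y : EuclideanSpace ℝ (Fin d)} (hx : x ∈ U) (hy : y ∈ U) :
    dist (wordMap f w x) (wordMap f w y) ≤ derivNorm f U w * dist x y := by
  rw [dist_eq_norm, dist_eq_norm]
  exact Convex.norm_image_sub_le_of_norm_fderiv_le
    (fun z hz => hf.differentiableAt_wordMap w hz)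
    (fun z hz => hf.norm_fderiv_le_derivNorm w hz) hf.convex hy hx

omit [Nontrivial (EuclideanSpace ℝ (Fin d))] in
theorem injOn_wordMap (hf : IsConformalIFS f U) (w : List (Fin S)) : InjOn (wordMap f w) U := by
  induction w with
  | nil => exact injOn_id U
  | cons i w ih => exact (hf.injOn i).comp ih (mapsTo_wordMap hf.mapsTo_self w)

omit [Nontrivial (EuclideanSpace ℝ (Fin d))] in
/-- A compact core of `U` on which distortion is bounded. -/
theorem exists_compact_core (hf : IsConformalIFS f U) {O : Set (EuclideanSpace ℝ (Fin d))}
    (hO : IsOpen O) (hOn : O.Nonempty) (hOU : O ⊆ U) :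
    ∃ K : Set (EuclideanSpace ℝ (Fin d)), IsCompact K ∧ K ⊆ U ∧
      (∀ i, MapsTo (f i) (closure U) K) ∧ (K ∩ O).Nonempty ∧
      ∃ a, ∃ ρ > 0, Metric.ball a ρ ⊆ K ∩ O := by
  obtain ⟨a, ha⟩ := hOn
  obtain ⟨ρ, hρ, hball⟩ := Metric.isOpen_iff.1 hO a ha
  have hc : Metric.closedBall a (ρ / 2) ⊆ O :=
    (Metric.closedBall_subset_ball (by linarith)).trans hball
  have hcpt : IsCompact (closure U) := hf.bounded.isCompact_closure
  refine ⟨(⋃ i, f i '' closure U) ∪ Metric.closedBall a (ρ / 2), ?_, ?_, ?_, ?_, a, ρ / 2,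
    by linarith, ?_⟩
  · exact (isCompact_iUnion fun i => hcpt.image_of_continuousOn (hf.continuousOn i)).union
      (isCompact_closedBall _ _)
  · exact union_subset (iUnion_subset fun i => (hf.mapsTo i).image_subset) (hc.trans hOU)
  · exact fun i x hx => Or.inl (mem_iUnion.2 ⟨i, mem_image_of_mem _ hx⟩)
  · exact ⟨a, Or.inr (Metric.mem_closedBall_self (by linarith)), ha⟩
  · exact subset_inter (Metric.ball_subset_closedBall.trans subset_union_right)
      (Metric.ball_subset_closedBall.trans hc)

theorem exists_lower_bound (hf : IsConformalIFS f U) {K : Set (EuclideanSpace ℝ (Fin d))}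
    (hK : IsCompact K) (hKU : K ⊆ U) (hKn : K.Nonempty) :
    ∃ κ > 0, ∀ i, ∀ x ∈ K, κ ≤ ‖fderiv ℝ (f i) x‖ := by
  have h : ∀ i, ∃ κ > 0, ∀ x ∈ K, κ ≤ ‖fderiv ℝ (f i) x‖ := by
    intro i
    have hc : ContinuousOn (fun x => ‖fderiv ℝ (f i) x‖) K :=
      (((hf.conformal i).contDiffOn.continuousOn_fderiv_of_isOpen hf.isOpen le_rfl).mono hKU).norm
    obtain ⟨x, hx, hmin⟩ := hK.exists_isMinOn hKn hc
    exact ⟨_, hf.norm_fderiv_pos i (hKU hx), fun y hy => hmin hy⟩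
  choose κ hκ hb using h
  have : Nonempty (Fin S) := ⟨⟨0, by have := hf.two_le; omega⟩⟩
  obtain ⟨i₀, hi₀⟩ := Finite.exists_min κ
  exact ⟨κ i₀, hκ i₀, fun i x hx => (hi₀ i).trans (hb i x hx)⟩

/-- Bounded distortion on a compact core. -/
theorem exists_distortion (hf : IsConformalIFS f U) {K : Set (EuclideanSpace ℝ (Fin d))}
    (hK : IsCompact K) (hKU : K ⊆ U) (hKn : K.Nonempty) (hmaps : ∀ i, MapsTo (f i) K K) :
    ∃ C : ℝ, 1 ≤ C ∧ ∀ w : List (Fin S), ∀ x ∈ K, ∀ y ∈ K,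
      ‖fderiv ℝ (wordMap f w) x‖ ≤ C * ‖fderiv ℝ (wordMap f w) y‖ := by
  obtain ⟨κ, hκ, hlow⟩ := hf.exists_lower_bound hK hKU hKn
  obtain ⟨r, hr, hr1, hle⟩ := hf.exists_contraction_ratio
  have hUn : U.Nonempty := hKn.mono hKU
  set D := Metric.diam U with hD
  have hdist : ∀ w : List (Fin S), ∀ x ∈ K, ∀ y ∈ K,
      dist (wordMap f w x) (wordMap f w y) ≤ r ^ w.length * D := by
    intro w x hx y hy
    refine (hf.dist_wordMap_le w (hKU hx) (hKU hy)).trans ?_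
    exact mul_le_mul (derivNorm_le hUn fun z hz => hf.norm_fderiv_wordMap_le_pow hr hle w hz)
      (Metric.dist_le_diam_of_mem hf.bounded (hKU hx) (hKU hy)) dist_nonneg (by positivity)
  -- Hölder continuity divided by the lower bound κ turns closeness at scale r^n into a ratio at
  -- most 1 + B q^n, where q = r^α.
  have hone : ∀ i, ∃ q B : ℝ, 0 ≤ q ∧ q < 1 ∧ 0 ≤ B ∧ ∀ n : ℕ, ∀ x ∈ K, ∀ y ∈ K,
      dist x y ≤ r ^ n * D →
      ‖fderiv ℝ (f i) x‖ ≤ Real.exp (B * q ^ n) * ‖fderiv ℝ (f i) y‖ := by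
    intro i
    obtain ⟨α, hα, c, hc, hh⟩ := (hf.conformal i).holder
    refine ⟨r ^ α, c / κ * D ^ α, by positivity, Real.rpow_lt_one hr.le hr1 hα,
      by have : 0 ≤ D := Metric.diam_nonneg
         positivity, ?_⟩
    intro n x hx y hy hxy
    have hDn : 0 ≤ D := Metric.diam_nonneg
    have h1 := hh x (hKU hx) y (hKU hy)
    rw [← dist_eq_norm x y] at h1
    have h2 : dist x y ^ α ≤ (r ^ α) ^ n * D ^ α := by
      calc dist x y ^ α ≤ (r ^ n * D) ^ α := Real.rpow_le_rpow dist_nonneg hxy hα.le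
        _ = (r ^ α) ^ n * D ^ α := by
          rw [Real.mul_rpow (by positivity) hDn, ← Real.rpow_natCast, ← Real.rpow_natCast,
            ← Real.rpow_mul hr.le, ← Real.rpow_mul hr.le, mul_comm (n : ℝ) α]
    have h3 := hlow i y hy
    have h4 : ‖fderiv ℝ (f i) x‖ ≤ ‖fderiv ℝ (f i) y‖ + c * ((r ^ α) ^ n * D ^ α) := by
      have := norm_le_norm_add_norm_sub (fderiv ℝ (f i) y) (fderiv ℝ (f i) x)
      rw [norm_sub_rev] at this
      nlinarith [mul_le_mul_of_nonneg_left h2 hc.le]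
    have h5 : c * ((r ^ α) ^ n * D ^ α) ≤
        c / κ * D ^ α * (r ^ α) ^ n * ‖fderiv ℝ (f i) y‖ := by
      have h6 : c * ((r ^ α) ^ n * D ^ α) = c / κ * D ^ α * (r ^ α) ^ n * κ := by
        field_simp
      rw [h6]
      gcongr
    have h7 := Real.add_one_le_exp (c / κ * D ^ α * (r ^ α) ^ n)
    nlinarith [mul_le_mul_of_nonneg_right h7 (norm_nonneg (fderiv ℝ (f i) y))]
  choose q B hq0 hq1 hB hqB using hone
  have : Nonempty (Fin S) := ⟨⟨0, by have := hf.two_le; omega⟩⟩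
  obtain ⟨i₀, hi₀⟩ := Finite.exists_max q
  obtain ⟨i₁, hi₁⟩ := Finite.exists_max B
  set Q := q i₀
  set b := B i₁
  -- By the chain rule, the letter applied after n others contributes exp(b Q^n); the exponents add
  -- up to a geometric sum bounded independently of the word.
  have hbound : ∀ w : List (Fin S), ∀ x ∈ K, ∀ y ∈ K, ‖fderiv ℝ (wordMap f w) x‖ ≤
      Real.exp (b * ∑ k ∈ Finset.range w.length, Q ^ k) * ‖fderiv ℝ (wordMap f w) y‖ := by
    intro w x hx y hy
    induction w with
    | nil => rw [wordMap_nil]; simp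
    | cons i w ih =>
      rw [hf.norm_fderiv_wordMap_cons i w (hKU hx), hf.norm_fderiv_wordMap_cons i w (hKU hy),
        List.length_cons, Finset.sum_range_succ, mul_add, Real.exp_add]
      have h1 := hqB i w.length _ (mapsTo_wordMap hmaps w hx) _ (mapsTo_wordMap hmaps w hy)
        (hdist w x hx y hy)
      have h2 : Real.exp (B i * q i ^ w.length) ≤ Real.exp (b * Q ^ w.length) := by
        exact Real.exp_le_exp.2 (mul_le_mul (hi₁ i) (pow_le_pow_left₀ (hq0 i) (hi₀ i) _)
          (pow_nonneg (hq0 i) _) (hB i₁))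
      calc ‖fderiv ℝ (f i) (wordMap f w x)‖ * ‖fderiv ℝ (wordMap f w) x‖
          ≤ (Real.exp (b * Q ^ w.length) * ‖fderiv ℝ (f i) (wordMap f w y)‖) *
            (Real.exp (b * ∑ k ∈ Finset.range w.length, Q ^ k) *
              ‖fderiv ℝ (wordMap f w) y‖) := by
            gcongr
            exact h1.trans (by gcongr)
        _ = _ := by ring
  refine ⟨Real.exp (b * (1 - Q)⁻¹), ?_, fun w x hx y hy => (hbound w x hx y hy).trans ?_⟩
  · exact Real.one_le_exp (mul_nonneg (hB i₁) (inv_nonneg.2 (by linarith [hq1 i₀])))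
  · gcongr
    · exact hB i₁
    · rw [← tsum_geometric_of_lt_one (hq0 i₀) (hq1 i₀)]
      exact (summable_geometric_of_lt_one (hq0 i₀) (hq1 i₀)).sum_le_tsum _
        fun k _ => pow_nonneg (hq0 i₀) k

end IsConformalIFS

end WordMap

/-! ### Quasi-multiplicative functions on words -/

/-- A positive function of words that is multiplicative up to a constant factor and decays
exponentially with the length. -/
structure IsQuasiMultiplicative {S : ℕ} (D : List (Fin S) → ℝ) (C κ r : ℝ) : Prop where
  one_le : 1 ≤ C
  lower_pos : 0 < κ
  ratio_pos : 0 < r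
  ratio_lt_one : r < 1
  nil : D [] = 1
  append_le : ∀ u w, D (u ++ w) ≤ D u * D w
  le_append : ∀ u w, D u * D w ≤ C * D (u ++ w)
  pow_le : ∀ w, κ ^ w.length ≤ D w
  le_pow : ∀ w, D w ≤ r ^ w.length

/-! ### Derivative norms: quasi-multiplicativity and the open set condition. -/

section

variable {d S : ℕ} {f : Fin S → EuclideanSpace ℝ (Fin d) → EuclideanSpace ℝ (Fin d)}
  {U : Set (EuclideanSpace ℝ (Fin d))}

/-- In a one-point space the images of O under two different maps would be the same point,
contradicting disjointness. -/
theorem OpenSetCondition.nontrivial (hosc : OpenSetCondition f U) (hS : 2 ≤ S) :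
    Nontrivial (EuclideanSpace ℝ (Fin d)) := by
  by_contra h
  rw [not_nontrivial_iff_subsingleton] at h
  obtain ⟨O, -, ⟨x, hx⟩, -, -, hd⟩ := hosc
  have h01 : (⟨0, by omega⟩ : Fin S) ≠ ⟨1, by omega⟩ := by simp
  refine disjoint_left.1 (hd _ _ h01) (mem_image_of_mem _ hx) ?_
  rw [Subsingleton.elim (f ⟨0, by omega⟩ x) (f ⟨1, by omega⟩ x)]
  exact mem_image_of_mem _ hx

variable [Nontrivial (EuclideanSpace ℝ (Fin d))]

/-- Distortion is controlled only on K, while the supremum runs over U. The innermost letter of the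
word already maps U into K, so the distortion bound applies to the rest, and that letter costs a
factor 1/κ. -/
theorem IsConformalIFS.exists_derivNorm_le (hf : IsConformalIFS f U)
    {K : Set (EuclideanSpace ℝ (Fin d))} (hK : IsCompact K) (hKU : K ⊆ U) (hKn : K.Nonempty)
    (hmaps : ∀ i, MapsTo (f i) (closure U) K) :
    ∃ C : ℝ, 1 ≤ C ∧ ∀ w, ∀ y ∈ K, derivNorm f U w ≤ C * ‖fderiv ℝ (wordMap f w) y‖ := by
  have hmK : ∀ i, MapsTo (f i) K K := fun i x hx => hmaps i (subset_closure (hKU hx))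
  obtain ⟨κ, hκ, hlow⟩ := hf.exists_lower_bound hK hKU hKn
  obtain ⟨r, hr, hr1, hle⟩ := hf.exists_contraction_ratio
  obtain ⟨C, hC, hdist⟩ := hf.exists_distortion hK hKU hKn hmK
  have hUn := hKn.mono hKU
  refine ⟨max 1 (C / κ), le_max_left _ _, fun w y hy => derivNorm_le hUn fun x hx => ?_⟩
  rcases List.eq_nil_or_concat w with rfl | ⟨w, i, rfl⟩
  · rw [wordMap_nil]; simp
  · rw [List.concat_eq_append, hf.norm_fderiv_wordMap_append _ _ hx,
      hf.norm_fderiv_wordMap_append _ _ (hKU hy)]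
    have h1 := hdist w _ (hmaps i (subset_closure hx)) _ (hmaps i (subset_closure (hKU hy)))
    have h2 := hle i x hx
    have h3 := hlow i y hy
    have hw : wordMap f [i] = f i := rfl
    rw [hw]
    calc ‖fderiv ℝ (wordMap f w) (f i x)‖ * ‖fderiv ℝ (f i) x‖
        ≤ (C * ‖fderiv ℝ (wordMap f w) (f i y)‖) * 1 := by
          gcongr
          exact h2.trans hr1.le
      _ ≤ (C * ‖fderiv ℝ (wordMap f w) (f i y)‖) * (‖fderiv ℝ (f i) y‖ / κ) := by
          gcongr
          rwa [one_le_div hκ]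
      _ = C / κ * (‖fderiv ℝ (wordMap f w) (f i y)‖ * ‖fderiv ℝ (f i) y‖) := by ring
      _ ≤ _ := by gcongr; exact le_max_right _ _

theorem IsConformalIFS.exists_isQuasiMultiplicative (hf : IsConformalIFS f U)
    (hosc : OpenSetCondition f U) :
    ∃ C κ r : ℝ, IsQuasiMultiplicative (derivNorm f U) C κ r := by
  obtain ⟨O, hO, hOn, hOU, -⟩ := hosc
  obtain ⟨K, hK, hKU, hmaps, ⟨y, hy, -⟩, -⟩ := hf.exists_compact_core hO hOn hOU
  have hKn : K.Nonempty := ⟨y, hy⟩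
  have hUn := hKn.mono hKU
  have hmK : ∀ i, MapsTo (f i) K K := fun i x hx => hmaps i (subset_closure (hKU hx))
  obtain ⟨κ, hκ, hlow⟩ := hf.exists_lower_bound hK hKU hKn
  obtain ⟨r, hr, hr1, hle⟩ := hf.exists_contraction_ratio
  obtain ⟨C, hC, hCD⟩ := hf.exists_derivNorm_le hK hKU hKn hmaps
  have hpos : ∀ w, 0 ≤ derivNorm f U w := fun w =>
    (norm_nonneg _).trans (hf.norm_fderiv_le_derivNorm w (hKU hy))
  -- Two factors C: each of ‖f'_u‖ and ‖f'_w‖ is compared with a derivative along the orbit of the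
  -- single point y.
  refine ⟨C * C, κ, r, by nlinarith, hκ, hr, hr1, ?_, ?_, ?_, ?_, ?_⟩
  · refine le_antisymm (derivNorm_le hUn fun x _ => by rw [wordMap_nil]; simp) ?_
    refine le_trans ?_ (hf.norm_fderiv_le_derivNorm [] (hKU hy))
    rw [wordMap_nil]; simp
  · intro u w
    refine derivNorm_le hUn fun x hx => ?_
    rw [hf.norm_fderiv_wordMap_append u w hx]
    exact mul_le_mul (hf.norm_fderiv_le_derivNorm u (mapsTo_wordMap hf.mapsTo_self w hx))
      (hf.norm_fderiv_le_derivNorm w hx) (norm_nonneg _) (hpos u)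
  · intro u w
    have h1 := hCD u _ (mapsTo_wordMap hmK w hy)
    have h2 := hCD w y hy
    have h3 := hf.norm_fderiv_le_derivNorm (u ++ w) (hKU hy)
    rw [hf.norm_fderiv_wordMap_append u w (hKU hy)] at h3
    calc derivNorm f U u * derivNorm f U w
        ≤ (C * ‖fderiv ℝ (wordMap f u) (wordMap f w y)‖) * (C * ‖fderiv ℝ (wordMap f w) y‖) :=
          mul_le_mul h1 h2 (hpos w) (by positivity)
      _ = C * C * (‖fderiv ℝ (wordMap f u) (wordMap f w y)‖ * ‖fderiv ℝ (wordMap f w) y‖) := by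
          ring
      _ ≤ _ := by gcongr
  · intro w
    refine le_trans ?_ (hf.norm_fderiv_le_derivNorm w (hKU hy))
    induction w with
    | nil => rw [wordMap_nil]; simp
    | cons i w ih =>
      rw [hf.norm_fderiv_wordMap_cons i w (hKU hy), List.length_cons, pow_succ']
      exact mul_le_mul (hlow i _ (mapsTo_wordMap hmK w hy)) ih (by positivity) (norm_nonneg _)
  · exact fun w => derivNorm_le hUn fun x hx => hf.norm_fderiv_wordMap_le_pow hr hle w hx

/-! ### Counting cylinders of comparable size -/

omit [Nontrivial (EuclideanSpace ℝ (Fin d))] in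
-- Strip the common prefix: at the first different letter the images of O are disjoint, and
-- injectivity carries this through the common prefix.
theorem disjoint_wordMap_image (hf : IsConformalIFS f U) {O : Set (EuclideanSpace ℝ (Fin d))}
    (hOU : O ⊆ U) (hmaps : ∀ i, f i '' O ⊆ O)
    (hdisj : ∀ i j, i ≠ j → Disjoint (f i '' O) (f j '' O)) :
    ∀ u w : List (Fin S), ¬ u <+: w → ¬ w <+: u →
      Disjoint (wordMap f u '' O) (wordMap f w '' O) := by
  have hmO : ∀ i, MapsTo (f i) O O := fun i => mapsTo_iff_image_subset.2 (hmaps i)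
  intro u
  induction u with
  | nil => exact fun w h => absurd List.nil_prefix h
  | cons i u ih =>
    intro w h1 h2
    cases w with
    | nil => exact absurd List.nil_prefix h2
    | cons j w =>
      rw [wordMap_cons, wordMap_cons, image_comp, image_comp]
      have hu := (mapsTo_wordMap hmO u).image_subset
      have hw := (mapsTo_wordMap hmO w).image_subset
      by_cases hij : i = j
      · subst hij
        rw [List.cons_prefix_cons] at h1 h2
        exact (ih w (by tauto) (by tauto)).image (hf.injOn i) (hu.trans hOU) (hw.trans hOU)
      · exact (hdisj i j hij).mono (image_mono hu) (image_mono hw)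

open MeasureTheory in
-- The image of the unit ball contains the ball of radius c; compare volumes.
theorem ofReal_pow_finrank_le_abs_det {E : Type*} [NormedAddCommGroup E] [NormedSpace ℝ E]
    [FiniteDimensional ℝ E] [MeasurableSpace E] [BorelSpace E] [Nontrivial E]
    (μ : Measure E) [μ.IsAddHaarMeasure] (A : E →L[ℝ] E) {c : ℝ} (hc : 0 < c)
    (hA : ∀ y, ‖A y‖ = c * ‖y‖) :
    ENNReal.ofReal (c ^ Module.finrank ℝ E) ≤ ENNReal.ofReal |A.det| := by
  have hinj : Function.Injective A := by
    rw [injective_iff_map_eq_zero]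
    intro y hy
    have := hA y
    rw [hy, norm_zero] at this
    rcases mul_eq_zero.1 this.symm with h | h
    · exact absurd h hc.ne'
    · exact norm_eq_zero.1 h
  have hsurj : Function.Surjective A :=
    (LinearMap.injective_iff_surjective (f := (A : E →ₗ[ℝ] E))).1 hinj
  have hsub : Metric.ball (0 : E) c ⊆ A '' Metric.ball 0 1 := by
    intro z hz
    obtain ⟨y, rfl⟩ := hsurj z
    refine mem_image_of_mem _ ?_
    rw [mem_ball_zero_iff] at hz ⊢
    rw [hA] at hz
    by_contra h
    nlinarith
  have h := measure_mono (μ := μ) hsub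
  rw [Measure.addHaar_image_continuousLinearMap, Measure.addHaar_ball μ 0 hc.le] at h
  have h0 : μ (Metric.ball 0 1) ≠ 0 := (Metric.measure_ball_pos μ 0 one_pos).ne'
  have ht : μ (Metric.ball 0 1) ≠ ⊤ := measure_ball_lt_top.ne
  exact (ENNReal.mul_le_mul_iff_left h0 ht).1 h

open MeasureTheory in
/-- Under the open set condition, boundedly many cylinders of size comparable to `ρ` meet a given
set of diameter at most `ρ`. -/
theorem IsConformalIFS.exists_card_le (hf : IsConformalIFS f U) (hosc : OpenSetCondition f U)
    {κ : ℝ} (hκ : 0 < κ) :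
    ∃ N : ℕ, ∀ ρ > 0, ∀ A : Set (EuclideanSpace ℝ (Fin d)), (∀ x ∈ A, ∀ y ∈ A, dist x y ≤ ρ) →
      ∀ W : Finset (List (Fin S)), (∀ u ∈ W, ∀ w ∈ W, u <+: w → u = w) →
        (∀ w ∈ W, κ * ρ ≤ derivNorm f U w) → (∀ w ∈ W, derivNorm f U w ≤ ρ) →
        (∀ w ∈ W, ∃ x ∈ U, wordMap f w x ∈ A) → W.card ≤ N := by
  obtain ⟨O, hO, hOn, hOU, hOm, hOd⟩ := hosc
  obtain ⟨K, hK, hKU, hmaps, ⟨y, hy, -⟩, a, ρ₀, hρ₀, hball⟩ := hf.exists_compact_core hO hOn hOU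
  obtain ⟨C, hC, hCD⟩ := hf.exists_derivNorm_le hK hKU ⟨y, hy⟩ hmaps
  set n := Module.finrank ℝ (EuclideanSpace ℝ (Fin d))
  set R := 2 + Metric.diam U
  have hdiam : 0 ≤ Metric.diam U := Metric.diam_nonneg
  -- A volume ratio: disjoint images of a fixed ball, each of volume at least that of a ball of
  -- radius κρρ₀/C, all lie in one ball of radius Rρ.
  refine ⟨⌊(R * C / (κ * ρ₀)) ^ n⌋₊, ?_⟩
  intro ρ hρ A hA W hW hlow hup hmeet
  rcases W.eq_empty_or_nonempty with rfl | ⟨w₀, hw₀⟩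
  · simp
  obtain ⟨x₀, -, hp⟩ := hmeet w₀ hw₀
  set p := wordMap f w₀ x₀
  set B := Metric.ball a ρ₀
  set V := (volume : Measure (EuclideanSpace ℝ (Fin d))) (Metric.ball 0 1)
  have hV0 : V ≠ 0 := (Metric.measure_ball_pos _ 0 one_pos).ne'
  have hVt : V ≠ ⊤ := measure_ball_lt_top.ne
  have hBU : B ⊆ U := fun z hz => hKU (hball hz).1
  have hfd : ∀ w, ∀ x ∈ B, HasFDerivWithinAt (wordMap f w) (fderiv ℝ (wordMap f w) x) B x :=
    fun w x hx => (hf.differentiableAt_wordMap w (hBU hx)).hasFDerivAt.hasFDerivWithinAt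
  have hinj : ∀ w, InjOn (wordMap f w) B := fun w => (hf.injOn_wordMap w).mono hBU
  have hvol : ∀ w ∈ W, ENNReal.ofReal ((κ * ρ / C * ρ₀) ^ n) * V ≤ volume (wordMap f w '' B) := by
    intro w hw
    rw [← lintegral_abs_det_fderiv_eq_addHaar_image volume measurableSet_ball (hfd w) (hinj w)]
    calc ENNReal.ofReal ((κ * ρ / C * ρ₀) ^ n) * V
        = ENNReal.ofReal ((κ * ρ / C) ^ n) * volume B := by
          rw [Measure.addHaar_ball volume a hρ₀.le, mul_pow, ENNReal.ofReal_mul (by positivity),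
            mul_assoc]
      _ = ∫⁻ _ in B, ENNReal.ofReal ((κ * ρ / C) ^ n) := by rw [setLIntegral_const]
      _ ≤ _ := by
        refine setLIntegral_mono' measurableSet_ball fun x hx => ?_
        have h1 : κ * ρ / C ≤ ‖fderiv ℝ (wordMap f w) x‖ := by
          rw [div_le_iff₀ (by linarith), mul_comm _ C]
          exact (hlow w hw).trans (hCD w x (hball hx).1)
        refine le_trans (ENNReal.ofReal_le_ofReal (pow_le_pow_left₀ (by positivity) h1 n)) ?_
        exact ofReal_pow_finrank_le_abs_det volume _ (hf.norm_fderiv_wordMap_pos w (hBU hx))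
          (hf.wordMap_fderiv w (hBU hx)).1
  have hsub : (⋃ w ∈ W, wordMap f w '' B) ⊆ Metric.ball p (R * ρ) := by
    refine iUnion₂_subset fun w hw => ?_
    rintro _ ⟨z, hz, rfl⟩
    obtain ⟨x, hxU, hxA⟩ := hmeet w hw
    rw [Metric.mem_ball]
    calc dist (wordMap f w z) p ≤ dist (wordMap f w z) (wordMap f w x) + dist (wordMap f w x) p :=
          dist_triangle _ _ _
      _ ≤ ρ * Metric.diam U + ρ := by
          refine add_le_add ((hf.dist_wordMap_le w (hBU hz) hxU).trans ?_) (hA _ hxA _ hp)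
          exact mul_le_mul (hup w hw) (Metric.dist_le_diam_of_mem hf.bounded (hBU hz) hxU)
            dist_nonneg hρ.le
      _ < R * ρ := by simp only [R]; nlinarith
  have hmeas : ∀ w ∈ W, MeasurableSet (wordMap f w '' B) := fun w _ =>
    measurable_image_of_fderivWithin measurableSet_ball (hfd w) (hinj w)
  have hdis : (W : Set (List (Fin S))).PairwiseDisjoint fun w => wordMap f w '' B := by
    intro u hu w hw huw
    refine (disjoint_wordMap_image hf hOU hOm hOd u w (fun h => huw (hW u hu w hw h))
      (fun h => huw (hW w hw u hu h).symm)).mono ?_ ?_ <;>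
    exact image_mono fun z hz => (hball hz).2
  have htot : (W.card : ENNReal) * (ENNReal.ofReal ((κ * ρ / C * ρ₀) ^ n) * V) ≤
      ENNReal.ofReal ((R * ρ) ^ n) * V := by
    calc (W.card : ENNReal) * (ENNReal.ofReal ((κ * ρ / C * ρ₀) ^ n) * V)
        = ∑ w ∈ W, ENNReal.ofReal ((κ * ρ / C * ρ₀) ^ n) * V := by
          rw [Finset.sum_const, nsmul_eq_mul]
      _ ≤ ∑ w ∈ W, volume (wordMap f w '' B) := Finset.sum_le_sum hvol
      _ = volume (⋃ w ∈ W, wordMap f w '' B) := (measure_biUnion_finset hdis hmeas).symm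
      _ ≤ volume (Metric.ball p (R * ρ)) := measure_mono hsub
      _ = _ := Measure.addHaar_ball volume p (by positivity)
  rw [← mul_assoc, ENNReal.mul_le_mul_iff_left hV0 hVt, ← ENNReal.ofReal_natCast,
    ← ENNReal.ofReal_mul (by positivity), ENNReal.ofReal_le_ofReal_iff (by positivity)] at htot
  refine Nat.le_floor ?_
  have hC0 : 0 < C := by linarith
  have h2 : (R * ρ) ^ n = (R * C / (κ * ρ₀)) ^ n * (κ * ρ / C * ρ₀) ^ n := by
    rw [← mul_pow]; congr 1; field_simp
  rw [h2] at htot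
  exact le_of_mul_le_mul_right htot (by positivity)

end

/-! ### Pressure of a quasi-multiplicative function -/

/-- The partition sum `∑_{|w| = n} D w ^ s`. -/
def partitionSum {S : ℕ} (D : List (Fin S) → ℝ) (s : ℝ) (n : ℕ) : ℝ :=
  ∑ w : Fin n → Fin S, D (List.ofFn w) ^ s

/-- The exponential growth rate of the partition sums. -/
def symbolicPressure {S : ℕ} (D : List (Fin S) → ℝ) (s : ℝ) : ℝ :=
  limUnder atTop fun n : ℕ => (1 / (n : ℝ)) * Real.log (partitionSum D s n)

namespace IsQuasiMultiplicative

variable {S : ℕ} {D : List (Fin S) → ℝ} {C κ r : ℝ}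

theorem pos (h : IsQuasiMultiplicative D C κ r) (w : List (Fin S)) : 0 < D w :=
  (pow_pos h.lower_pos _).trans_le (h.pow_le w)

theorem le_one (h : IsQuasiMultiplicative D C κ r) (w : List (Fin S)) : D w ≤ 1 :=
  (h.le_pow w).trans (pow_le_one₀ h.ratio_pos.le h.ratio_lt_one.le)

theorem const_pos (h : IsQuasiMultiplicative D C κ r) : 0 < C := one_pos.trans_le h.one_le

theorem log_ratio_neg (h : IsQuasiMultiplicative D C κ r) : Real.log r < 0 :=
  Real.log_neg h.ratio_pos h.ratio_lt_one

theorem log_le (h : IsQuasiMultiplicative D C κ r) (w : List (Fin S)) :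
    Real.log (D w) ≤ w.length * Real.log r := by
  rw [← Real.log_pow]; exact Real.log_le_log (h.pos w) (h.le_pow w)

theorem le_log (h : IsQuasiMultiplicative D C κ r) (w : List (Fin S)) :
    w.length * Real.log κ ≤ Real.log (D w) := by
  rw [← Real.log_pow]; exact Real.log_le_log (pow_pos h.lower_pos _) (h.pow_le w)

theorem log_append_le (h : IsQuasiMultiplicative D C κ r) (u w : List (Fin S)) :
    Real.log (D (u ++ w)) ≤ Real.log (D u) + Real.log (D w) := by
  rw [← Real.log_mul (h.pos u).ne' (h.pos w).ne']
  exact Real.log_le_log (h.pos _) (h.append_le u w)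

theorem le_log_append (h : IsQuasiMultiplicative D C κ r) (u w : List (Fin S)) :
    Real.log (D u) + Real.log (D w) ≤ Real.log C + Real.log (D (u ++ w)) := by
  rw [← Real.log_mul (h.pos u).ne' (h.pos w).ne', ← Real.log_mul h.const_pos.ne' (h.pos _).ne']
  exact Real.log_le_log (mul_pos (h.pos u) (h.pos w)) (h.le_append u w)

theorem log_const_nonneg (h : IsQuasiMultiplicative D C κ r) : 0 ≤ Real.log C :=
  Real.log_nonneg h.one_le

variable [NeZero S]

theorem log_lower_neg (h : IsQuasiMultiplicative D C κ r) : Real.log κ < 0 := by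
  have h1 := (h.le_log [0]).trans (h.log_le [0])
  have h2 := h.log_ratio_neg
  simp only [List.length_singleton, Nat.cast_one, one_mul] at h1
  linarith

theorem partitionSum_pos (h : IsQuasiMultiplicative D C κ r) (s : ℝ) (n : ℕ) :
    0 < partitionSum D s n :=
  Finset.sum_pos (fun _ _ => Real.rpow_pos_of_pos (h.pos _) s) Finset.univ_nonempty

omit [NeZero S] in
theorem partitionSum_add (s : ℝ) (m n : ℕ) : partitionSum D s (m + n) =
    ∑ u : Fin m → Fin S, ∑ w : Fin n → Fin S, D (List.ofFn u ++ List.ofFn w) ^ s := by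
  rw [partitionSum, ← (Fin.appendEquiv m n).sum_comp, Fintype.sum_prod_type]
  refine Finset.sum_congr rfl fun u _ => Finset.sum_congr rfl fun w _ => ?_
  rw [← List.ofFn_fin_append]; rfl

omit [NeZero S] in
theorem partitionSum_add_le (h : IsQuasiMultiplicative D C κ r) {s : ℝ} (hs : 0 ≤ s) (m n : ℕ) :
    partitionSum D s (m + n) ≤ partitionSum D s m * partitionSum D s n := by
  rw [partitionSum_add, partitionSum, partitionSum, Finset.sum_mul_sum]
  refine Finset.sum_le_sum fun u _ => Finset.sum_le_sum fun w _ => ?_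
  rw [← Real.mul_rpow (h.pos _).le (h.pos _).le]
  exact Real.rpow_le_rpow (h.pos _).le (h.append_le _ _) hs

omit [NeZero S] in
theorem le_partitionSum_add (h : IsQuasiMultiplicative D C κ r) {s : ℝ} (hs : 0 ≤ s) (m n : ℕ) :
    partitionSum D s m * partitionSum D s n ≤ C ^ s * partitionSum D s (m + n) := by
  rw [partitionSum_add, partitionSum, partitionSum, Finset.sum_mul_sum, Finset.mul_sum]
  refine Finset.sum_le_sum fun u _ => ?_
  rw [Finset.mul_sum]
  refine Finset.sum_le_sum fun w _ => ?_
  rw [← Real.mul_rpow (h.pos _).le (h.pos _).le, ← Real.mul_rpow h.const_pos.le (h.pos _).le]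
  exact Real.rpow_le_rpow (mul_pos (h.pos _) (h.pos _)).le (h.le_append _ _) hs

theorem le_partitionSum (h : IsQuasiMultiplicative D C κ r) {s : ℝ} (hs : 0 ≤ s) (n : ℕ) :
    (κ ^ s) ^ n ≤ partitionSum D s n := by
  have h1 : (κ ^ s) ^ n ≤ D (List.ofFn fun _ : Fin n => (0 : Fin S)) ^ s := by
    have := h.pow_le (List.ofFn fun _ : Fin n => (0 : Fin S))
    rw [List.length_ofFn] at this
    rw [← Real.rpow_natCast, ← Real.rpow_mul h.lower_pos.le, mul_comm,
      Real.rpow_mul h.lower_pos.le, Real.rpow_natCast]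
    exact Real.rpow_le_rpow (pow_pos h.lower_pos n).le this hs
  refine h1.trans ?_
  exact Finset.single_le_sum (f := fun w : Fin n → Fin S => D (List.ofFn w) ^ s)
    (fun w _ => (Real.rpow_pos_of_pos (h.pos _) s).le) (Finset.mem_univ _)

omit [NeZero S] in
theorem partitionSum_le (h : IsQuasiMultiplicative D C κ r) {s : ℝ} (hs : 0 ≤ s) (n : ℕ) :
    partitionSum D s n ≤ (S : ℝ) ^ n := by
  calc partitionSum D s n ≤ ∑ _w : Fin n → Fin S, (1 : ℝ) :=
        Finset.sum_le_sum fun w _ => Real.rpow_le_one (h.pos _).le (h.le_one _) hs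
    _ = _ := by simp

theorem log_partitionSum_mem (h : IsQuasiMultiplicative D C κ r) {s : ℝ} (hs : 0 ≤ s) (n : ℕ) :
    Real.log (partitionSum D s n) / n ∈ Icc (s * Real.log κ) (Real.log S) := by
  rcases Nat.eq_zero_or_pos n with rfl | hn
  · simp only [Nat.cast_zero, div_zero, mem_Icc]
    exact ⟨mul_nonpos_of_nonneg_of_nonpos hs h.log_lower_neg.le,
      Real.log_natCast_nonneg S⟩
  · have hn' : (0 : ℝ) < n := Nat.cast_pos.2 hn
    constructor
    · rw [le_div_iff₀ hn']
      have := Real.log_le_log (pow_pos (Real.rpow_pos_of_pos h.lower_pos s) n)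
        (h.le_partitionSum hs n)
      rw [Real.log_pow, Real.log_rpow h.lower_pos] at this
      linarith
    · rw [div_le_iff₀ hn']
      have := Real.log_le_log (h.partitionSum_pos s n) (h.partitionSum_le hs n)
      rw [Real.log_pow] at this
      linarith

theorem subadditive_log_partitionSum (h : IsQuasiMultiplicative D C κ r) {s : ℝ} (hs : 0 ≤ s) :
    Subadditive fun n => Real.log (partitionSum D s n) := by
  intro m n
  rw [← Real.log_mul (h.partitionSum_pos s m).ne' (h.partitionSum_pos s n).ne']
  exact Real.log_le_log (h.partitionSum_pos s _) (h.partitionSum_add_le hs m n)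

theorem tendsto_symbolicPressure (h : IsQuasiMultiplicative D C κ r) {s : ℝ} (hs : 0 ≤ s) :
    Tendsto (fun n : ℕ => Real.log (partitionSum D s n) / n) atTop
      (𝓝 (symbolicPressure D s)) := by
  have hb : BddBelow (range fun n : ℕ => Real.log (partitionSum D s n) / n) :=
    ⟨s * Real.log κ, by rintro _ ⟨n, rfl⟩; exact (h.log_partitionSum_mem hs n).1⟩
  have ht := (h.subadditive_log_partitionSum hs).tendsto_lim hb
  have heq : symbolicPressure D s = (h.subadditive_log_partitionSum hs).lim := by
    refine Tendsto.limUnder_eq (ht.congr fun n => ?_)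
    rw [div_eq_mul_inv, mul_comm, one_div]
  rwa [heq]

/-- For a subadditive sequence the Fekete limit is the infimum of the quotients. -/
theorem exp_le_partitionSum (h : IsQuasiMultiplicative D C κ r) {s : ℝ} (hs : 0 ≤ s) (n : ℕ) :
    Real.exp (n * symbolicPressure D s) ≤ partitionSum D s n := by
  rcases Nat.eq_zero_or_pos n with rfl | hn
  · simp [partitionSum, h.nil]
  have hb : BddBelow (range fun n : ℕ => Real.log (partitionSum D s n) / n) :=
    ⟨s * Real.log κ, by rintro _ ⟨n, rfl⟩; exact (h.log_partitionSum_mem hs n).1⟩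
  have hle := (h.subadditive_log_partitionSum hs).lim_le_div hb hn.ne'
  rw [tendsto_nhds_unique ((h.subadditive_log_partitionSum hs).tendsto_lim hb)
    (h.tendsto_symbolicPressure hs), le_div_iff₀ (Nat.cast_pos.2 hn), mul_comm] at hle
  rwa [← Real.le_log_iff_exp_le (h.partitionSum_pos s n)]

theorem partitionSum_le_exp (h : IsQuasiMultiplicative D C κ r) {s : ℝ} (hs : 0 ≤ s) (n : ℕ) :
    partitionSum D s n ≤ C ^ s * Real.exp (n * symbolicPressure D s) := by
  have hCs : 1 ≤ C ^ s := Real.one_le_rpow h.one_le hs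
  have hC0 : 0 < C ^ s := by linarith
  rcases Nat.eq_zero_or_pos n with rfl | hn
  · simpa [partitionSum, h.nil] using hCs
  -- Supermultiplicativity up to C^s makes this complementary sequence subadditive; its Fekete limit
  -- is minus the pressure.
  have hsub : Subadditive fun n => Real.log (C ^ s) - Real.log (partitionSum D s n) := by
    intro m n
    have h1 := Real.log_le_log (mul_pos (h.partitionSum_pos s m) (h.partitionSum_pos s n))
      (h.le_partitionSum_add hs m n)
    rw [Real.log_mul (h.partitionSum_pos s m).ne' (h.partitionSum_pos s n).ne',
      Real.log_mul hC0.ne' (h.partitionSum_pos s _).ne'] at h1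
    linarith
  have hL : 0 ≤ Real.log (C ^ s) := Real.log_nonneg hCs
  have hb : BddBelow
      (range fun n : ℕ => (Real.log (C ^ s) - Real.log (partitionSum D s n)) / n) := by
    refine ⟨-Real.log S, ?_⟩
    rintro _ ⟨n, rfl⟩
    have h1 := (h.log_partitionSum_mem hs n).2
    have h2 : 0 ≤ Real.log (C ^ s) / n := by positivity
    simp only [sub_div]
    linarith
  have hlim : Tendsto (fun n : ℕ => (Real.log (C ^ s) - Real.log (partitionSum D s n)) / n)
      atTop (𝓝 (0 - symbolicPressure D s)) := by
    simp only [sub_div]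
    exact (tendsto_const_div_atTop_nhds_zero_nat _).sub (h.tendsto_symbolicPressure hs)
  have hle := hsub.lim_le_div hb hn.ne'
  rw [tendsto_nhds_unique (hsub.tendsto_lim hb) hlim, le_div_iff₀ (Nat.cast_pos.2 hn)] at hle
  rw [← Real.log_le_log_iff (h.partitionSum_pos s n) (by positivity),
    Real.log_mul hC0.ne' (Real.exp_pos _).ne', Real.log_exp]
  linarith

theorem symbolicPressure_zero (h : IsQuasiMultiplicative D C κ r) :
    symbolicPressure D 0 = Real.log S := by
  refine tendsto_nhds_unique (h.tendsto_symbolicPressure le_rfl) ?_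
  refine tendsto_const_nhds.congr' ?_
  filter_upwards [eventually_gt_atTop 0] with n hn
  have : (n : ℝ) ≠ 0 := Nat.cast_ne_zero.2 hn.ne'
  simp [partitionSum]
  field_simp

/-- Termwise, raising the exponent by t - s multiplies each summand by D(w)^(t-s), which lies
between κ^(n(t-s)) and r^(n(t-s)). The pressure is therefore Lipschitz and strictly decreasing. -/
theorem symbolicPressure_sub_mem (h : IsQuasiMultiplicative D C κ r) {s t : ℝ} (hs : 0 ≤ s)
    (hst : s ≤ t) : symbolicPressure D t - symbolicPressure D s ∈
      Icc ((t - s) * Real.log κ) ((t - s) * Real.log r) := by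
  have hlim := (h.tendsto_symbolicPressure (hs.trans hst)).sub (h.tendsto_symbolicPressure hs)
  have hd : 0 ≤ t - s := by linarith
  have hpow : ∀ (a : ℝ), 0 < a → ∀ n : ℕ, (a ^ n) ^ (t - s) = (a ^ (t - s)) ^ n := by
    intro a ha n
    rw [← Real.rpow_natCast, ← Real.rpow_natCast, ← Real.rpow_mul ha.le, ← Real.rpow_mul ha.le,
      mul_comm]
  have hsplit : ∀ w : List (Fin S), D w ^ t = D w ^ (t - s) * D w ^ s := by
    intro w
    rw [← Real.rpow_add (h.pos w), sub_add_cancel]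
  constructor
  · refine ge_of_tendsto hlim ?_
    filter_upwards [eventually_gt_atTop 0] with n hn
    have hn' : (0 : ℝ) < n := Nat.cast_pos.2 hn
    have h1 : (κ ^ (t - s)) ^ n * partitionSum D s n ≤ partitionSum D t n := by
      rw [partitionSum, partitionSum, Finset.mul_sum]
      refine Finset.sum_le_sum fun w _ => ?_
      rw [hsplit, ← hpow κ h.lower_pos]
      have h2 := h.pow_le (List.ofFn w)
      rw [List.length_ofFn] at h2
      exact mul_le_mul_of_nonneg_right
        (Real.rpow_le_rpow (pow_pos h.lower_pos _).le h2 hd) (Real.rpow_nonneg (h.pos _).le _)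
    have hk : 0 < (κ ^ (t - s)) ^ n := pow_pos (Real.rpow_pos_of_pos h.lower_pos _) _
    have h3 := Real.log_le_log (mul_pos hk (h.partitionSum_pos s n)) h1
    rw [Real.log_mul hk.ne' (h.partitionSum_pos s n).ne', Real.log_pow,
      Real.log_rpow h.lower_pos] at h3
    rw [← sub_div, le_div_iff₀ hn']
    linarith
  · refine le_of_tendsto hlim ?_
    filter_upwards [eventually_gt_atTop 0] with n hn
    have hn' : (0 : ℝ) < n := Nat.cast_pos.2 hn
    have h1 : partitionSum D t n ≤ (r ^ (t - s)) ^ n * partitionSum D s n := by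
      rw [partitionSum, partitionSum, Finset.mul_sum]
      refine Finset.sum_le_sum fun w _ => ?_
      rw [hsplit, ← hpow r h.ratio_pos]
      have h2 := h.le_pow (List.ofFn w)
      rw [List.length_ofFn] at h2
      exact mul_le_mul_of_nonneg_right
        (Real.rpow_le_rpow (h.pos _).le h2 hd) (Real.rpow_nonneg (h.pos _).le _)
    have hk : 0 < (r ^ (t - s)) ^ n := pow_pos (Real.rpow_pos_of_pos h.ratio_pos _) _
    have h3 := Real.log_le_log (h.partitionSum_pos t n) h1
    rw [Real.log_mul hk.ne' (h.partitionSum_pos s n).ne', Real.log_pow,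
      Real.log_rpow h.ratio_pos] at h3
    rw [← sub_div, div_le_iff₀ hn']
    linarith

theorem continuousOn_symbolicPressure (h : IsQuasiMultiplicative D C κ r) :
    ContinuousOn (symbolicPressure D) (Ici 0) := by
  have hk := h.log_lower_neg
  have key : ∀ s t : ℝ, 0 ≤ s → s ≤ t →
      |symbolicPressure D t - symbolicPressure D s| ≤ -Real.log κ * |t - s| := by
    intro s t hs hst
    have h1 := h.symbolicPressure_sub_mem hs hst
    have h2 := h.log_ratio_neg
    have h3 : 0 ≤ t - s := by linarith
    rw [abs_of_nonneg h3, abs_le]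
    constructor <;> nlinarith [h1.1, h1.2]
  refine (LipschitzOnWith.of_dist_le_mul (K := ⟨-Real.log κ, by linarith⟩) ?_).continuousOn
  intro s hs t ht
  rw [Real.dist_eq, Real.dist_eq]
  rcases le_total s t with hst | hst
  · rw [abs_sub_comm, abs_sub_comm s]; exact key s t hs hst
  · exact key t s ht hst

/-- The left side is nonnegative at 0, as P(0) = log S ≥ 0, and decreases with slope at most b < 0;
it has exactly one zero. -/
theorem existsUnique_exponent (h : IsQuasiMultiplicative D C κ r) {a b : ℝ} (ha : 0 ≤ a)
    (hb : b < 0) : ∃! s : ℝ, 0 ≤ s ∧ a * symbolicPressure D s + s * b = 0 := by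
  set H : ℝ → ℝ := fun s => a * symbolicPressure D s + s * b with hH
  have hanti : ∀ s t : ℝ, 0 ≤ s → s ≤ t → H t ≤ H s + (t - s) * b := by
    intro s t hs hst
    have h1 := (h.symbolicPressure_sub_mem hs hst).2
    have h2 := h.log_ratio_neg
    have h3 : symbolicPressure D t ≤ symbolicPressure D s := by nlinarith
    simp only [hH]
    nlinarith
  have h0 : 0 ≤ H 0 := by
    simp only [hH, h.symbolicPressure_zero]
    have := mul_nonneg ha (Real.log_natCast_nonneg S)
    linarith
  -- A line of slope b starting at height H 0 reaches 0 here, so H is nonpositive at this point.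
  set s₁ := H 0 / -b with hs₁
  have hs₁0 : 0 ≤ s₁ := div_nonneg h0 (by linarith)
  have h1 : H s₁ ≤ 0 := by
    have := hanti 0 s₁ le_rfl hs₁0
    have h2 : s₁ * -b = H 0 := div_mul_cancel₀ _ (by linarith)
    linarith
  have hcont : ContinuousOn H (Icc 0 s₁) :=
    ((continuousOn_const.mul h.continuousOn_symbolicPressure).add
      (continuousOn_id.mul continuousOn_const)).mono Icc_subset_Ici_self
  obtain ⟨s, hs, hs0⟩ := intermediate_value_Icc' hs₁0 hcont ⟨h1, h0⟩
  refine ⟨s, ⟨hs.1, hs0⟩, ?_⟩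
  rintro t ⟨ht, ht0⟩
  change H t = 0 at ht0
  rcases lt_trichotomy s t with hst | hst | hst
  · have := hanti s t hs.1 hst.le
    nlinarith
  · exact hst.symm
  · have := hanti t s ht hst.le
    nlinarith

end IsQuasiMultiplicative

/-! ### Concatenations of initial words -/

section Words

variable {S : ℕ}

theorem length_subword (e : ℕ → Fin S) (m l : ℕ) : (subword e m l).length = l :=
  List.length_ofFn

theorem length_initialWord (e : ℕ → Fin S) (l : ℕ) : (initialWord e l).length = l :=
  length_subword e 0 l

theorem subword_add (e : ℕ → Fin S) (m k l : ℕ) :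
    subword e m (k + l) = subword e m k ++ subword e (m + k) l := by
  rw [subword, List.ofFn_add]
  simp [subword, add_assoc]

theorem initialWord_add (e : ℕ → Fin S) (k l : ℕ) :
    initialWord e (k + l) = initialWord e k ++ subword e k l := by
  rw [initialWord, subword_add, zero_add, initialWord]

theorem subword_congr {e e' : ℕ → Fin S} {m m' l : ℕ} :
    subword e m l = subword e' m' l ↔ ∀ i < l, e (m + i) = e' (m' + i) := by
  rw [subword, subword, List.ofFn_inj, funext_iff]
  exact ⟨fun h i hi => h ⟨i, hi⟩, fun h i => h i i.2⟩

/-- The concatenation `t|_{g (n-1)} ⋯ t|_{g 1} t|_{g 0}` of initial words of `t`. -/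
def blockWord (t : ℕ → Fin S) (g : ℕ → ℕ) (n : ℕ) : List (Fin S) :=
  (List.range n).reverse.flatMap fun q => initialWord t (g q)

theorem blockWord_succ (t : ℕ → Fin S) (g : ℕ → ℕ) (n : ℕ) :
    blockWord t g (n + 1) = initialWord t (g n) ++ blockWord t g n := by
  simp [blockWord, List.range_succ]

theorem exists_blockWord_add (t : ℕ → Fin S) (g : ℕ → ℕ) (n k : ℕ) :
    ∃ u : List (Fin S), u.length = ∑ q ∈ Finset.range k, g (n + q) ∧
      blockWord t g (n + k) = u ++ blockWord t g n := by
  induction k with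
  | zero => exact ⟨[], by simp⟩
  | succ k ih =>
    obtain ⟨u, hu, h⟩ := ih
    refine ⟨initialWord t (g (n + k)) ++ u, ?_, ?_⟩
    · rw [List.length_append, hu, length_initialWord, Finset.sum_range_succ, add_comm]
    · rw [← add_assoc, blockWord_succ, h, List.append_assoc]

theorem length_blockWord (t : ℕ → Fin S) (g : ℕ → ℕ) (n : ℕ) :
    (blockWord t g n).length = ∑ q ∈ Finset.range n, g q := by
  induction n with
  | zero => rfl
  | succ n ih =>
    rw [blockWord_succ, List.length_append, ih, length_initialWord, Finset.sum_range_succ,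
      add_comm]

theorem targetWord_eq (M : ℝ) (t : ℕ → Fin S) (θ v : ℝ) :
    targetWord M t θ v = blockWord t (fun q => ⌊v * M / θ ^ q⌋₊) (maxPower θ v M + 1) ++
      initialWord t ⌊θ * v * M⌋₊ := rfl

theorem le_maxPower {θ v M : ℝ} (hθ : 1 < θ) {p : ℕ} (hp : 1 ≤ v * M / θ ^ p) :
    p ≤ maxPower θ v M := by
  -- Boundedness of the set of exponents ensures that the supremum in ℕ is not the default value 0.
  refine le_csSup ?_ hp
  obtain ⟨n, hn⟩ := pow_unbounded_of_one_lt (v * M) hθ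
  refine ⟨n, fun q hq => ?_⟩
  by_contra! hlt
  have h1 : (1 : ℝ) ≤ v * M / θ ^ q := hq
  rw [le_div_iff₀ (by positivity), one_mul] at h1
  linarith [pow_le_pow_right₀ hθ.le hlt.le]

theorem sum_floor_geometric_le {θ x : ℝ} (hθ : 1 < θ) (hx : 0 ≤ x) (n k : ℕ) :
    ((∑ q ∈ Finset.range k, ⌊x / θ ^ (n + q)⌋₊ : ℕ) : ℝ) ≤ x / θ ^ n * (θ / (θ - 1)) := by
  have hθ0 : 0 < θ := by linarith
  have hinv : (θ⁻¹ : ℝ) < 1 := inv_lt_one_of_one_lt₀ hθ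
  push_cast
  calc ∑ q ∈ Finset.range k, (⌊x / θ ^ (n + q)⌋₊ : ℝ)
      ≤ ∑ q ∈ Finset.range k, x / θ ^ n * θ⁻¹ ^ q := by
        refine Finset.sum_le_sum fun q _ => (Nat.floor_le (by positivity)).trans_eq ?_
        rw [pow_add, inv_pow]; field_simp
    _ = x / θ ^ n * ∑ q ∈ Finset.range k, θ⁻¹ ^ q := by rw [Finset.mul_sum]
    _ ≤ x / θ ^ n * (1 - θ⁻¹)⁻¹ := by
        gcongr
        rw [← tsum_geometric_of_lt_one (by positivity) hinv]
        exact (summable_geometric_of_lt_one (by positivity) hinv).sum_le_tsum _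
          fun _ _ => by positivity
    _ = _ := by
        have : θ - 1 ≠ 0 := by linarith
        congr 1; field_simp

theorem length_targetWord_le {θ v M : ℝ} (hθ : 1 < θ) (hv : 0 ≤ v) (hM : 0 ≤ M)
    (t : ℕ → Fin S) :
    ((targetWord M t θ v).length : ℝ) ≤ (v * (θ / (θ - 1)) + θ * v) * M := by
  have hθ0 : 0 < θ := by linarith
  rw [targetWord_eq, List.length_append, length_blockWord, length_initialWord, Nat.cast_add]
  have h1 := sum_floor_geometric_le hθ (mul_nonneg hv hM) 0 (maxPower θ v M + 1)
  simp only [zero_add, pow_zero, div_one] at h1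
  have h2 : (⌊θ * v * M⌋₊ : ℝ) ≤ θ * v * M := Nat.floor_le (by positivity)
  linarith

theorem floor_le_length_targetWord (M θ v : ℝ) (t : ℕ → Fin S) :
    ⌊θ * v * M⌋₊ ≤ (targetWord M t θ v).length := by
  rw [targetWord_eq, List.length_append, length_initialWord]; exact Nat.le_add_left _ _

end Words

/-! ### The growth rate along the target words -/

section Omega

variable {S : ℕ} {D : List (Fin S) → ℝ} {C κ r : ℝ}

/-- The exponential rate of `D` along the target word of parameter `M`. -/
def targetRate (D : List (Fin S) → ℝ) (t : ℕ → Fin S) (θ v M : ℝ) : ℝ :=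
  Real.log (D (targetWord M t θ v)) / M

namespace IsQuasiMultiplicative

theorem targetRate_le (h : IsQuasiMultiplicative D C κ r) (t : ℕ → Fin S) {θ v : ℝ} (hθ : 1 < θ)
    (hv : 0 < v) : ∃ η < 0, ∀ᶠ M in atTop, targetRate D t θ v M ≤ η := by
  have hr := h.log_ratio_neg
  have hθv : 0 < θ * v := by positivity
  -- The last factor alone has length ⌊θvM⌋, which is at least θvM/2 once θvM ≥ 2.
  refine ⟨θ * v / 2 * Real.log r, by nlinarith, ?_⟩
  filter_upwards [eventually_ge_atTop (2 / (θ * v))] with M hM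
  have hM0 : 0 < M := lt_of_lt_of_le (by positivity) hM
  rw [div_le_iff₀' hθv] at hM
  rw [targetRate, div_le_iff₀ hM0]
  refine (h.log_le _).trans ?_
  have h1 : ((⌊θ * v * M⌋₊ : ℕ) : ℝ) ≤ (targetWord M t θ v).length :=
    Nat.cast_le.2 (floor_le_length_targetWord M θ v t)
  have h2 := Nat.lt_floor_add_one (θ * v * M)
  nlinarith

theorem le_targetRate [NeZero S] (h : IsQuasiMultiplicative D C κ r) (t : ℕ → Fin S) {θ v : ℝ}
    (hθ : 1 < θ) (hv : 0 < v) : ∃ b, ∀ᶠ M in atTop, b ≤ targetRate D t θ v M := by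
  have hk := h.log_lower_neg
  refine ⟨(v * (θ / (θ - 1)) + θ * v) * Real.log κ, ?_⟩
  filter_upwards [eventually_gt_atTop 0] with M hM
  rw [targetRate, le_div_iff₀ hM]
  refine le_trans ?_ (h.le_log _)
  have := length_targetWord_le hθ hv.le hM.le t
  nlinarith

theorem isBoundedUnder_le_targetRate (h : IsQuasiMultiplicative D C κ r) (t : ℕ → Fin S)
    {θ v : ℝ} (hθ : 1 < θ) (hv : 0 < v) :
    IsBoundedUnder (· ≤ ·) atTop (targetRate D t θ v) :=
  let ⟨η, _, h1⟩ := h.targetRate_le t hθ hv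
  ⟨η, h1⟩

variable [NeZero S] (h : IsQuasiMultiplicative D C κ r) (t : ℕ → Fin S) {θ v : ℝ} (hθ : 1 < θ)
  (hv : 0 < v)
include h hθ hv

theorem isBoundedUnder_ge_targetRate :
    IsBoundedUnder (· ≥ ·) atTop (targetRate D t θ v) :=
  let ⟨b, h1⟩ := h.le_targetRate t hθ hv
  ⟨b, h1⟩

theorem limsup_targetRate_neg : limsup (targetRate D t θ v) atTop < 0 := by
  obtain ⟨η, hη, h1⟩ := h.targetRate_le t hθ hv
  exact (limsup_le_of_le (h.isBoundedUnder_ge_targetRate t hθ hv).isCoboundedUnder_le h1).trans_lt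
    hη

theorem liminf_targetRate_neg : liminf (targetRate D t θ v) atTop < 0 :=
  (liminf_le_limsup (h.isBoundedUnder_le_targetRate t hθ hv)
    (h.isBoundedUnder_ge_targetRate t hθ hv)).trans_lt (h.limsup_targetRate_neg t hθ hv)

omit [NeZero S] in
theorem eventually_targetRate_lt {a : ℝ} (ha : limsup (targetRate D t θ v) atTop < a) :
    ∀ᶠ M in atTop, targetRate D t θ v M < a :=
  eventually_lt_of_limsup_lt ha (h.isBoundedUnder_le_targetRate t hθ hv)

theorem eventually_lt_targetRate {a : ℝ} (ha : a < liminf (targetRate D t θ v) atTop) :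
    ∀ᶠ M in atTop, a < targetRate D t θ v M :=
  eventually_lt_of_lt_liminf ha (h.isBoundedUnder_ge_targetRate t hθ hv)

end IsQuasiMultiplicative

namespace IsQuasiMultiplicative

theorem le_blockWord (h : IsQuasiMultiplicative D C κ r) (t : ℕ → Fin S) (g : ℕ → ℕ) (n : ℕ) :
    ∑ q ∈ Finset.range n, Real.log (D (initialWord t (g q))) ≤
      n * Real.log C + Real.log (D (blockWord t g n)) := by
  induction n with
  | zero => simp [blockWord, h.nil]
  | succ n ih =>
    rw [Finset.sum_range_succ, blockWord_succ]
    have := h.le_log_append (initialWord t (g n)) (blockWord t g n)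
    push_cast
    linarith

theorem blockWord_le (h : IsQuasiMultiplicative D C κ r) (t : ℕ → Fin S) (g : ℕ → ℕ) (n : ℕ) :
    Real.log (D (blockWord t g n)) ≤ ∑ q ∈ Finset.range n, Real.log (D (initialWord t (g q))) := by
  induction n with
  | zero => simp [blockWord, h.nil]
  | succ n ih =>
    rw [Finset.sum_range_succ, blockWord_succ]
    have := h.log_append_le (initialWord t (g n)) (blockWord t g n)
    linarith

/-- The first `J` factors of the target word control its size from below, up to an error which is
small compared with `M` when `J` is large. -/
theorem sum_le_log_targetWord [NeZero S] (h : IsQuasiMultiplicative D C κ r) (t : ℕ → Fin S)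
    {θ v M : ℝ} (hθ : 1 < θ) (J : ℕ) (hM : θ ^ J ≤ v * M) :
    ∑ q ∈ Finset.range J, Real.log (D (initialWord t ⌊v * M / θ ^ q⌋₊)) +
        Real.log (D (initialWord t ⌊θ * v * M⌋₊)) ≤
      (J + 2) * Real.log C - v * M / θ ^ J * (θ / (θ - 1)) * Real.log κ +
        Real.log (D (targetWord M t θ v)) := by
  have hθ0 : 0 < θ := by linarith
  have hvM : 0 ≤ v * M := le_trans (by positivity) hM
  have hJ : J ≤ maxPower θ v M + 1 := by
    refine (le_maxPower hθ ?_).trans (Nat.le_succ _)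
    rwa [le_div_iff₀ (by positivity), one_mul]
  obtain ⟨k, hk⟩ := Nat.exists_eq_add_of_le hJ
  -- The word u collects the factors with index at least J. Their total length is a geometric tail,
  -- so they cost at most that many factors κ.
  obtain ⟨u, hu, hb⟩ := exists_blockWord_add t (fun q => ⌊v * M / θ ^ q⌋₊) J k
  rw [targetWord_eq, hk, hb]
  have h1 := h.le_blockWord t (fun q => ⌊v * M / θ ^ q⌋₊) J
  have h2 := h.le_log_append u (blockWord t (fun q => ⌊v * M / θ ^ q⌋₊) J)
  have h3 := h.le_log_append (u ++ blockWord t (fun q => ⌊v * M / θ ^ q⌋₊) J)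
    (initialWord t ⌊θ * v * M⌋₊)
  have h4 := h.le_log u
  have h5 : (u.length : ℝ) ≤ v * M / θ ^ J * (θ / (θ - 1)) := by
    rw [hu]; exact sum_floor_geometric_le hθ hvM J k
  have h6 := h.log_lower_neg
  nlinarith

/-- Each extra letter costs at most a factor κ. This is how perturbed lengths are exchanged for the
exact lengths in the target word. -/
theorem log_initialWord_le [NeZero S] (h : IsQuasiMultiplicative D C κ r) (t : ℕ → Fin S)
    {m n : ℕ} (hmn : m ≤ n) :
    Real.log (D (initialWord t m)) ≤
      Real.log C + Real.log (D (initialWord t n)) - ((n : ℝ) - m) * Real.log κ := by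
  obtain ⟨k, rfl⟩ := Nat.exists_eq_add_of_le hmn
  rw [initialWord_add]
  have h1 := h.le_log_append (initialWord t m) (subword t m k)
  have h2 := h.le_log (subword t m k)
  rw [length_subword] at h2
  push_cast
  linarith

end IsQuasiMultiplicative

end Omega

/-! ### Occurrences of initial words of the target -/

section Matching

variable {S : ℕ} {e t : ℕ → Fin S}

theorem shift_iterate (e : ℕ → Fin S) (m i : ℕ) : shift^[m] e i = e (m + i) := by
  induction m generalizing e i with
  | zero => simp
  | succ m ih => rw [Function.iterate_succ_apply, ih, shift, add_right_comm]

theorem shift_iterate_mem_cylinder {m l : ℕ} :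
    shift^[m] e ∈ PiNat.cylinder t l ↔ ∀ i < l, e (m + i) = t i := by
  simp only [PiNat.mem_cylinder_iff, shift_iterate]

theorem Rs_anti {u w : ℝ} (h : u ≤ w) : Rs w t ⊆ Rs u t := by
  intro e he N
  obtain ⟨n, hn, hm⟩ := he N
  exact ⟨n, hn, PiNat.cylinder_anti t (Nat.floor_le_floor (by gcongr)) hm⟩

theorem Re_anti {u w : ℝ} (h : u ≤ w) : Re w t ⊆ Re u t := by
  rintro e ⟨N, he⟩
  refine ⟨N, fun n hn => ?_⟩
  obtain ⟨m, hm, h'⟩ := he n hn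
  exact ⟨m, hm, PiNat.cylinder_anti t (Nat.floor_le_floor (by gcongr)) h'⟩

theorem mem_Rs_of_lt_vs {u : ℝ} (h : (u : EReal) < vs e t) : e ∈ Rs u t := by
  obtain ⟨_, ⟨w, ⟨-, hw⟩, rfl⟩, huw⟩ := lt_sSup_iff.1 h
  exact Rs_anti (EReal.coe_lt_coe_iff.1 huw).le hw

theorem mem_Re_of_lt_ve {u : ℝ} (h : (u : EReal) < ve e t) : e ∈ Re u t := by
  obtain ⟨_, ⟨w, ⟨-, hw⟩, rfl⟩, huw⟩ := lt_sSup_iff.1 h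
  exact Re_anti (EReal.coe_lt_coe_iff.1 huw).le hw

theorem notMem_Rs_of_vs_lt {u : ℝ} (hu : 0 ≤ u) (h : vs e t < (u : EReal)) : e ∉ Rs u t :=
  fun he => absurd (le_sSup (mem_image_of_mem _ (show u ∈ {v : ℝ | 0 ≤ v ∧ e ∈ Rs v t} from
    ⟨hu, he⟩))) (not_le.2 h)

/-- `ℓ m` is the length of the longest initial word of `t` that occurs in `e` at position `m`. -/
structure IsMatchLength (e t : ℕ → Fin S) (ℓ : ℕ → ℕ) : Prop where
  eq_of_lt : ∀ m, ∀ i < ℓ m, e (m + i) = t i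
  ne : ∀ m, e (m + ℓ m) ≠ t (ℓ m)

theorem IsMatchLength.le_iff {ℓ : ℕ → ℕ} (h : IsMatchLength e t ℓ) {m l : ℕ} :
    l ≤ ℓ m ↔ ∀ i < l, e (m + i) = t i := by
  refine ⟨fun hl i hi => h.eq_of_lt m i (hi.trans_le hl), fun hl => ?_⟩
  by_contra! hlt
  exact h.ne m (hl _ hlt)

/-- A target satisfying the admissibility condition and having an occurrence of its own first digit
at a late position has a period ending there. -/
theorem admissible_periodic {N : ℕ}
    (ht : ∀ n > N, ∀ m < n, ∀ j : Fin S, j ≠ t n →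
      subword (Function.update t n j) m (n - m + 1) ≠ initialWord t (n - m + 1))
    {q : ℕ} (hq : N < q) (h0 : t q = t 0) : ∀ i, t (q + i) = t i := by
  intro i
  induction i using Nat.strong_induction_on with
  | _ i ih =>
    rcases Nat.eq_zero_or_pos i with rfl | hi
    · exact h0
    by_contra hne
    -- If i is the first failure, replacing the digit at q + i by t i would create an initial word
    -- of t starting at q.
    refine ht (q + i) (by omega) q (by omega) (t i) (Ne.symm hne) ?_
    refine subword_congr.2 fun k hk => ?_
    rw [zero_add]
    rcases (show k < i ∨ k = i by omega) with hki | rfl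
    · rw [Function.update_of_ne (by omega), ih k hki]
    · rw [Function.update_self]

/-- An infinite match from position m would leave a tail of e equal to t. Late occurrences would
then be late returns of the first digit of t, making t periodic by `admissible_periodic`, so all of
t would recur in e at arbitrarily late times. This contradicts e ∉ R_s(b, t). -/
theorem exists_isMatchLength (ht : t ∈ admissibleTargets S) {a b : ℝ} (ha : 0 < a)
    (he : e ∈ Rs a t) (he' : e ∉ Rs b t) : ∃ ℓ, IsMatchLength e t ℓ := by
  obtain ⟨N, hN⟩ := ht
  have hfin : ∀ m, ∃ i, e (m + i) ≠ t i := by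
    by_contra! hm
    obtain ⟨m, hm⟩ := hm
    refine he' fun N' => ?_
    obtain ⟨n, hn, hn'⟩ := he (max N' (max (m + N + 1) ⌈1 / a⌉₊))
    refine ⟨n, (le_max_left _ _).trans hn, ?_⟩
    rw [shift_iterate_mem_cylinder] at hn' ⊢
    have hn1 : m + N + 1 ≤ n := (le_max_left _ _).trans ((le_max_right _ _).trans hn)
    have hn2 : ⌈1 / a⌉₊ ≤ n := (le_max_right _ _).trans ((le_max_right _ _).trans hn)
    have hpos : 0 < ⌊a * n⌋₊ := by
      rw [Nat.floor_pos]
      have := Nat.ceil_le.1 hn2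
      rwa [div_le_iff₀' ha] at this
    have h1 := hn' 0 hpos
    have h2 := hm (n - m)
    rw [add_zero] at h1
    rw [show m + (n - m) = n by omega, h1] at h2
    intro i _
    rw [← admissible_periodic hN (q := n - m) (by omega) h2.symm i, ← hm]
    congr 1; omega
  classical
  exact ⟨fun m => Nat.find (hfin m),
    fun m i hi => not_not.1 (Nat.find_min (hfin m) hi), fun m => Nat.find_spec (hfin m)⟩

/-- The occurrence at `M` ends after every occurrence that starts earlier. -/
def IsRecord (ℓ : ℕ → ℕ) (M : ℕ) : Prop := ∀ m < M, m + ℓ m < M + ℓ M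

/-- The first position whose occurrence ends no earlier than the one at M is a record. -/
theorem exists_isRecord (ℓ : ℕ → ℕ) (M : ℕ) : ∃ M' ≤ M, IsRecord ℓ M' ∧ M + ℓ M ≤ M' + ℓ M' := by
  classical
  have hex : ∃ m, M + ℓ M ≤ m + ℓ m := ⟨M, le_rfl⟩
  refine ⟨Nat.find hex, Nat.find_min' hex le_rfl, fun m hm => ?_, Nat.find_spec hex⟩
  exact (not_le.1 (Nat.find_min hex hm)).trans_le (Nat.find_spec hex)

/-- Long occurrences before a record end before it starts. -/
theorem IsRecord.add_le {N : ℕ}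
    (ht : ∀ n > N, ∀ m < n, ∀ j : Fin S, j ≠ t n →
      subword (Function.update t n j) m (n - m + 1) ≠ initialWord t (n - m + 1))
    {ℓ : ℕ → ℕ} (hℓ : IsMatchLength e t ℓ) {M m : ℕ} (hM : IsRecord ℓ M) (hm : m < M)
    (hN : N < ℓ m) : m + ℓ m ≤ M := by
  by_contra! hlt
  have hend := hM m hm
  -- Suppose the two occurrences overlap. The digit of e that stops the match at m still belongs to
  -- the match at M, which ends later; inserted into t at position ℓ m it completes an initial word
  -- starting at M - m.
  refine ht (ℓ m) hN (M - m) (by omega) _ (hℓ.ne m) ?_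
  refine subword_congr.2 fun k hk => ?_
  rw [zero_add]
  have hMk : e (M + k) = t k := hℓ.eq_of_lt M k (by omega)
  rcases (show k < ℓ m - (M - m) ∨ k = ℓ m - (M - m) by omega) with hk' | hk'
  · rw [Function.update_of_ne (by omega), ← hMk, ← hℓ.eq_of_lt m (M - m + k) (by omega)]
    congr 1; omega
  · rw [← hMk, show M - m + k = ℓ m by omega, Function.update_self]
    congr 1; omega

theorem exists_bound (ℓ : ℕ → ℕ) (N : ℕ) : ∃ L, ∀ m < N, ℓ m ≤ L :=
  ⟨∑ m ∈ Finset.range N, ℓ m, fun _ hm =>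
    Finset.single_le_sum (fun _ _ => Nat.zero_le _) (Finset.mem_range.2 hm)⟩

/-- Before a late record there is another record, at a comparable position and with a long
occurrence. -/
theorem exists_previous_record (ht : t ∈ admissibleTargets S) {ℓ : ℕ → ℕ}
    (hℓ : IsMatchLength e t ℓ) {b l u w : ℝ} (hb : 0 < b) (hw : 0 < w) (huw : u < w)
    (hbl : b < l * w) (hRe : e ∈ Re w t) (hRs : e ∉ Rs b t) :
    ∃ B : ℕ, ∀ M ≥ B, IsRecord ℓ M →
      ∃ m, IsRecord ℓ m ∧ m + ℓ m ≤ M ∧ (M : ℝ) ≤ l * m ∧ ⌊u * M⌋₊ ≤ ℓ m := by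
  obtain ⟨N, hN⟩ := ht
  obtain ⟨N₁, hN₁⟩ := hRe
  have hRs' : ∃ N₀, ∀ n ≥ N₀, ℓ n < ⌊b * n⌋₊ := by
    by_contra! hcon
    refine hRs fun N' => ?_
    obtain ⟨n, hn, hn'⟩ := hcon N'
    exact ⟨n, hn, shift_iterate_mem_cylinder.2 (hℓ.le_iff.1 hn')⟩
  obtain ⟨N₀, hN₀⟩ := hRs'
  obtain ⟨L, hL⟩ := exists_bound ℓ N₀
  obtain ⟨B₁, hB₁⟩ := exists_nat_ge ((L + N + 2) / w + 1)
  obtain ⟨B₂, hB₂⟩ := exists_nat_ge (w / (w - u))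
  have hl : 0 < l * w - b := by linarith
  obtain ⟨B₃, hB₃⟩ := exists_nat_ge ((b * ((1 + w) / (l * w - b)) + 1) / w + 1)
  -- Here `B₁` makes the occurrence found longer than N and its start later than N₀, `B₂` absorbs
  -- the passage from M - 1 to M in its length, and `B₃` makes m large enough to absorb the additive
  -- 1 + w in the comparison of M with l m.
  refine ⟨max (N₁ + 1) (max B₁ (max B₂ B₃)), fun M hM hrec => ?_⟩
  have hM1 : N₁ + 1 ≤ M := (le_max_left _ _).trans hM
  have hM2 : B₁ ≤ M := (le_max_left _ _).trans ((le_max_right _ _).trans hM)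
  have hM3 : B₂ ≤ M :=
    (le_max_left _ _).trans ((le_max_right _ _).trans ((le_max_right _ _).trans hM))
  have hM4 : B₃ ≤ M :=
    (le_max_right _ _).trans ((le_max_right _ _).trans ((le_max_right _ _).trans hM))
  replace hB₁ : ((L + N + 2) / w + 1 : ℝ) ≤ M := hB₁.trans (Nat.cast_le.2 hM2)
  replace hB₂ : (w / (w - u) : ℝ) ≤ M := hB₂.trans (Nat.cast_le.2 hM3)
  replace hB₃ : ((b * ((1 + w) / (l * w - b)) + 1) / w + 1 : ℝ) ≤ M :=
    hB₃.trans (Nat.cast_le.2 hM4)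
  have hcast : ((M - 1 : ℕ) : ℝ) = M - 1 := by
    rw [Nat.cast_sub (by omega), Nat.cast_one]
  -- Time M - 1, so that the occurrence starts strictly before M.
  obtain ⟨m₀, hm₀, hmem⟩ := hN₁ (M - 1) (by omega)
  rw [shift_iterate_mem_cylinder, ← hℓ.le_iff, hcast] at hmem
  obtain ⟨m, hmm, hmrec, hmend⟩ := exists_isRecord ℓ m₀
  -- The record starts no later and ends no earlier than the occurrence at m₀, so it is at least as
  -- long.
  have hℓm : ⌊w * (M - 1)⌋₊ ≤ ℓ m := by omega
  have hbig : w * (M - 1) < ℓ m + 1 := by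
    refine (Nat.lt_floor_add_one _).trans_le ?_
    exact_mod_cast Nat.succ_le_succ hℓm
  have h1 : (L + N + 2 : ℝ) ≤ w * (M - 1) := by
    rw [← div_le_iff₀' hw]; linarith
  have h2 : L + N + 1 < ℓ m + 1 := by
    have : (L + N + 1 : ℝ) < ℓ m + 1 := by linarith
    exact_mod_cast this
  have hmN₀ : N₀ ≤ m := by
    by_contra! hlt
    have := hL m hlt
    omega
  have hlt : (ℓ m : ℝ) < b * m :=
    (Nat.cast_lt.2 (hN₀ m hmN₀)).trans_le (Nat.floor_le (by positivity))
  refine ⟨m, hmrec, hrec.add_le hN hℓ (by omega) (by omega), ?_, ?_⟩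
  · have h3 : b * ((1 + w) / (l * w - b)) + 1 ≤ w * (M - 1) := by
      rw [← div_le_iff₀' hw]; linarith
    have h4 : (1 + w) / (l * w - b) < m := by
      have : b * ((1 + w) / (l * w - b)) < b * m := by linarith
      exact lt_of_mul_lt_mul_left this hb.le
    rw [div_lt_iff₀ hl] at h4
    have h5 : w * (M : ℝ) ≤ w * (l * m) := by nlinarith
    exact le_of_mul_le_mul_left h5 hw
  · refine (Nat.floor_le_floor ?_).trans hℓm
    have h6 : w ≤ (w - u) * M := by
      rwa [← div_le_iff₀' (by linarith)]
    linarith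

/-- Replacing a long occurrence by a record starting no later keeps the length bound. The record is
late because occurrences starting before B have bounded ends. -/
theorem exists_late_record {ℓ : ℕ → ℕ} (hℓ : IsMatchLength e t ℓ) {a : ℝ} (ha : 0 < a)
    (hRs : e ∈ Rs a t) (B : ℕ) : ∃ M ≥ B, IsRecord ℓ M ∧ ⌊a * M⌋₊ ≤ ℓ M := by
  obtain ⟨L, hL⟩ := exists_bound ℓ B
  obtain ⟨B', hB'⟩ := exists_nat_ge ((L + B + 1) / a)
  obtain ⟨n, hn, hmem⟩ := hRs B'
  rw [shift_iterate_mem_cylinder, ← hℓ.le_iff] at hmem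
  obtain ⟨M, hMn, hrec, hend⟩ := exists_isRecord ℓ n
  refine ⟨M, ?_, hrec, ?_⟩
  · by_contra! hlt
    have h1 := hL M hlt
    have h2 : ((L + B + 1) / a : ℝ) ≤ n := hB'.trans (Nat.cast_le.2 hn)
    rw [div_le_iff₀' ha] at h2
    have h3 : L + B + 1 ≤ ⌊a * n⌋₊ := Nat.le_floor (by push_cast; exact h2)
    omega
  · have : ⌊a * (M : ℝ)⌋₊ ≤ ⌊a * (n : ℝ)⌋₊ := Nat.floor_le_floor (by gcongr)
    omega

/-- The two rates are related by `θ ≥ 1 / (1 - v)`. -/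
theorem ve_inter_vs_eq_empty (ht : t ∈ admissibleTargets S) {v θ : ℝ} (hv0 : 0 < v) (hv1 : v < 1)
    (hθ : 0 < θ) (hθv : θ < 1 / (1 - v)) :
    {e : ℕ → Fin S | (v : EReal) ≤ ve e t} ∩ {e | vs e t = ((θ * v : ℝ) : EReal)} = ∅ := by
  rw [lt_div_iff₀ (by linarith)] at hθv
  have hθv0 : 0 < θ * v := by positivity
  rw [eq_empty_iff_forall_notMem]
  rintro e ⟨hve : (v : EReal) ≤ ve e t, hvs : vs e t = ((θ * v : ℝ) : EReal)⟩
  -- The previous record starts after about M/θ and carries about vM letters before M; dividing by M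
  -- bounds 1/θ + v by 1 up to ε.
  have key : ∀ ε : ℝ, 0 < ε → ε < 1 / 2 →
      (1 - ε) / (θ * (1 + 2 * ε)) + (1 - 2 * ε) * v ≤ 1 := by
    intro ε hε hε2
    have hRs : e ∈ Rs (θ * v / 2) t := mem_Rs_of_lt_vs (by
      rw [hvs, EReal.coe_lt_coe_iff]; linarith)
    have hRs' : e ∉ Rs (θ * v * (1 + ε)) t := notMem_Rs_of_vs_lt (by positivity) (by
      rw [hvs, EReal.coe_lt_coe_iff]; nlinarith)
    have hRe : e ∈ Re ((1 - ε) * v) t := mem_Re_of_lt_ve (lt_of_lt_of_le (by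
      rw [EReal.coe_lt_coe_iff]; nlinarith) hve)
    obtain ⟨ℓ, hℓ⟩ := exists_isMatchLength ht (by positivity) hRs hRs'
    have h1ε : 0 < 1 - ε := by linarith
    -- Chosen so that l times the hitting rate (1 - ε)v strictly exceeds the shrinking target rate
    -- θv(1 + ε).
    set l := θ * (1 + 2 * ε) / (1 - ε) with hl
    have hl0 : 0 < l := by positivity
    have hlw : l * ((1 - ε) * v) = θ * v * (1 + 2 * ε) := by
      rw [hl]; field_simp
    obtain ⟨B, hB⟩ := exists_previous_record ht hℓ (u := (1 - 2 * ε) * v) (l := l) (by positivity)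
      (by positivity) (by nlinarith) (by rw [hlw]; nlinarith) hRe hRs'
    by_contra! hgt
    set γ := (1 - ε) / (θ * (1 + 2 * ε)) + (1 - 2 * ε) * v - 1 with hγ
    have hγ0 : 0 < γ := by linarith
    obtain ⟨B', hB'⟩ := exists_nat_ge (1 / γ)
    obtain ⟨M, hM, hrec, -⟩ := exists_late_record hℓ (by positivity) hRs (max B (B' + 1))
    obtain ⟨m, -, hm1, hm2, hm3⟩ := hB M ((le_max_left _ _).trans hM) hrec
    have hM' : (B' : ℝ) + 1 ≤ M := by exact_mod_cast (le_max_right _ _).trans hM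
    rw [div_le_iff₀ hγ0] at hB'
    have h1 := Nat.lt_floor_add_one ((1 - 2 * ε) * v * M)
    have h2 : (m : ℝ) + ⌊(1 - 2 * ε) * v * M⌋₊ ≤ M := by
      exact_mod_cast (Nat.add_le_add_left hm3 m).trans hm1
    have h3 : (1 - ε) / (θ * (1 + 2 * ε)) * M ≤ m := by
      have : (1 - ε) / (θ * (1 + 2 * ε)) = 1 / l := by rw [hl, one_div_div]
      rw [this, one_div, inv_mul_le_iff₀ hl0]
      exact hm2
    have h4 : γ * M = (1 - ε) / (θ * (1 + 2 * ε)) * M + (1 - 2 * ε) * v * M - M := by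
      rw [hγ]; ring
    nlinarith
  have hc : Tendsto (fun ε : ℝ => (1 - ε) / (θ * (1 + 2 * ε)) + (1 - 2 * ε) * v) (𝓝[>] 0)
      (𝓝 ((1 - 0) / (θ * (1 + 2 * 0)) + (1 - 2 * 0) * v)) := by
    refine Tendsto.mono_left (ContinuousAt.tendsto (f := fun ε : ℝ =>
      (1 - ε) / (θ * (1 + 2 * ε)) + (1 - 2 * ε) * v) ?_) nhdsWithin_le_nhds
    have : θ * (1 + 2 * 0) ≠ 0 := by simpa using hθ.ne'
    fun_prop (disch := assumption)
  have hle := le_of_tendsto hc (by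
    filter_upwards [Ioo_mem_nhdsGT (show (0 : ℝ) < 1 / 2 by norm_num)] with ε hε
    exact key ε hε.1 hε.2)
  simp only [sub_zero, mul_zero, add_zero, mul_one, one_mul] at hle
  rw [← le_sub_iff_add_le, div_le_iff₀ hθ] at hle
  linarith

end Matching

/-! ### The coding map -/

section Coding

variable {d S : ℕ} {f : Fin S → EuclideanSpace ℝ (Fin d) → EuclideanSpace ℝ (Fin d)}
  {U Λ : Set (EuclideanSpace ℝ (Fin d))}

theorem IsAttractor.subset_of_mapsTo (hΛ : IsAttractor f U Λ) (hf : IsConformalIFS f U) :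
    Λ ⊆ U := by
  rw [hΛ.eq_iUnion]
  exact iUnion_subset fun i => ((hf.mapsTo i).mono_left hΛ.subset).image_subset

theorem IsAttractor.mapsTo (hΛ : IsAttractor f U Λ) (i : Fin S) : MapsTo (f i) Λ Λ := by
  intro x hx
  rw [hΛ.eq_iUnion]
  exact mem_iUnion.2 ⟨i, mem_image_of_mem _ hx⟩

/-- Cantor's intersection theorem: nested nonempty compact sets have a common point, so the choice
in `coding` meets its specification. -/
theorem coding_mem (hf : IsConformalIFS f U) (hΛ : IsAttractor f U Λ) (e : ℕ → Fin S) (n : ℕ) :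
    coding f Λ e ∈ wordMap f (initialWord e n) '' Λ := by
  have hcont : ∀ w : List (Fin S), ContinuousOn (wordMap f w) Λ := by
    intro w
    induction w with
    | nil => exact continuousOn_id
    | cons i w ih =>
      exact ((hf.continuousOn i).mono hΛ.subset).comp ih (mapsTo_wordMap hΛ.mapsTo w)
  have hcpt : ∀ n, IsCompact (wordMap f (initialWord e n) '' Λ) := fun n =>
    hΛ.isCompact.image_of_continuousOn (hcont _)
  have hne : (⋂ n, wordMap f (initialWord e n) '' Λ).Nonempty := by
    refine IsCompact.nonempty_iInter_of_sequence_nonempty_isCompact_isClosed _ (fun n => ?_)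
      (fun n => hΛ.nonempty.image _) (hcpt 0) fun n => (hcpt n).isClosed
    rw [initialWord_add, wordMap_append, image_comp]
    exact image_mono (mapsTo_wordMap hΛ.mapsTo _).image_subset
  obtain ⟨x, hx⟩ := hne
  exact Classical.epsilon_spec (p := fun x => ∀ n : ℕ, x ∈ wordMap f (initialWord e n) '' Λ)
    ⟨x, fun n => mem_iInter.1 hx n⟩ n

theorem coding_image_subset (hf : IsConformalIFS f U) (hΛ : IsAttractor f U Λ)
    (A : Set (ℕ → Fin S)) : coding f Λ '' A ⊆ Λ := by
  rintro _ ⟨e, -, rfl⟩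
  simpa [initialWord, subword, wordMap_nil] using coding_mem hf hΛ e 0

variable [Nontrivial (EuclideanSpace ℝ (Fin d))] {C κ r : ℝ}

/-- Sequences agreeing in n letters are coded into one cylinder, of diameter at most r^n diam U. -/
theorem continuous_coding (hf : IsConformalIFS f U) (hΛ : IsAttractor f U Λ)
    (hD : IsQuasiMultiplicative (derivNorm f U) C κ r) : Continuous (coding f Λ) := by
  rw [continuous_iff_continuousAt]
  intro e
  rw [Metric.continuousAt_iff']
  intro ε hε
  have hlim : Tendsto (fun n : ℕ => r ^ n * Metric.diam U) atTop (𝓝 (0 * Metric.diam U)) :=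
    (tendsto_pow_atTop_nhds_zero_of_lt_one hD.ratio_pos.le hD.ratio_lt_one).mul_const _
  rw [zero_mul] at hlim
  obtain ⟨n, hn⟩ := (hlim.eventually (gt_mem_nhds hε)).exists
  filter_upwards [(PiNat.isOpen_cylinder (fun _ : ℕ => Fin S) e n).mem_nhds
    (PiNat.self_mem_cylinder e n)] with e' he'
  have heq : initialWord e' n = initialWord e n :=
    subword_congr.2 fun i hi => by rw [zero_add]; exact he' i hi
  obtain ⟨x, hx, hx'⟩ := coding_mem hf hΛ e' n
  obtain ⟨y, hy, hy'⟩ := coding_mem hf hΛ e n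
  rw [← hx', ← hy', heq]
  have hΛU := hΛ.subset_of_mapsTo hf
  refine ((hf.dist_wordMap_le _ (hΛU hx) (hΛU hy)).trans ?_).trans_lt hn
  refine mul_le_mul ?_ (Metric.dist_le_diam_of_mem hf.bounded (hΛU hx) (hΛU hy)) dist_nonneg
    (pow_nonneg hD.ratio_pos.le n)
  simpa [length_initialWord] using hD.le_pow (initialWord e n)

open MeasureTheory in
/-- Points lying in infinitely many families of cylinders with summable `s`-th powers of the
derivative norms form a set of dimension at most `s`. -/
theorem dimH_le_of_summable (hf : IsConformalIFS f U)
    (hD : IsQuasiMultiplicative (derivNorm f U) C κ r) {s : ℝ} (hs : 0 ≤ s)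
    (F : ℕ → Finset (List (Fin S))) (hlen : ∀ M, ∀ w ∈ F M, M ≤ w.length)
    (hsum : Summable fun M => ∑ w ∈ F M, derivNorm f U w ^ s)
    {X : Set (EuclideanSpace ℝ (Fin d))}
    (hX : ∀ x ∈ X, ∀ B : ℕ, ∃ M ≥ B, ∃ w ∈ F M, x ∈ wordMap f w '' U) :
    dimH X ≤ ENNReal.ofReal s := by
  set R := Metric.diam U
  have hR : 0 ≤ R := Metric.diam_nonneg
  have hdiam : ∀ w, Metric.ediam (wordMap f w '' U) ≤ ENNReal.ofReal (derivNorm f U w * R) := by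
    intro w
    refine Metric.ediam_le ?_
    rintro _ ⟨x, hx, rfl⟩ _ ⟨y, hy, rfl⟩
    rw [edist_dist]
    refine ENNReal.ofReal_le_ofReal ((hf.dist_wordMap_le w hx hy).trans ?_)
    exact mul_le_mul_of_nonneg_left (Metric.dist_le_diam_of_mem hf.bounded hx hy) (hD.pos w).le
  set a : ℕ → ℝ := fun M => ∑ w ∈ F M, derivNorm f U w ^ s
  have ha : ∀ M, 0 ≤ a M := fun M =>
    Finset.sum_nonneg fun w _ => Real.rpow_nonneg (hD.pos w).le s
  have hpow : Tendsto (fun n : ℕ => ENNReal.ofReal (r ^ n * R)) atTop (𝓝 0) := by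
    have hlim : Tendsto (fun n : ℕ => r ^ n * R) atTop (𝓝 (0 * R)) :=
      (tendsto_pow_atTop_nhds_zero_of_lt_one hD.ratio_pos.le hD.ratio_lt_one).mul_const _
    rw [zero_mul] at hlim
    simpa using ENNReal.tendsto_ofReal hlim
  have htail : Tendsto (fun n : ℕ => ∑' k, ENNReal.ofReal (a (k + n)) * ENNReal.ofReal (R ^ s))
      atTop (𝓝 0) := by
    have h1 : ∑' k, ENNReal.ofReal (a k) ≠ ⊤ := by
      rw [← ENNReal.ofReal_tsum_of_nonneg ha hsum]; exact ENNReal.ofReal_ne_top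
    have h2 := ENNReal.tendsto_sum_nat_add (fun k => ENNReal.ofReal (a k)) h1
    have h3 := ENNReal.Tendsto.mul_const h2 (Or.inr (ENNReal.ofReal_ne_top (r := R ^ s)))
    rw [zero_mul] at h3
    refine h3.congr fun n => ?_
    rw [ENNReal.tsum_mul_right]
  -- The n-th cover consists of all cylinders of the families with index at least n; its sum is
  -- bounded by a tail of the convergent series.
  have hle := Measure.hausdorffMeasure_le_liminf_tsum s X
    (ι := fun n : ℕ => (k : ℕ) × {w // w ∈ F (k + n)})
    (fun n : ℕ => ENNReal.ofReal (r ^ n * R)) hpow (fun n p => wordMap f p.2.1 '' U)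
    (Eventually.of_forall fun n p => ?_) (Eventually.of_forall fun n x hx => ?_)
  · have hzero : liminf (fun n : ℕ => ∑' p : (k : ℕ) × {w // w ∈ F (k + n)},
        Metric.ediam (wordMap f p.2.1 '' U) ^ s) atTop ≤ 0 := by
      rw [← htail.liminf_eq]
      refine liminf_le_liminf (Eventually.of_forall fun n => ?_)
      rw [ENNReal.tsum_sigma']
      refine ENNReal.tsum_le_tsum fun k => ?_
      rw [tsum_fintype]
      calc ∑ w : {w // w ∈ F (k + n)}, Metric.ediam (wordMap f w.1 '' U) ^ s
          = ∑ w ∈ F (k + n), Metric.ediam (wordMap f w '' U) ^ s :=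
            Finset.sum_coe_sort (F (k + n)) fun w => Metric.ediam (wordMap f w '' U) ^ s
        _ ≤ ∑ w ∈ F (k + n), ENNReal.ofReal (derivNorm f U w ^ s) * ENNReal.ofReal (R ^ s) := by
            refine Finset.sum_le_sum fun w _ => ?_
            rw [← ENNReal.ofReal_mul (Real.rpow_nonneg (hD.pos w).le s),
              ← Real.mul_rpow (hD.pos w).le hR,
              ← ENNReal.ofReal_rpow_of_nonneg (mul_nonneg (hD.pos w).le hR) hs]
            exact ENNReal.rpow_le_rpow (hdiam w) hs
        _ = _ := by
            rw [← Finset.sum_mul, ENNReal.ofReal_sum_of_nonneg]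
            exact fun w _ => Real.rpow_nonneg (hD.pos w).le s
    have hH : (μH[s] : Measure (EuclideanSpace ℝ (Fin d))) X = 0 :=
      le_antisymm (hle.trans hzero) zero_le
    refine dimH_le_of_hausdorffMeasure_ne_top (d := s.toNNReal) ?_
    rw [Real.coe_toNNReal s hs, hH]
    exact ENNReal.zero_ne_top
  · refine (hdiam _).trans (ENNReal.ofReal_le_ofReal ?_)
    refine mul_le_mul_of_nonneg_right ((hD.le_pow _).trans ?_) hR
    exact pow_le_pow_of_le_one hD.ratio_pos.le hD.ratio_lt_one.le
      ((Nat.le_add_left n p.1).trans (hlen _ _ p.2.2))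
  · obtain ⟨M, hM, w, hw, hxw⟩ := hX x hx n
    obtain ⟨k, rfl⟩ := Nat.exists_eq_add_of_le' hM
    exact mem_iUnion.2 ⟨⟨k, w, hw⟩, hxw⟩

end Coding

/-! ### Words with prescribed occurrences of the target -/

theorem sum_biUnion_le {α β : Type*} [DecidableEq α] [DecidableEq β] (s : Finset α)
    (F : α → Finset β) {g : β → ℝ} (hg : ∀ b, 0 ≤ g b) :
    ∑ b ∈ s.biUnion F, g b ≤ ∑ a ∈ s, ∑ b ∈ F a, g b := by
  induction s using Finset.induction_on with
  | empty => simp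
  | insert a s ha ih =>
    rw [Finset.biUnion_insert, Finset.sum_insert ha]
    have h1 := Finset.sum_union_inter (s₁ := F a) (s₂ := s.biUnion F) (f := g)
    have h2 : 0 ≤ ∑ b ∈ F a ∩ s.biUnion F, g b := Finset.sum_nonneg fun b _ => hg b
    linarith

section Families

variable {S : ℕ}

/-- All words of length `n`. -/
def wordsOfLength (S n : ℕ) : Finset (List (Fin S)) :=
  Finset.univ.image (List.ofFn : (Fin n → Fin S) → List (Fin S))

/-- The words of length `M` that contain `J` disjoint occurrences of initial words of `t`, of
lengths `⌊u x / l ^ (J - 1)⌋, …, ⌊u x / l⌋, ⌊u x⌋` in this order. -/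
def targetFamily (t : ℕ → Fin S) (u l : ℝ) : ℕ → ℝ → ℕ → Finset (List (Fin S))
  | 0, _, M => wordsOfLength S M
  | J + 1, x, M => (Finset.range (M + 1)).biUnion fun m =>
      if m + ⌊u * x⌋₊ ≤ M then
        Finset.image₂ (· ++ ·)
          ((targetFamily t u l J (x / l) m).image (· ++ initialWord t ⌊u * x⌋₊))
          (wordsOfLength S (M - (m + ⌊u * x⌋₊)))
      else ∅

theorem subword_mem_wordsOfLength (e : ℕ → Fin S) (m n : ℕ) :
    subword e m n ∈ wordsOfLength S n :=
  Finset.mem_image_of_mem _ (Finset.mem_univ _)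

theorem length_of_mem_wordsOfLength {n : ℕ} {w : List (Fin S)} (hw : w ∈ wordsOfLength S n) :
    w.length = n := by
  obtain ⟨g, -, rfl⟩ := Finset.mem_image.1 hw
  exact List.length_ofFn

theorem length_of_mem_targetFamily {t : ℕ → Fin S} {u l : ℝ} {J : ℕ} {x : ℝ} {M : ℕ}
    {w : List (Fin S)} (hw : w ∈ targetFamily t u l J x M) : w.length = M := by
  induction J generalizing x M w with
  | zero => exact length_of_mem_wordsOfLength hw
  | succ J ih =>
    rw [targetFamily, Finset.mem_biUnion] at hw
    obtain ⟨m, -, hw⟩ := hw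
    split_ifs at hw with hm
    · obtain ⟨a, ha, b, hb, rfl⟩ := Finset.mem_image₂.1 hw
      obtain ⟨c, hc, rfl⟩ := Finset.mem_image.1 ha
      rw [List.length_append, List.length_append, ih hc, length_initialWord,
        length_of_mem_wordsOfLength hb]
      omega
    · simp at hw

/-- Going back one record divides the guaranteed lower bound x on the position by l. The condition B
l^J ≤ x keeps the records late enough for J such steps. -/
theorem initialWord_mem_targetFamily {e t : ℕ → Fin S} {ℓ : ℕ → ℕ} (hℓ : IsMatchLength e t ℓ)
    {u l : ℝ} (hu : 0 ≤ u) (hl : 1 ≤ l) {B : ℕ}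
    (hB : ∀ M ≥ B, IsRecord ℓ M →
      ∃ m, IsRecord ℓ m ∧ m + ℓ m ≤ M ∧ (M : ℝ) ≤ l * m ∧ ⌊u * M⌋₊ ≤ ℓ m)
    (J : ℕ) {x : ℝ} {M : ℕ} (hM : IsRecord ℓ M) (hxM : x ≤ M) (hx : B * l ^ J ≤ x) :
    initialWord e M ∈ targetFamily t u l J x M := by
  induction J generalizing x M with
  | zero => exact subword_mem_wordsOfLength e 0 M
  | succ J ih =>
    have hl0 : 0 < l := by linarith
    have hBM : B ≤ M := by
      have h1 : (B : ℝ) * 1 ≤ B * l ^ (J + 1) := by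
        gcongr; exact one_le_pow₀ hl
      have : (B : ℝ) ≤ M := by linarith
      exact_mod_cast this
    obtain ⟨m, hm, hmM, hml, hlen⟩ := hB M hBM hM
    have hfl : ⌊u * x⌋₊ ≤ ℓ m := (Nat.floor_le_floor (by gcongr)).trans hlen
    have hmem := ih hm (x := x / l) (by rw [div_le_iff₀' hl0]; linarith) (by
      rw [le_div_iff₀ hl0, mul_assoc, ← pow_succ]; exact hx)
    rw [targetFamily, Finset.mem_biUnion]
    refine ⟨m, Finset.mem_range.2 (by omega), ?_⟩
    rw [if_pos (by omega)]
    have hsplit : initialWord e M = (initialWord e m ++ initialWord t ⌊u * x⌋₊) ++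
        subword e (m + ⌊u * x⌋₊) (M - (m + ⌊u * x⌋₊)) := by
      have h1 : initialWord t ⌊u * x⌋₊ = subword e m ⌊u * x⌋₊ :=
        subword_congr.2 fun i hi => by rw [zero_add]; exact (hℓ.eq_of_lt m i (by omega)).symm
      rw [h1, ← initialWord_add, ← initialWord_add]
      congr 1; omega
    rw [hsplit]
    exact Finset.mem_image₂_of_mem (Finset.mem_image_of_mem _ hmem)
      (subword_mem_wordsOfLength _ _ _)

end Families

/-! ### Sums over words with prescribed occurrences. -/

namespace IsQuasiMultiplicative

variable {S : ℕ} {D : List (Fin S) → ℝ} {C κ r : ℝ}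

theorem sum_wordsOfLength (D : List (Fin S) → ℝ) (s : ℝ) (n : ℕ) :
    ∑ w ∈ wordsOfLength S n, D w ^ s = partitionSum D s n := by
  rw [wordsOfLength, Finset.sum_image fun a _ b _ h => List.ofFn_injective h]; rfl

theorem rpow_append_le (h : IsQuasiMultiplicative D C κ r) {s : ℝ} (hs : 0 ≤ s)
    (u w : List (Fin S)) : D (u ++ w) ^ s ≤ D u ^ s * D w ^ s := by
  rw [← Real.mul_rpow (h.pos u).le (h.pos w).le]
  exact Real.rpow_le_rpow (h.pos _).le (h.append_le u w) hs

theorem sum_image_append_le (h : IsQuasiMultiplicative D C κ r) {s : ℝ} (hs : 0 ≤ s)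
    (A : Finset (List (Fin S))) (w : List (Fin S)) :
    ∑ z ∈ A.image (· ++ w), D z ^ s ≤ (∑ u ∈ A, D u ^ s) * D w ^ s := by
  rw [Finset.sum_image fun a _ b _ hab => List.append_cancel_right hab, Finset.sum_mul]
  exact Finset.sum_le_sum fun u _ => h.rpow_append_le hs u w

theorem sum_image₂_append_le (h : IsQuasiMultiplicative D C κ r) {s : ℝ} (hs : 0 ≤ s)
    (A B : Finset (List (Fin S))) :
    ∑ z ∈ Finset.image₂ (· ++ ·) A B, D z ^ s ≤ (∑ u ∈ A, D u ^ s) * ∑ w ∈ B, D w ^ s := by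
  rw [Finset.sum_mul_sum, ← Finset.sum_product', Finset.image₂]
  refine (Finset.sum_image_le_of_nonneg (f := fun z => D z ^ s) ?_).trans ?_
  · exact fun z _ => Real.rpow_nonneg (h.pos _).le s
  · exact Finset.sum_le_sum fun p _ => h.rpow_append_le hs p.1 p.2

theorem rpow_eq_exp (h : IsQuasiMultiplicative D C κ r) (s : ℝ) (w : List (Fin S)) :
    D w ^ s = Real.exp (s * Real.log (D w)) := by
  rw [Real.rpow_def_of_pos (h.pos w), mul_comm]

variable [NeZero S]

/-- Each prescribed word of length L contributes D^s in place of e^{LP}. The choice of its position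
gives a factor at most M + 1, and each of the J + 1 free pieces a factor C^s. -/
theorem sum_targetFamily_le (h : IsQuasiMultiplicative D C κ r) {s : ℝ} (hs : 0 ≤ s)
    (t : ℕ → Fin S) (u l : ℝ) (J : ℕ) (x : ℝ) (M : ℕ) :
    ∑ w ∈ targetFamily t u l J x M, D w ^ s ≤
      (C ^ s) ^ (J + 1) * (M + 1 : ℝ) ^ J *
        Real.exp (M * symbolicPressure D s + ∑ j ∈ Finset.range J,
          (s * Real.log (D (initialWord t ⌊u * (x / l ^ j)⌋₊)) -
            ⌊u * (x / l ^ j)⌋₊ * symbolicPressure D s)) := by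
  have hC : 0 < C ^ s := Real.rpow_pos_of_pos h.const_pos s
  induction J generalizing x M with
  | zero =>
    simp only [targetFamily, sum_wordsOfLength, zero_add, pow_one, pow_zero, mul_one,
      Finset.range_zero, Finset.sum_empty, add_zero]
    exact h.partitionSum_le_exp hs M
  | succ J ih =>
    set P := symbolicPressure D s
    set L := ⌊u * x⌋₊ with hL
    set b : ℝ := ∑ j ∈ Finset.range J,
          (s * Real.log (D (initialWord t ⌊u * (x / l / l ^ j)⌋₊)) -
            ⌊u * (x / l / l ^ j)⌋₊ * P) with hb
    have hbsum : ∑ j ∈ Finset.range (J + 1),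
          (s * Real.log (D (initialWord t ⌊u * (x / l ^ j)⌋₊)) -
            ⌊u * (x / l ^ j)⌋₊ * P) = b + (s * Real.log (D (initialWord t L)) - L * P) := by
      rw [Finset.sum_range_succ', hb]
      simp only [pow_zero, div_one, ← hL, pow_succ', div_div]
    rw [hbsum]
    set T : ℝ := (C ^ s) ^ (J + 2) * (M + 1 : ℝ) ^ J *
      Real.exp (M * P + (b + (s * Real.log (D (initialWord t L)) - L * P))) with hT
    have hT0 : 0 < T := by positivity
    have hterm : ∀ m ∈ Finset.range (M + 1), (∑ w ∈ (if m + L ≤ M then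
        Finset.image₂ (· ++ ·) ((targetFamily t u l J (x / l) m).image (· ++ initialWord t L))
          (wordsOfLength S (M - (m + L))) else ∅), D w ^ s) ≤ T := by
      intro m hm
      split_ifs with hmL
      · refine (h.sum_image₂_append_le hs _ _).trans ?_
        rw [sum_wordsOfLength]
        have h1 := h.sum_image_append_le hs (targetFamily t u l J (x / l) m) (initialWord t L)
        have h2 := ih (x / l) m
        have h3 := h.partitionSum_le_exp hs (M - (m + L))
        rw [h.rpow_eq_exp s (initialWord t L)] at h1
        have h4 : ((M - (m + L) : ℕ) : ℝ) = M - m - L := by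
          rw [Nat.cast_sub hmL]; push_cast; ring
        rw [h4] at h3
        have hmM : (m : ℝ) ≤ M := Nat.cast_le.2 (by omega)
        calc _ ≤ ((C ^ s) ^ (J + 1) * (m + 1 : ℝ) ^ J * Real.exp (m * P + b) *
              Real.exp (s * Real.log (D (initialWord t L)))) *
              (C ^ s * Real.exp ((M - m - L) * P)) := by
              refine mul_le_mul (h1.trans ?_) h3 (h.partitionSum_pos s _).le (by positivity)
              exact mul_le_mul_of_nonneg_right h2 (Real.exp_pos _).le
          _ = (C ^ s) ^ (J + 2) * (m + 1 : ℝ) ^ J *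
              Real.exp (M * P + (b + (s * Real.log (D (initialWord t L)) - L * P))) := by
              rw [show (M : ℝ) * P + (b + (s * Real.log (D (initialWord t L)) - L * P)) =
                (m * P + b) + s * Real.log (D (initialWord t L)) + (M - m - L) * P by ring,
                Real.exp_add (_ + _ + _), Real.exp_add (m * P + b)]
              ring
          _ ≤ T := by rw [hT]; gcongr
      · simpa using hT0.le
    rw [targetFamily]
    calc _ ≤ ∑ m ∈ Finset.range (M + 1), (∑ w ∈ (if m + L ≤ M then
        Finset.image₂ (· ++ ·) ((targetFamily t u l J (x / l) m).image (· ++ initialWord t L))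
          (wordsOfLength S (M - (m + L))) else ∅), D w ^ s) :=
          sum_biUnion_le _ _ fun w => Real.rpow_nonneg (h.pos w).le s
      _ ≤ ∑ m ∈ Finset.range (M + 1), T := Finset.sum_le_sum hterm
      _ = _ := by
        rw [Finset.sum_const, Finset.card_range, nsmul_eq_mul, hT]
        push_cast
        ring

end IsQuasiMultiplicative

namespace IsQuasiMultiplicative

variable {S : ℕ} {D : List (Fin S) → ℝ} {C κ r : ℝ} [NeZero S]

/-- Comparison of the contribution of the prescribed occurrences with the target word. -/
theorem exponent_le (h : IsQuasiMultiplicative D C κ r) {s : ℝ} (hs : 0 ≤ s) (t : ℕ → Fin S)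
    {θ l v u a M ε : ℝ} (hθ : 1 < θ) (hθl : θ ≤ l) (hv : 0 ≤ v) (hu : 0 ≤ u) (huv : u ≤ v)
    (haθ : a ≤ θ * v) (J : ℕ) (hM : θ ^ J ≤ v * M) (hM0 : 0 ≤ M) (P : ℝ)
    (hε : ε = v * (θ / (θ - 1)) - u * ∑ j ∈ Finset.range J, l⁻¹ ^ j) :
    M * P + ∑ j ∈ Finset.range J, (s * Real.log (D (initialWord t ⌊u * (M / l ^ j)⌋₊)) -
        ⌊u * (M / l ^ j)⌋₊ * P) + s * Real.log (D (initialWord t ⌊a * M⌋₊)) ≤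
      M * (P * (1 - v * (θ / (θ - 1))) + |P| * ε + s * -Real.log κ * (2 * ε + (θ * v - a))) +
        s * Real.log (D (targetWord M t θ v)) +
        (|P| * J + s * ((2 * J + 3) * Real.log C + (J + 1) * -Real.log κ)) := by
  have hθ0 : 0 < θ := by linarith
  have hl0 : 0 < l := by linarith
  have hk : 0 < -Real.log κ := by linarith [h.log_lower_neg]
  have hC := h.log_const_nonneg
  set k := -Real.log κ with hkdef
  set q : ℕ → ℕ := fun j => ⌊v * M / θ ^ j⌋₊ with hq
  set L : ℕ → ℕ := fun j => ⌊u * (M / l ^ j)⌋₊ with hL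
  set G : ℝ := ∑ j ∈ Finset.range J, θ⁻¹ ^ j with hG
  set H : ℝ := ∑ j ∈ Finset.range J, l⁻¹ ^ j with hH
  have hgeom : G = θ / (θ - 1) - (θ ^ J)⁻¹ * (θ / (θ - 1)) := by
    have h1 : θ⁻¹ ≠ 1 := by
      intro h1; rw [inv_eq_one] at h1; linarith
    have h2 : θ - 1 ≠ 0 := by linarith
    have h3 : θ⁻¹ - 1 ≠ 0 := sub_ne_zero.2 h1
    rw [hG, geom_sum_eq h1, inv_pow, div_eq_iff h3]
    field_simp
    ring
  have hHG : H ≤ G := Finset.sum_le_sum fun j _ =>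
    pow_le_pow_left₀ (by positivity) (inv_anti₀ hθ0 hθl) j
  have hH0 : 0 ≤ H := Finset.sum_nonneg fun j _ => by positivity
  -- The quantity ε contains both the truncation after J terms and the effect of changing θ, v to l,
  -- u; this isolates the truncation.
  have hT : v * ((θ ^ J)⁻¹ * (θ / (θ - 1))) ≤ ε := by
    rw [hε]; nlinarith
  have hT0 : 0 ≤ (θ ^ J)⁻¹ * (θ / (θ - 1)) :=
    mul_nonneg (by positivity) (div_nonneg hθ0.le (by linarith))
  have hε0 : 0 ≤ ε := (mul_nonneg hv hT0).trans hT
  have hqle : ∀ j, (q j : ℝ) ≤ v * M * θ⁻¹ ^ j := by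
    intro j
    rw [inv_pow, ← div_eq_mul_inv]
    exact Nat.floor_le (by positivity)
  have hLle : ∀ j, (L j : ℝ) ≤ u * M * l⁻¹ ^ j := by
    intro j
    rw [inv_pow, ← div_eq_mul_inv, mul_div_assoc]
    exact Nat.floor_le (by positivity)
  have hleL : ∀ j, u * M * l⁻¹ ^ j - 1 ≤ L j := by
    intro j
    rw [inv_pow, ← div_eq_mul_inv, mul_div_assoc]
    exact (Nat.sub_one_lt_floor _).le
  have hLq : ∀ j, L j ≤ q j := by
    intro j
    refine Nat.floor_le_floor ?_
    rw [← mul_div_assoc]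
    gcongr
  have hsumq : ∑ j ∈ Finset.range J, (q j : ℝ) ≤ v * M * G := by
    rw [hG, Finset.mul_sum]; exact Finset.sum_le_sum fun j _ => hqle j
  have hsumL : ∑ j ∈ Finset.range J, (L j : ℝ) ≤ u * M * H := by
    rw [hH, Finset.mul_sum]; exact Finset.sum_le_sum fun j _ => hLle j
  have hsumL' : u * M * H - J ≤ ∑ j ∈ Finset.range J, (L j : ℝ) := by
    have := Finset.sum_le_sum fun j (_ : j ∈ Finset.range J) => hleL j
    rw [Finset.sum_sub_distrib, ← Finset.mul_sum] at this
    simp only [Finset.sum_const, Finset.card_range, nsmul_eq_mul, mul_one, ← hH] at this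
    exact this
  have hlog : ∑ j ∈ Finset.range J, Real.log (D (initialWord t (L j))) ≤
      J * Real.log C + ∑ j ∈ Finset.range J, Real.log (D (initialWord t (q j))) +
        k * (∑ j ∈ Finset.range J, (q j : ℝ) - ∑ j ∈ Finset.range J, (L j : ℝ)) := by
    have := Finset.sum_le_sum fun j (_ : j ∈ Finset.range J) => h.log_initialWord_le t (hLq j)
    rw [Finset.sum_sub_distrib, Finset.sum_add_distrib, ← Finset.sum_mul,
      Finset.sum_sub_distrib] at this
    simp only [Finset.sum_const, Finset.card_range, nsmul_eq_mul] at this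
    rw [hkdef]
    linarith
  have haA : ⌊a * M⌋₊ ≤ ⌊θ * v * M⌋₊ := Nat.floor_le_floor (by gcongr)
  have hloga := h.log_initialWord_le t haA
  have hA1 : (⌊θ * v * M⌋₊ : ℝ) ≤ θ * v * M := Nat.floor_le (by positivity)
  have hA2 := Nat.lt_floor_add_one (a * M)
  have hmain := h.sum_le_log_targetWord t hθ J hM
  have hA3 : k * ((⌊θ * v * M⌋₊ : ℝ) - ⌊a * M⌋₊) ≤ k * (M * (θ * v - a) + 1) := by
    gcongr; linarith
  have hA4 : k * (∑ j ∈ Finset.range J, (q j : ℝ) - ∑ j ∈ Finset.range J, (L j : ℝ)) ≤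
      k * (M * (ε - v * ((θ ^ J)⁻¹ * (θ / (θ - 1)))) + J) := by
    gcongr
    have : M * (ε - v * ((θ ^ J)⁻¹ * (θ / (θ - 1)))) = v * M * G - u * M * H := by
      rw [hgeom, hε]; ring
    linarith
  have hlogs : ∑ j ∈ Finset.range J, Real.log (D (initialWord t (L j))) +
      Real.log (D (initialWord t ⌊a * M⌋₊)) ≤
      Real.log (D (targetWord M t θ v)) + k * (M * (2 * ε + (θ * v - a))) +
        ((2 * J + 3) * Real.log C + (J + 1) * k) := by
    have h1 : v * M / θ ^ J * (θ / (θ - 1)) * Real.log κ =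
        -(k * (M * (v * ((θ ^ J)⁻¹ * (θ / (θ - 1)))))) := by
      rw [hkdef, div_eq_mul_inv]; ring
    rw [h1] at hmain
    -- The geometric tails from the length exchange and from the truncated target word cancel, so
    -- one ε would suffice; the second is slack.
    have h2 : 0 ≤ k * (M * ε) := by positivity
    linarith
  have hP : P * (M - ∑ j ∈ Finset.range J, (L j : ℝ)) ≤
      M * (P * (1 - v * (θ / (θ - 1))) + |P| * ε) + |P| * J := by
    have h1 : P * (M - ∑ j ∈ Finset.range J, (L j : ℝ)) = M * (P * (1 - v * (θ / (θ - 1)))) +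
        P * (M * (v * (θ / (θ - 1))) - ∑ j ∈ Finset.range J, (L j : ℝ)) := by ring
    have h2 : u * M * H = M * (v * (θ / (θ - 1))) - M * ε := by rw [hε]; ring
    have h3 : |P * (M * (v * (θ / (θ - 1))) - ∑ j ∈ Finset.range J, (L j : ℝ))| ≤
        |P| * (M * ε + J) := by
      rw [abs_mul]
      refine mul_le_mul_of_nonneg_left (abs_le.2 ⟨?_, ?_⟩) (abs_nonneg P)
      · have : 0 ≤ M * ε := by positivity
        have : (0 : ℝ) ≤ J := Nat.cast_nonneg J
        linarith
      · linarith
    have h4 := le_abs_self (P * (M * (v * (θ / (θ - 1))) - ∑ j ∈ Finset.range J, (L j : ℝ)))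
    rw [h1]
    linarith
  have hsplit : ∑ j ∈ Finset.range J, (s * Real.log (D (initialWord t (L j))) - L j * P) =
      s * ∑ j ∈ Finset.range J, Real.log (D (initialWord t (L j))) -
        P * ∑ j ∈ Finset.range J, (L j : ℝ) := by
    rw [Finset.sum_sub_distrib, Finset.mul_sum, ← Finset.sum_mul, mul_comm P]
  rw [hsplit]
  have := mul_le_mul_of_nonneg_left hlogs hs
  linarith

end IsQuasiMultiplicative

/-! ### The upper bound for the dimension of Υ. -/

theorem one_lt_of_one_div_le {v θ : ℝ} (hv0 : 0 < v) (hv1 : v < 1) (hθ : 1 / (1 - v) ≤ θ) :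
    1 < θ :=
  lt_of_lt_of_le (by rw [lt_div_iff₀] <;> linarith) hθ

/-- The infinite sum is l/(l - 1). The three terms of the constant account for replacing θ by l, for
the factor 1 - 2δ, and for the truncation at a finite J. -/
theorem geometric_error_le {θ δ v : ℝ} (hθ : 1 < θ) (hδ : 0 < δ)
    (hv1 : v ≤ 1) : ∃ J : ℕ, v * (θ / (θ - 1)) -
      (1 - 2 * δ) * v * ∑ j ∈ Finset.range J, (θ + (2 * θ + 5) * δ)⁻¹ ^ j ≤
        ((2 * θ + 5) / (θ - 1) ^ 2 + 2 * (θ / (θ - 1)) + 1) * δ := by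
  set l := θ + (2 * θ + 5) * δ with hl
  have hθ1 : 0 < θ - 1 := by linarith
  have hlθ : θ ≤ l := by rw [hl]; nlinarith
  have hl1 : 0 < l - 1 := by linarith
  have hl0 : 0 < l := by linarith
  have hlim : Tendsto (fun J : ℕ => (1 - 2 * δ) * v * ∑ j ∈ Finset.range J, l⁻¹ ^ j) atTop
      (𝓝 ((1 - 2 * δ) * v * (l / (l - 1)))) := by
    refine Tendsto.const_mul _ ?_
    have h1 := (hasSum_geometric_of_lt_one (inv_nonneg.2 hl0.le)
      (inv_lt_one_of_one_lt₀ (by linarith : 1 < l))).tendsto_sum_nat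
    have h2 : (1 - l⁻¹)⁻¹ = l / (l - 1) := by
      rw [inv_eq_one_div, div_eq_div_iff (by
        rw [sub_ne_zero, ne_comm, Ne, inv_eq_one]; linarith) hl1.ne']
      field_simp
    rwa [h2] at h1
  obtain ⟨J, hJ⟩ := (hlim.eventually (lt_mem_nhds (sub_lt_self _ hδ))).exists
  refine ⟨J, ?_⟩
  have hdiff : θ / (θ - 1) - l / (l - 1) ≤ (2 * θ + 5) / (θ - 1) ^ 2 * δ := by
    have h1 : θ / (θ - 1) - l / (l - 1) = (2 * θ + 5) * δ / ((θ - 1) * (l - 1)) := by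
      rw [div_sub_div _ _ hθ1.ne' hl1.ne', hl]; congr 1; ring
    rw [h1, div_mul_eq_mul_div, sq]
    gcongr
  have hmono : l / (l - 1) ≤ θ / (θ - 1) := by
    rw [div_le_div_iff₀ hl1 hθ1]; nlinarith
  have h0 : 0 ≤ l / (l - 1) := by positivity
  have h3 : 0 ≤ (2 * θ + 5) / (θ - 1) ^ 2 * δ := by positivity
  have h1 : v * (θ / (θ - 1) - l / (l - 1)) ≤ (2 * θ + 5) / (θ - 1) ^ 2 * δ := by nlinarith
  have h2 : v * (l / (l - 1)) ≤ θ / (θ - 1) := by nlinarith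
  nlinarith

section UpperBound

variable {d S : ℕ} {f : Fin S → EuclideanSpace ℝ (Fin d) → EuclideanSpace ℝ (Fin d)}
  {U Λ : Set (EuclideanSpace ℝ (Fin d))} [Nontrivial (EuclideanSpace ℝ (Fin d))] {C κ r : ℝ}
  [NeZero S]

/-- If the exponential growth rate is negative for the parameters `δ`, `J`, the set `Υ` has
dimension at most `s`. -/
theorem dimH_coding_Upsilon_le_of_neg (hf : IsConformalIFS f U) (hΛ : IsAttractor f U Λ)
    (hD : IsQuasiMultiplicative (derivNorm f U) C κ r) {t : ℕ → Fin S}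
    (ht : t ∈ admissibleTargets S) {v θ δ s ε ω : ℝ} {J : ℕ} (hv0 : 0 < v)
    (hθ : 1 < θ) (hδ0 : 0 < δ) (hδ1 : δ ≤ 1 / 4) (hs : 0 ≤ s)
    (hε : ε = v * (θ / (θ - 1)) -
      (1 - 2 * δ) * v * ∑ j ∈ Finset.range J, (θ + (2 * θ + 5) * δ)⁻¹ ^ j)
    (hω : ∀ᶠ M in atTop, targetRate (derivNorm f U) t θ v M < ω)
    (hneg : symbolicPressure (derivNorm f U) s * (1 - v * (θ / (θ - 1))) +
      |symbolicPressure (derivNorm f U) s| * ε +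
      s * -Real.log κ * (2 * ε + 2 * δ * v) + s * ω < 0) :
    dimH (coding f Λ '' Upsilon t θ v δ) ≤ ENNReal.ofReal s := by
  set D := derivNorm f U
  set P := symbolicPressure D s
  set l := θ + (2 * θ + 5) * δ with hl
  set u := (1 - 2 * δ) * v with hu
  set a := (θ - 2 * δ) * v with ha
  have hu0 : 0 ≤ u := by rw [hu]; nlinarith
  have huv : u ≤ v := by rw [hu]; nlinarith
  have hlθ : θ ≤ l := by rw [hl]; nlinarith
  have ha0 : 0 < a := by rw [ha]; exact mul_pos (by linarith) hv0
  have haθ : a ≤ θ * v := by rw [ha]; nlinarith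
  set β := -(P * (1 - v * (θ / (θ - 1))) + |P| * ε + s * -Real.log κ * (2 * ε + 2 * δ * v) +
    s * ω) with hβ
  have hβ0 : 0 < β := by linarith
  -- The first M letters, constrained by the J previous records, followed by the occurrence at the
  -- record M itself.
  set F : ℕ → Finset (List (Fin S)) := fun M =>
    (targetFamily t u l J M M).image (· ++ initialWord t ⌊a * M⌋₊)
  set K := |P| * J + s * ((2 * J + 3) * Real.log C + (J + 1) * -Real.log κ) with hK
  refine dimH_le_of_summable hf hD hs F ?_ ?_ ?_
  · intro M w hw
    obtain ⟨z, hz, rfl⟩ := Finset.mem_image.1 hw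
    rw [List.length_append, length_of_mem_targetFamily hz]
    exact Nat.le_add_right _ _
  · have hsum := ((Real.summable_pow_mul_exp_neg_nat_mul J hβ0).mul_left
      ((C ^ s) ^ (J + 1) * 2 ^ J * Real.exp K))
    refine hsum.of_norm_bounded_eventually_nat ?_
    have hev1 : ∀ᶠ M : ℕ in atTop, targetRate D t θ v (M : ℝ) < ω :=
      tendsto_natCast_atTop_atTop.eventually hω
    have hev2 : ∀ᶠ M : ℕ in atTop, θ ^ J / v ≤ (M : ℝ) :=
      tendsto_natCast_atTop_atTop.eventually (eventually_ge_atTop _)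
    filter_upwards [hev1, hev2, eventually_ge_atTop 1] with M h1 h2 h3
    have hM1 : (1 : ℝ) ≤ M := Nat.one_le_cast.2 h3
    have hM0 : (0 : ℝ) < M := by linarith
    have hnn : 0 ≤ ∑ w ∈ F M, D w ^ s :=
      Finset.sum_nonneg fun w _ => Real.rpow_nonneg (hD.pos w).le s
    rw [Real.norm_of_nonneg hnn]
    have hC : 0 < C ^ s := Real.rpow_pos_of_pos hD.const_pos s
    rw [div_le_iff₀' hv0] at h2
    rw [targetRate, div_lt_iff₀ hM0] at h1
    have hexp := hD.exponent_le hs t hθ hlθ hv0.le hu0 huv haθ J h2 hM0.le P hε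
    have hexp2 : (M : ℝ) * P + ∑ j ∈ Finset.range J,
        (s * Real.log (D (initialWord t ⌊u * (M / l ^ j)⌋₊)) - ⌊u * (M / l ^ j)⌋₊ * P) +
          s * Real.log (D (initialWord t ⌊a * M⌋₊)) ≤ K + -β * M := by
      refine hexp.trans ?_
      have h4 := mul_le_mul_of_nonneg_left h1.le hs
      have h5 : θ * v - a = 2 * δ * v := by rw [ha]; ring
      rw [h5, hβ]
      linarith
    calc ∑ w ∈ F M, D w ^ s
        ≤ (∑ w ∈ targetFamily t u l J M M, D w ^ s) * D (initialWord t ⌊a * M⌋₊) ^ s :=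
          hD.sum_image_append_le hs _ _
      _ ≤ ((C ^ s) ^ (J + 1) * (M + 1 : ℝ) ^ J * Real.exp (M * P + ∑ j ∈ Finset.range J,
          (s * Real.log (D (initialWord t ⌊u * (M / l ^ j)⌋₊)) -
            ⌊u * (M / l ^ j)⌋₊ * P))) *
            Real.exp (s * Real.log (D (initialWord t ⌊a * M⌋₊))) := by
          rw [hD.rpow_eq_exp s (initialWord t _)]
          exact mul_le_mul_of_nonneg_right (hD.sum_targetFamily_le hs t u l J M M)
            (Real.exp_pos _).le
      _ = (C ^ s) ^ (J + 1) * (M + 1 : ℝ) ^ J * Real.exp ((M : ℝ) * P + ∑ j ∈ Finset.range J,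
          (s * Real.log (D (initialWord t ⌊u * (M / l ^ j)⌋₊)) - ⌊u * (M / l ^ j)⌋₊ * P) +
          s * Real.log (D (initialWord t ⌊a * M⌋₊))) := by
          rw [mul_assoc, ← Real.exp_add]
      _ ≤ (C ^ s) ^ (J + 1) * (2 * M : ℝ) ^ J * Real.exp (K + -β * M) := by
          gcongr
          linarith
      _ = _ := by rw [Real.exp_add, mul_pow]; ring
  · rintro _ ⟨e, ⟨hve, hvs1, hvs2⟩, rfl⟩ B
    change (v : EReal) ≤ ve e t at hve
    have hRs : e ∈ Rs a t := mem_Rs_of_lt_vs (lt_of_lt_of_le (by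
      rw [EReal.coe_lt_coe_iff, ha]; nlinarith) hvs1)
    have hRs' : e ∉ Rs ((θ + 2 * δ) * v) t := notMem_Rs_of_vs_lt (by positivity)
      (lt_of_le_of_lt hvs2 (by rw [EReal.coe_lt_coe_iff]; nlinarith))
    have hRe : e ∈ Re ((1 - δ) * v) t := mem_Re_of_lt_ve (lt_of_lt_of_le (by
      rw [EReal.coe_lt_coe_iff]; nlinarith) hve)
    obtain ⟨ℓ, hℓ⟩ := exists_isMatchLength ht ha0 hRs hRs'
    -- This inequality dictates the coefficient 2θ + 5 in l; the bound δ ≤ 1/4 is used here.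
    have hlw : (θ + 2 * δ) * v < l * ((1 - δ) * v) := by
      have : θ + 2 * δ < l * (1 - δ) := by
        rw [hl]
        have : 0 ≤ (2 * θ + 5) * δ * (1 / 4 - δ) := by
          apply mul_nonneg <;> [positivity; linarith]
        nlinarith
      nlinarith
    obtain ⟨B₀, hB₀⟩ := exists_previous_record ht hℓ (u := u) (l := l) (by positivity)
      (mul_pos (by linarith) hv0) (by rw [hu]; nlinarith) hlw hRe hRs'
    obtain ⟨B₁, hB₁⟩ := exists_nat_ge (B₀ * l ^ J : ℝ)
    obtain ⟨M, hM, hrec, hlen⟩ := exists_late_record hℓ ha0 hRs (max B B₁)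
    have hmem := initialWord_mem_targetFamily hℓ hu0 (by linarith : 1 ≤ l) hB₀ J hrec le_rfl
      (hB₁.trans (Nat.cast_le.2 ((le_max_right _ _).trans hM)))
    refine ⟨M, (le_max_left _ _).trans hM, initialWord e (M + ⌊a * M⌋₊), ?_,
      image_mono (hΛ.subset_of_mapsTo hf) (coding_mem hf hΛ e _)⟩
    refine Finset.mem_image.2 ⟨_, hmem, ?_⟩
    rw [initialWord_add, initialWord]
    congr 1
    exact subword_congr.2 fun i hi => by
      rw [zero_add]; exact (hℓ.eq_of_lt M i (hi.trans_le hlen)).symm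

/-- The upper bound for the dimension of `Υ`, with an error linear in `δ`. -/
theorem exists_dimH_coding_Upsilon_le (hf : IsConformalIFS f U) (hΛ : IsAttractor f U Λ)
    (hD : IsQuasiMultiplicative (derivNorm f U) C κ r) {t : ℕ → Fin S}
    (ht : t ∈ admissibleTargets S) {v θ s₀ : ℝ} (hv0 : 0 < v) (hv1 : v < 1)
    (hθ : 1 / (1 - v) ≤ θ) (hs₀ : IsExponent f U v θ (OmegaPlus f U t θ v) s₀) :
    ∃ c : ℝ, ∃ δ₀ > (0 : ℝ), ∀ δ : ℝ, 0 < δ → δ < δ₀ →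
      dimH (coding f Λ '' Upsilon t θ v δ) ≤ ENNReal.ofReal (s₀ + c * δ) := by
  have hθ1 : 1 < θ := one_lt_of_one_div_le hv0 hv1 hθ
  set D := derivNorm f U
  set Ω := limsup (targetRate D t θ v) atTop with hΩ
  have hΩneg : Ω < 0 := hD.limsup_targetRate_neg t hθ1 hv0
  obtain ⟨hs₀0, heq⟩ := hs₀
  -- By definition, `pressure` and `OmegaPlus` are `symbolicPressure` and the limsup of `targetRate`
  -- for D.
  change (θ - θ * v - 1) * symbolicPressure D s₀ = -s₀ * (θ - 1) * Ω at heq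
  set A := 1 - v * (θ / (θ - 1)) with hA
  have hA' : A * (θ - 1) = θ - θ * v - 1 := by
    have : θ - 1 ≠ 0 := by linarith
    rw [hA]; field_simp; ring
  have hA0 : 0 ≤ A := by
    have h1 : 0 ≤ θ - θ * v - 1 := by
      rw [div_le_iff₀ (by linarith)] at hθ; linarith
    rw [← hA'] at h1
    exact nonneg_of_mul_nonneg_left h1 (by linarith)
  have hE : symbolicPressure D s₀ * A + s₀ * Ω = 0 := by
    have : (symbolicPressure D s₀ * A + s₀ * Ω) * (θ - 1) = 0 := by
      rw [← hA'] at heq; linarith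
    exact (mul_eq_zero.1 this).resolve_right (by linarith)
  have hk : 0 < -Real.log κ := by linarith [hD.log_lower_neg]
  set k := -Real.log κ with hkdef
  set P₁ := |symbolicPressure D 0| + (s₀ + 1) * k with hP₁
  set C₀ := (2 * θ + 5) / (θ - 1) ^ 2 + 2 * (θ / (θ - 1)) + 1 with hC₀
  have hC₀0 : 0 ≤ C₀ := by
    have : 0 < θ - 1 := by linarith
    positivity
  have hP₁0 : 0 ≤ P₁ := by positivity
  -- `C₁` gathers the coefficients of δ in all error terms. With this c, moving s by cδ lowers sΩ by
  -- (C₁ + 1)δ, more than all errors together.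
  set C₁ := P₁ * C₀ + (s₀ + 1) * k * (2 * C₀ + 2) + (s₀ + 1) with hC₁
  have hC₁0 : 0 ≤ C₁ := by positivity
  set c := (C₁ + 1) / -Ω with hc
  have hc0 : 0 < c := div_pos (by linarith) (by linarith)
  -- The bound 1/c keeps s ≤ s₀ + 1, so that `P₁` bounds |P(s)| uniformly in δ.
  refine ⟨c, min (1 / 4) (1 / c), by positivity, fun δ hδ0 hδ => ?_⟩
  have hδ1 : δ ≤ 1 / 4 := hδ.le.trans (min_le_left _ _)
  have hcδ : c * δ ≤ 1 := by
    have := hδ.le.trans (min_le_right _ _)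
    rwa [le_div_iff₀' hc0] at this
  have hcδ0 : 0 < c * δ := by positivity
  set s := s₀ + c * δ with hs
  have hs0 : 0 ≤ s := by linarith
  have hs1 : s ≤ s₀ + 1 := by linarith
  obtain ⟨J, hJ⟩ := geometric_error_le hθ1 hδ0 hv1.le
  refine dimH_coding_Upsilon_le_of_neg (J := J) (ω := Ω + δ) hf hΛ hD ht hv0 hθ1 hδ0 hδ1 hs0 rfl
    (hD.eventually_targetRate_lt t hθ1 hv0 (by linarith)) ?_
  set ε := v * (θ / (θ - 1)) -
      (1 - 2 * δ) * v * ∑ j ∈ Finset.range J, (θ + (2 * θ + 5) * δ)⁻¹ ^ j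
  set P := symbolicPressure D s
  have hPs : P ≤ symbolicPressure D s₀ := by
    have h1 := (hD.symbolicPressure_sub_mem hs₀0 (by linarith : s₀ ≤ s)).2
    have h2 := mul_nonpos_of_nonneg_of_nonpos (by linarith : 0 ≤ s - s₀) hD.log_ratio_neg.le
    linarith
  have hPabs : |P| ≤ P₁ := by
    have h1 := hD.symbolicPressure_sub_mem le_rfl hs0
    have h2 : (s - 0) * k ≤ (s₀ + 1) * k := by gcongr; linarith
    have h3 := mul_nonpos_of_nonneg_of_nonpos (by linarith : 0 ≤ s - 0) hD.log_ratio_neg.le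
    have h4 : -((s - 0) * k) = (s - 0) * Real.log κ := by rw [hkdef]; ring
    have h5 := le_abs_self (symbolicPressure D 0)
    have h6 := neg_abs_le (symbolicPressure D 0)
    have h7 := h1.1
    have h8 := h1.2
    have h9 : 0 ≤ (s₀ + 1) * k := by positivity
    rw [abs_le, hP₁]
    constructor <;> linarith
  have h1 : P * A + s * Ω ≤ -(C₁ + 1) * δ := by
    have h2 : P * A ≤ symbolicPressure D s₀ * A := by gcongr
    have h3 : c * δ * Ω = -(C₁ + 1) * δ := by
      have : c * -Ω = C₁ + 1 := div_mul_cancel₀ _ (by linarith)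
      linear_combination -δ * this
    rw [hs, add_mul, h3]
    linarith
  have h2 : |P| * ε ≤ P₁ * (C₀ * δ) :=
    (mul_le_mul_of_nonneg_left hJ (abs_nonneg P)).trans
      (mul_le_mul_of_nonneg_right hPabs (by positivity))
  have h3 : s * k * (2 * ε + 2 * δ * v) ≤ (s₀ + 1) * k * (2 * (C₀ * δ) + 2 * δ) := by
    have h4 : 2 * ε + 2 * δ * v ≤ 2 * (C₀ * δ) + 2 * δ := by nlinarith
    calc s * k * (2 * ε + 2 * δ * v) ≤ s * k * (2 * (C₀ * δ) + 2 * δ) := by gcongr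
      _ ≤ _ := by gcongr
  have h4 : s * δ ≤ (s₀ + 1) * δ := by gcongr
  have h5 : C₁ * δ = P₁ * (C₀ * δ) + (s₀ + 1) * k * (2 * (C₀ * δ) + 2 * δ) + (s₀ + 1) * δ := by
    rw [hC₁]; ring
  rw [mul_add s]
  linarith

end UpperBound

/-! ### Mass distribution -/

section Mass

variable {S : ℕ} {D : List (Fin S) → ℝ} {C κ r : ℝ}

theorem initialWord_prefix (e : ℕ → Fin S) {m n : ℕ} (h : m ≤ n) :
    initialWord e m <+: initialWord e n := by
  obtain ⟨k, rfl⟩ := Nat.exists_eq_add_of_le h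
  rw [initialWord_add]
  exact List.prefix_append _ _

/-- Stop at the first length where D drops to ρ. One step earlier D exceeded ρ, and one letter loses
at most the factor κ/C. The stopping length is not 0, since D of the empty word is 1. -/
theorem IsQuasiMultiplicative.exists_stopping (h : IsQuasiMultiplicative D C κ r) (e : ℕ → Fin S)
    {ρ : ℝ} (hρ0 : 0 < ρ) (hρ1 : ρ < 1) :
    ∃ n, D (initialWord e n) ≤ ρ ∧ κ / C * ρ ≤ D (initialWord e n) ∧
      ∀ m < n, ρ < D (initialWord e m) := by
  classical
  have hex : ∃ n, D (initialWord e n) ≤ ρ := by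
    obtain ⟨n, hn⟩ := exists_pow_lt_of_lt_one hρ0 h.ratio_lt_one
    exact ⟨n, (by simpa [length_initialWord] using h.le_pow (initialWord e n) :
      D (initialWord e n) ≤ r ^ n).trans hn.le⟩
  refine ⟨Nat.find hex, Nat.find_spec hex, ?_, fun m hm => not_le.1 (Nat.find_min hex hm)⟩
  have hpos : Nat.find hex ≠ 0 := by
    intro h0
    have := Nat.find_spec hex
    rw [h0] at this
    have h1 : D (initialWord e 0) = 1 := h.nil
    linarith
  obtain ⟨k, hk⟩ := Nat.exists_eq_succ_of_ne_zero hpos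
  have hlt : ρ < D (initialWord e k) := not_le.1 (Nat.find_min hex (by omega))
  rw [hk, Nat.succ_eq_add_one, initialWord_add]
  have h1 := h.le_append (initialWord e k) (subword e k 1)
  have h2 := h.pow_le (subword e k 1)
  rw [length_subword, pow_one] at h2
  rw [div_mul_eq_mul_div, div_le_iff₀' h.const_pos]
  refine le_trans ?_ h1
  rw [mul_comm]
  exact mul_le_mul hlt.le h2 h.lower_pos.le (h.pos _).le

end Mass

section MassDistribution

open MeasureTheory

variable {d S : ℕ} {f : Fin S → EuclideanSpace ℝ (Fin d) → EuclideanSpace ℝ (Fin d)}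
  {U Λ : Set (EuclideanSpace ℝ (Fin d))} [Nontrivial (EuclideanSpace ℝ (Fin d))] {C κ r : ℝ}

/-- Mass distribution principle: a random sequence whose cylinder probabilities are bounded by
the `s`-th powers of the derivative norms codes a set of dimension at least `s`. -/
theorem le_dimH_coding (hf : IsConformalIFS f U) (hosc : OpenSetCondition f U)
    (hΛ : IsAttractor f U Λ) (hD : IsQuasiMultiplicative (derivNorm f U) C κ r) {s : ℝ}
    (hs : 0 < s) {Ω : Type*} [MeasurableSpace Ω] (μ : Measure Ω) [IsProbabilityMeasure μ]
    {E : Ω → ℕ → Fin S} (hE : Measurable E) {c : ℝ} (hc : 0 < c)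
    (hμ : ∀ w : List (Fin S), μ {ω | initialWord (E ω) w.length = w} ≤
      ENNReal.ofReal (c * derivNorm f U w ^ s)) {X : Set (ℕ → Fin S)} (hX : ∀ ω, E ω ∈ X) :
    ENNReal.ofReal s ≤ dimH (coding f Λ '' X) := by
  classical
  obtain ⟨N, hN⟩ := hf.exists_card_le hosc (div_pos hD.lower_pos hD.const_pos)
  have hmeas : Measurable fun ω => coding f Λ (E ω) :=
    (continuous_coding hf hΛ hD).measurable.comp hE
  set g : Ω → EuclideanSpace ℝ (Fin d) := fun ω => coding f Λ (E ω) with hg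
  have hball : ∀ A : Set (EuclideanSpace ℝ (Fin d)), ∀ ρ : ℝ, 0 < ρ → ρ < 1 →
      (∀ x ∈ A, ∀ y ∈ A, dist x y ≤ ρ) → μ (g ⁻¹' A) ≤ ENNReal.ofReal (N * c * ρ ^ s) := by
    intro A ρ hρ0 hρ1 hA
    choose n hn1 hn2 hn3 using fun ω => hD.exists_stopping (E ω) hρ0 hρ1
    set W : Set (List (Fin S)) := (fun ω => initialWord (E ω) (n ω)) '' (g ⁻¹' A) with hW
    -- Stopping at the first passage makes these words an antichain for the prefix order.
    have hanti : ∀ u ∈ W, ∀ w ∈ W, u <+: w → u = w := by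
      rintro _ ⟨ω, hω, rfl⟩ _ ⟨ω', hω', rfl⟩ hp
      refine hp.eq_of_length ?_
      have hlen := hp.length_le
      simp only [length_initialWord] at hlen ⊢
      by_contra hne
      have hlt : n ω < n ω' := lt_of_le_of_ne hlen hne
      have heq : initialWord (E ω) (n ω) = initialWord (E ω') (n ω) :=
        (List.prefix_of_prefix_length_le hp (initialWord_prefix (E ω') hlen)
          (by simp [length_initialWord])).eq_of_length (by simp [length_initialWord])
      have h1 := hn3 ω' _ hlt
      rw [← heq] at h1
      exact absurd (hn1 ω) (not_le.2 h1)
    have hcard : ∀ F : Finset (List (Fin S)), (F : Set (List (Fin S))) ⊆ W → F.card ≤ N := by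
      intro F hF
      refine hN ρ hρ0 A hA F (fun u hu w hw => hanti u (hF hu) w (hF hw)) ?_ ?_ ?_
      · intro w hw
        obtain ⟨ω, -, rfl⟩ := hF hw
        exact hn2 ω
      · intro w hw
        obtain ⟨ω, -, rfl⟩ := hF hw
        exact hn1 ω
      · intro w hw
        obtain ⟨ω, hω, rfl⟩ := hF hw
        obtain ⟨x, hx, hxe⟩ := coding_mem hf hΛ (E ω) (n ω)
        exact ⟨x, hΛ.subset_of_mapsTo hf hx, by rw [hxe]; exact hω⟩
    -- The bound N holds for every finite subset, so it forces finiteness.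
    have hfin : W.Finite := by
      by_contra hinf
      obtain ⟨F, hF, hFc⟩ := Set.Infinite.exists_subset_card_eq hinf (N + 1)
      have := hcard F hF
      omega
    have hcover : g ⁻¹' A ⊆ ⋃ w ∈ hfin.toFinset, {ω | initialWord (E ω) w.length = w} := by
      intro ω hω
      refine mem_iUnion₂.2 ⟨initialWord (E ω) (n ω), ?_, ?_⟩
      · rw [Finite.mem_toFinset]; exact mem_image_of_mem _ hω
      · rw [mem_ofPred_eq, length_initialWord]
    calc μ (g ⁻¹' A) ≤ μ (⋃ w ∈ hfin.toFinset, {ω | initialWord (E ω) w.length = w}) :=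
          measure_mono hcover
      _ ≤ ∑ w ∈ hfin.toFinset, μ {ω | initialWord (E ω) w.length = w} :=
          measure_biUnion_finset_le _ _
      _ ≤ ∑ w ∈ hfin.toFinset, ENNReal.ofReal (c * ρ ^ s) := by
          refine Finset.sum_le_sum fun w hw => (hμ w).trans (ENNReal.ofReal_le_ofReal ?_)
          obtain ⟨ω, -, rfl⟩ := hfin.mem_toFinset.1 hw
          exact mul_le_mul_of_nonneg_left
            (Real.rpow_le_rpow (hD.pos _).le (hn1 ω) hs.le) hc.le
      _ = hfin.toFinset.card * ENNReal.ofReal (c * ρ ^ s) := by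
          rw [Finset.sum_const, nsmul_eq_mul]
      _ ≤ N * ENNReal.ofReal (c * ρ ^ s) := by
          gcongr
          exact hcard _ (by simp)
      _ = _ := by
          rw [mul_assoc, ENNReal.ofReal_mul (Nat.cast_nonneg N), ENNReal.ofReal_natCast]
  -- The added 1 keeps b positive even if N = 0.
  set b : ℝ := N * c + 1 with hb
  have hNc : 0 ≤ (N : ℝ) * c := by positivity
  have hb0 : 0 < b := by linarith
  set ν : Measure (EuclideanSpace ℝ (Fin d)) := (ENNReal.ofReal b)⁻¹ • μ.map g with hν
  have hbne : ENNReal.ofReal b ≠ 0 := by simpa using hb0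
  have hle : ν ≤ μH[s] := by
    refine Measure.le_hausdorffMeasure s ν (ENNReal.ofReal (1 / 2)) (by simp) fun A hA => ?_
    set δ := (Metric.ediam A).toReal with hδ
    have hAt : Metric.ediam A ≠ ⊤ := ne_top_of_le_ne_top ENNReal.ofReal_ne_top hA
    have hδ2 : δ ≤ 1 / 2 := ENNReal.toReal_le_of_le_ofReal (by norm_num) hA
    have hδ0 : 0 ≤ δ := ENNReal.toReal_nonneg
    have hdist : ∀ x ∈ closure A, ∀ y ∈ closure A, dist x y ≤ δ := by
      intro x hx y hy
      rw [dist_edist, hδ, ← Metric.ediam_closure]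
      exact ENNReal.toReal_mono (by rwa [Metric.ediam_closure]) (Metric.edist_le_ediam_of_mem hx hy)
    have hlim : Tendsto (fun ρ : ℝ => ENNReal.ofReal (b * ρ ^ s)) (𝓝[>] δ)
        (𝓝 (ENNReal.ofReal (b * δ ^ s))) := by
      refine ENNReal.tendsto_ofReal (Tendsto.const_mul b ?_)
      exact (Real.continuousAt_rpow_const δ s (Or.inr hs.le)).tendsto.mono_left
        nhdsWithin_le_nhds
    -- Letting ρ decrease to δ also covers sets of diameter 0; the closure is used because it is
    -- measurable.
    have hbound : μ (g ⁻¹' closure A) ≤ ENNReal.ofReal (b * δ ^ s) := by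
      refine ge_of_tendsto hlim ?_
      filter_upwards [Ioo_mem_nhdsGT (show δ < 1 by linarith)] with ρ hρ
      have hρ0 : 0 < ρ := hδ0.trans_lt hρ.1
      refine (hball _ ρ hρ0 hρ.2 fun x hx y hy => (hdist x hx y hy).trans hρ.1.le).trans ?_
      refine ENNReal.ofReal_le_ofReal ?_
      have := Real.rpow_nonneg hρ0.le s
      rw [hb]
      linarith
    calc ν A ≤ ν (closure A) := measure_mono subset_closure
      _ = (ENNReal.ofReal b)⁻¹ * μ (g ⁻¹' closure A) := by
          rw [hν, Measure.smul_apply, smul_eq_mul, Measure.map_apply hmeas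
            isClosed_closure.measurableSet]
      _ ≤ (ENNReal.ofReal b)⁻¹ * ENNReal.ofReal (b * δ ^ s) := by gcongr
      _ = Metric.ediam A ^ s := by
          rw [ENNReal.ofReal_mul hb0.le, ← mul_assoc,
            ENNReal.inv_mul_cancel hbne ENNReal.ofReal_ne_top, one_mul,
            ← ENNReal.ofReal_rpow_of_nonneg hδ0 hs.le, hδ, ENNReal.ofReal_toReal hAt]
  have hpos : (μH[s] : Measure (EuclideanSpace ℝ (Fin d))) (coding f Λ '' X) ≠ 0 := by
    have h1 : μ (g ⁻¹' (coding f Λ '' X)) = 1 := by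
      have : g ⁻¹' (coding f Λ '' X) = univ :=
        eq_univ_of_forall fun ω => mem_image_of_mem _ (hX ω)
      rw [this, measure_univ]
    have h2 : (ENNReal.ofReal b)⁻¹ ≤ ν (coding f Λ '' X) := by
      rw [hν, Measure.smul_apply, smul_eq_mul]
      have := Measure.le_map_apply (μ := μ) hmeas.aemeasurable (coding f Λ '' X)
      rw [h1] at this
      calc (ENNReal.ofReal b)⁻¹ = (ENNReal.ofReal b)⁻¹ * 1 := (mul_one _).symm
        _ ≤ _ := by gcongr
    have h3 := h2.trans (hle (coding f Λ '' X))
    have h4 : (0 : ENNReal) < (ENNReal.ofReal b)⁻¹ := ENNReal.inv_pos.2 ENNReal.ofReal_ne_top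
    exact (h4.trans_le h3).ne'
  refine le_dimH_of_hausdorffMeasure_ne_zero (d := s.toNNReal) ?_
  rwa [Real.coe_toNNReal s hs.le]

end MassDistribution

/-! ### Random sequences built from independent free blocks and initial words of the target -/

section RandomSequence

variable {S : ℕ}

/-- The end of the `k`-th pair (free block of length `g j`, initial word of length `ℓ j`). -/
def blockEnd (g ℓ : ℕ → ℕ) (k : ℕ) : ℕ := ∑ j ∈ Finset.range k, (g j + ℓ j)

/-- The word `ω₀ t|_{ℓ 0} ω₁ t|_{ℓ 1} ⋯ ω_{k-1} t|_{ℓ (k-1)}`. -/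
def blockConcat (t : ℕ → Fin S) {g : ℕ → ℕ} (ℓ : ℕ → ℕ) (ω : ∀ k, Fin (g k) → Fin S) :
    ℕ → List (Fin S)
  | 0 => []
  | k + 1 => blockConcat t ℓ ω k ++ (List.ofFn (ω k) ++ initialWord t (ℓ k))

/-- The infinite sequence `ω₀ t|_{ℓ 0} ω₁ t|_{ℓ 1} ⋯`. -/
def blockSequence [NeZero S] (t : ℕ → Fin S) {g : ℕ → ℕ} (ℓ : ℕ → ℕ)
    (ω : ∀ k, Fin (g k) → Fin S) : ℕ → Fin S :=
  fun i => (blockConcat t ℓ ω (i + 1)).getD i 0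

variable {t : ℕ → Fin S} {g ℓ : ℕ → ℕ}

theorem blockEnd_succ (g ℓ : ℕ → ℕ) (k : ℕ) :
    blockEnd g ℓ (k + 1) = blockEnd g ℓ k + (g k + ℓ k) := Finset.sum_range_succ _ _

theorem length_blockConcat (ω : ∀ k, Fin (g k) → Fin S) (k : ℕ) :
    (blockConcat t ℓ ω k).length = blockEnd g ℓ k := by
  induction k with
  | zero => rfl
  | succ k ih =>
    rw [blockConcat, List.length_append, List.length_append, ih, List.length_ofFn,
      length_initialWord, blockEnd_succ]

theorem blockConcat_prefix (ω : ∀ k, Fin (g k) → Fin S) {k m : ℕ} (h : k ≤ m) :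
    blockConcat t ℓ ω k <+: blockConcat t ℓ ω m := by
  induction m, h using Nat.le_induction with
  | base => exact List.prefix_rfl
  | succ m _ ih => exact ih.trans (List.prefix_append _ _)

theorem blockConcat_injective {ω ω' : ∀ k, Fin (g k) → Fin S} {k : ℕ}
    (h : blockConcat t ℓ ω k = blockConcat t ℓ ω' k) : ∀ j < k, ω j = ω' j := by
  induction k with
  | zero => intro j hj; omega
  | succ k ih =>
    rw [blockConcat, blockConcat] at h
    obtain ⟨h1, h2⟩ := List.append_inj h (by rw [length_blockConcat, length_blockConcat])
    intro j hj
    rcases (show j < k ∨ j = k by omega) with hjk | rfl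
    · exact ih h1 j hjk
    · exact List.ofFn_injective (List.append_inj h2 (by simp)).1

theorem le_blockEnd (hℓ : ∀ k, 0 < ℓ k) (k : ℕ) : k ≤ blockEnd g ℓ k := by
  induction k with
  | zero => exact Nat.zero_le _
  | succ k ih => rw [blockEnd_succ]; have := hℓ k; omega

theorem exists_block_index (hℓ : ∀ k, 0 < ℓ k) (N : ℕ) :
    ∃ k, blockEnd g ℓ k ≤ N ∧ N < blockEnd g ℓ (k + 1) := by
  classical
  have hex : ∃ k, N < blockEnd g ℓ (k + 1) := ⟨N, le_blockEnd hℓ (N + 1)⟩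
  refine ⟨Nat.find hex, ?_, Nat.find_spec hex⟩
  rcases Nat.eq_zero_or_pos (Nat.find hex) with h0 | h0
  · rw [h0]; exact Nat.zero_le N
  · obtain ⟨k, hk⟩ := Nat.exists_eq_succ_of_ne_zero h0.ne'
    rw [hk]
    exact not_lt.1 (Nat.find_min hex (by omega))

variable [NeZero S]

theorem initialWord_blockSequence (hℓ : ∀ k, 0 < ℓ k) (ω : ∀ k, Fin (g k) → Fin S) (k : ℕ) :
    initialWord (blockSequence t ℓ ω) (blockEnd g ℓ k) = blockConcat t ℓ ω k := by
  have hpre : ∀ {a b : List (Fin S)} {i : ℕ}, a <+: b → i < a.length → b.getD i 0 = a.getD i 0 := by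
    rintro a _ i ⟨c, rfl⟩ hi
    exact List.getD_append _ _ _ _ hi
  refine List.ext_getElem (by rw [length_initialWord, length_blockConcat]) fun i h1 h2 => ?_
  -- Positive ℓ makes i + 1 blocks at least i + 1 letters long, so the default digit in
  -- `blockSequence` is never read.
  have hi : i < (blockConcat t ℓ ω (i + 1)).length := by
    rw [length_blockConcat]; exact le_blockEnd hℓ (i + 1)
  have h3 : (blockConcat t ℓ ω (i + 1)).getD i 0 = (blockConcat t ℓ ω k).getD i 0 := by
    rcases le_total (i + 1) k with hk | hk
    · exact (hpre (blockConcat_prefix ω hk) hi).symm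
    · exact hpre (blockConcat_prefix ω hk) h2
  rw [List.getD_eq_getElem _ _ h2] at h3
  rw [← h3]
  simp [initialWord, subword, blockSequence]

theorem subword_blockSequence (hℓ : ∀ k, 0 < ℓ k) (ω : ∀ k, Fin (g k) → Fin S) (k : ℕ) :
    subword (blockSequence t ℓ ω) (blockEnd g ℓ k) (g k) = List.ofFn (ω k) ∧
      subword (blockSequence t ℓ ω) (blockEnd g ℓ k + g k) (ℓ k) = initialWord t (ℓ k) := by
  have h := initialWord_blockSequence (t := t) hℓ ω (k + 1)
  rw [blockEnd_succ, initialWord_add, initialWord_blockSequence hℓ, blockConcat, subword_add] at h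
  exact List.append_inj (List.append_cancel_left h) (by simp [length_subword])

theorem measurable_blockSequence (t : ℕ → Fin S) (g ℓ : ℕ → ℕ) :
    Measurable (blockSequence t (g := g) ℓ) := by
  let _ : MeasurableSpace (List (Fin S)) := ⊤
  have : DiscreteMeasurableSpace (List (Fin S)) := ⟨fun _ => trivial⟩
  have hW : ∀ k, Measurable fun ω : ∀ k, Fin (g k) → Fin S => blockConcat t ℓ ω k := by
    intro k
    induction k with
    | zero => exact measurable_const
    | succ k ih =>
      exact (Measurable.of_discrete (f := fun p : List (Fin S) × (Fin (g k) → Fin S) =>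
        p.1 ++ (List.ofFn p.2 ++ initialWord t (ℓ k)))).comp (ih.prodMk (measurable_pi_apply k))
  refine measurable_pi_iff.2 fun i => ?_
  exact (Measurable.of_discrete (f := fun w : List (Fin S) => w.getD i 0)).comp (hW (i + 1))

end RandomSequence

/-! ### Block measures and cylinder probabilities. -/

section BlockMeasure

open MeasureTheory

variable {S : ℕ} {D : List (Fin S) → ℝ} {C κ r : ℝ} [NeZero S]

/-- The probability measure on words of length `n` with weights proportional to `D w ^ s`. -/
def blockMeasure (D : List (Fin S) → ℝ) (s : ℝ) (n : ℕ) : Measure (Fin n → Fin S) :=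
  ∑ w : Fin n → Fin S,
    ENNReal.ofReal (D (List.ofFn w) ^ s / partitionSum D s n) • Measure.dirac w

namespace IsQuasiMultiplicative

omit [NeZero S] in
open Classical in
theorem blockMeasure_apply (h : IsQuasiMultiplicative D C κ r) (s : ℝ) (n : ℕ)
    (A : Set (Fin n → Fin S)) : blockMeasure D s n A =
      ENNReal.ofReal ((∑ w with w ∈ A, D (List.ofFn w) ^ s) / partitionSum D s n) := by
  have hZ : 0 ≤ partitionSum D s n :=
    Finset.sum_nonneg fun w _ => Real.rpow_nonneg (h.pos _).le s
  rw [blockMeasure, Measure.finsetSum_apply, Finset.sum_div, ENNReal.ofReal_sum_of_nonneg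
    fun w _ => div_nonneg (Real.rpow_nonneg (h.pos _).le s) hZ, Finset.sum_filter]
  refine Finset.sum_congr rfl fun w _ => ?_
  rw [Measure.smul_apply, Measure.dirac_apply' _ MeasurableSet.of_discrete, smul_eq_mul,
    indicator_apply]
  split_ifs <;> simp

theorem isProbabilityMeasure_blockMeasure (h : IsQuasiMultiplicative D C κ r) (s : ℝ) (n : ℕ) :
    IsProbabilityMeasure (blockMeasure D s n) := by
  classical
  refine ⟨?_⟩
  rw [h.blockMeasure_apply]
  simp only [mem_univ, Finset.filter_true]
  rw [← partitionSum, div_self (h.partitionSum_pos s n).ne', ENNReal.ofReal_one]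

/-- The words extending u sum to at most D(u)^s Z_{n-|u|}. Dividing by Z_n and using both
exponential bounds leaves the factor C^s e^{-|u|P}. -/
theorem blockMeasure_prefix_le (h : IsQuasiMultiplicative D C κ r) {s : ℝ} (hs : 0 ≤ s) {n : ℕ}
    {u : List (Fin S)} (hu : u.length ≤ n) :
    blockMeasure D s n {w | u <+: List.ofFn w} ≤ ENNReal.ofReal
      (C ^ s * D u ^ s * Real.exp (-(u.length * symbolicPressure D s))) := by
  classical
  set P := symbolicPressure D s
  rw [h.blockMeasure_apply]
  refine ENNReal.ofReal_le_ofReal ?_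
  rw [div_le_iff₀ (h.partitionSum_pos s n)]
  have hnn : ∀ w : List (Fin S), 0 ≤ D w ^ s := fun w => Real.rpow_nonneg (h.pos w).le s
  have h1 : ∑ w : Fin n → Fin S with w ∈ {w : Fin n → Fin S | u <+: List.ofFn w},
      D (List.ofFn w) ^ s ≤ ∑ z ∈ wordsOfLength S (n - u.length), D (u ++ z) ^ s := by
    rw [← Finset.sum_image (s := Finset.univ.filter fun w : Fin n → Fin S =>
      w ∈ {w : Fin n → Fin S | u <+: List.ofFn w}) (g := List.ofFn)
      (f := fun z : List (Fin S) => D z ^ s) fun a _ b _ hab => List.ofFn_injective hab,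
      ← Finset.sum_image (g := fun z => u ++ z) (f := fun z : List (Fin S) => D z ^ s)
        fun a _ b _ hab => List.append_cancel_left hab]
    refine Finset.sum_le_sum_of_subset_of_nonneg ?_ fun z _ _ => hnn z
    intro z hz
    obtain ⟨w, hw, rfl⟩ := Finset.mem_image.1 hz
    obtain ⟨c, hc⟩ : u <+: List.ofFn w := (Finset.mem_filter.1 hw).2
    refine Finset.mem_image.2 ⟨c, ?_, hc⟩
    have hlen : c.length = n - u.length := by
      have := congrArg List.length hc
      rw [List.length_append, List.length_ofFn] at this
      omega
    rw [wordsOfLength, ← hlen]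
    exact Finset.mem_image.2 ⟨c.get, Finset.mem_univ _, List.ofFn_get c⟩
  refine le_trans (le_of_eq (Finset.sum_congr (by ext; simp) fun _ _ => rfl))
    (h1.trans ((Finset.sum_le_sum fun z _ => h.rpow_append_le hs u z).trans ?_))
  rw [← Finset.mul_sum, sum_wordsOfLength]
  have h2 := h.partitionSum_le_exp hs (n - u.length)
  have h3 := h.exp_le_partitionSum hs n
  have hC : 0 < C ^ s := Real.rpow_pos_of_pos h.const_pos s
  calc D u ^ s * partitionSum D s (n - u.length)
      ≤ D u ^ s * (C ^ s * Real.exp ((n - u.length : ℕ) * P)) :=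
        mul_le_mul_of_nonneg_left h2 (hnn u)
    _ = C ^ s * D u ^ s * Real.exp (-(u.length * P)) * Real.exp (n * P) := by
        rw [Nat.cast_sub hu, sub_mul, sub_eq_add_neg, Real.exp_add]; ring
    _ ≤ _ := by
        exact mul_le_mul_of_nonneg_left h3
          (mul_nonneg (mul_nonneg hC.le (hnn u)) (Real.exp_pos _).le)

/-- The product of the block measures. -/
theorem infinitePi_blockMeasure_le (h : IsQuasiMultiplicative D C κ r) {s : ℝ} (hs : 0 ≤ s)
    (g : ℕ → ℕ) (ω₀ : ∀ k, Fin (g k) → Fin S) (k : ℕ) {u : List (Fin S)} (hu : u.length ≤ g k) :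
    Measure.infinitePi (fun k => blockMeasure D s (g k))
      {ω | (∀ j < k, ω j = ω₀ j) ∧ u <+: List.ofFn (ω k)} ≤
      ENNReal.ofReal ((∏ j ∈ Finset.range k, (C ^ s * D (List.ofFn (ω₀ j)) ^ s *
        Real.exp (-(g j * symbolicPressure D s)))) *
        (C ^ s * D u ^ s * Real.exp (-(u.length * symbolicPressure D s)))) := by
  classical
  have := fun k => h.isProbabilityMeasure_blockMeasure s (g k)
  -- For j < k, agreement with ω₀ j is relaxed to a prefix condition of full length, so one estimate
  -- serves all factors.
  set A : ∀ j, Set (Fin (g j) → Fin S) := fun j =>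
    if j < k then {w | List.ofFn (ω₀ j) <+: List.ofFn w} else {w | u <+: List.ofFn w} with hA
  have hsub : {ω : ∀ k, Fin (g k) → Fin S | (∀ j < k, ω j = ω₀ j) ∧ u <+: List.ofFn (ω k)} ⊆
      (↑(Finset.range (k + 1)) : Set ℕ).pi A := by
    rintro ω ⟨h1, h2⟩ j hj
    rw [Finset.mem_coe, Finset.mem_range] at hj
    rcases (show j < k ∨ j = k by omega) with hjk | rfl
    · simp only [hA, if_pos hjk, h1 j hjk]
      exact List.prefix_rfl
    · simp only [hA, lt_irrefl, if_false]
      exact h2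
  have hC : 0 ≤ C ^ s := Real.rpow_nonneg h.const_pos.le s
  have hnn : ∀ w : List (Fin S), 0 ≤ D w ^ s := fun w => Real.rpow_nonneg (h.pos w).le s
  have hterm : ∀ j, 0 ≤ C ^ s * D (List.ofFn (ω₀ j)) ^ s *
      Real.exp (-(g j * symbolicPressure D s)) := fun j =>
    mul_nonneg (mul_nonneg hC (hnn _)) (Real.exp_pos _).le
  refine (measure_mono hsub).trans ?_
  rw [Measure.infinitePi_pi _ fun _ _ => MeasurableSet.of_discrete, Finset.prod_range_succ,
    ENNReal.ofReal_mul (Finset.prod_nonneg fun j _ => hterm j),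
    ENNReal.ofReal_prod_of_nonneg fun j _ => hterm j]
  refine mul_le_mul' (Finset.prod_le_prod' fun j hj => ?_) ?_
  · rw [Finset.mem_range] at hj
    simp only [hA, if_pos hj]
    have := h.blockMeasure_prefix_le hs (n := g j) (u := List.ofFn (ω₀ j)) (by simp)
    rwa [List.length_ofFn] at this
  · simp only [hA, lt_irrefl, if_false]
    exact h.blockMeasure_prefix_le hs hu

omit [NeZero S] in
theorem rpow_append_ge (h : IsQuasiMultiplicative D C κ r) {s : ℝ} (hs : 0 ≤ s)
    (u w : List (Fin S)) : D u ^ s * D w ^ s ≤ C ^ s * D (u ++ w) ^ s := by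
  rw [← Real.mul_rpow (h.pos u).le (h.pos w).le, ← Real.mul_rpow h.const_pos.le (h.pos _).le]
  exact Real.rpow_le_rpow (mul_pos (h.pos u) (h.pos w)).le (h.le_append u w) hs

/-- The ratio between the probability of a block concatenation and the `s`-th power of its size. -/
def blockRatio (D : List (Fin S) → ℝ) (C s : ℝ) (t : ℕ → Fin S) (g ℓ : ℕ → ℕ) (k : ℕ) : ℝ :=
  ∏ j ∈ Finset.range k, ((C ^ s) ^ 3 * (D (initialWord t (ℓ j)) ^ s)⁻¹ *
    Real.exp (-(g j * symbolicPressure D s)))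

omit [NeZero S] in
-- Each block brings a cube of C^s: one factor from its measure, two from splitting off the block
-- and then its target word.
theorem prod_le_blockRatio (h : IsQuasiMultiplicative D C κ r) {s : ℝ} (hs : 0 ≤ s)
    (t : ℕ → Fin S) (g ℓ : ℕ → ℕ) (ω : ∀ k, Fin (g k) → Fin S) (k : ℕ) :
    (∏ j ∈ Finset.range k, (C ^ s * D (List.ofFn (ω j)) ^ s *
        Real.exp (-(g j * symbolicPressure D s)))) ≤
      blockRatio D C s t g ℓ k * D (blockConcat t ℓ ω k) ^ s := by
  have hC : 0 < C ^ s := Real.rpow_pos_of_pos h.const_pos s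
  have hp : ∀ w : List (Fin S), 0 < D w ^ s := fun w => Real.rpow_pos_of_pos (h.pos w) s
  induction k with
  | zero => simp [blockRatio, blockConcat, h.nil]
  | succ k ih =>
    have hR : 0 ≤ blockRatio D C s t g ℓ k := Finset.prod_nonneg fun j _ =>
      mul_nonneg (mul_nonneg (by positivity) (inv_nonneg.2 (hp _).le)) (Real.exp_pos _).le
    rw [Finset.prod_range_succ, blockRatio, Finset.prod_range_succ, ← blockRatio, blockConcat]
    set W := blockConcat t ℓ ω k
    set B := List.ofFn (ω k)
    set T := initialWord t (ℓ k)
    set E := Real.exp (-(g k * symbolicPressure D s))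
    have hE : 0 < E := Real.exp_pos _
    have hT := hp T
    have h1 := h.rpow_append_ge hs W (B ++ T)
    have h2 := h.rpow_append_ge hs B T
    have h3 : D W ^ s * (D B ^ s * D T ^ s) ≤ C ^ s * (C ^ s * D (W ++ (B ++ T)) ^ s) :=
      calc D W ^ s * (D B ^ s * D T ^ s) ≤ D W ^ s * (C ^ s * D (B ++ T) ^ s) :=
            mul_le_mul_of_nonneg_left h2 (hp W).le
        _ = C ^ s * (D W ^ s * D (B ++ T) ^ s) := by ring
        _ ≤ _ := mul_le_mul_of_nonneg_left h1 hC.le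
    calc _ ≤ blockRatio D C s t g ℓ k * D W ^ s * (C ^ s * D B ^ s * E) := by
          refine mul_le_mul_of_nonneg_right ih ?_
          have := hp B
          positivity
      _ = blockRatio D C s t g ℓ k * C ^ s * (D T ^ s)⁻¹ * E *
          (D W ^ s * (D B ^ s * D T ^ s)) := by
          field_simp
      _ ≤ blockRatio D C s t g ℓ k * C ^ s * (D T ^ s)⁻¹ * E *
          (C ^ s * (C ^ s * D (W ++ (B ++ T)) ^ s)) := by
          gcongr
      _ = _ := by ring

/-- Cylinder probabilities of the random sequence. -/
theorem measure_cylinder_le (h : IsQuasiMultiplicative D C κ r) {s : ℝ} (hs : 0 ≤ s)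
    (hP : 0 ≤ symbolicPressure D s) (t : ℕ → Fin S) (g ℓ : ℕ → ℕ) (hℓ : ∀ k, 0 < ℓ k) {R : ℝ}
    (hR : ∀ k, blockRatio D C s t g ℓ k ≤ R) (w : List (Fin S)) :
    Measure.infinitePi (fun k => blockMeasure D s (g k))
      {ω | initialWord (blockSequence t ℓ ω) w.length = w} ≤
      ENNReal.ofReal (R * (C ^ s) ^ 2 * D w ^ s) := by
  have hC : 1 ≤ C ^ s := Real.one_le_rpow h.one_le hs
  have hC0 : 0 < C ^ s := by linarith
  have hp : ∀ w : List (Fin S), 0 < D w ^ s := fun w => Real.rpow_pos_of_pos (h.pos w) s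
  have hR0 : 0 ≤ R := zero_le_one.trans ((by simp [blockRatio] :
    (1 : ℝ) ≤ blockRatio D C s t g ℓ 0).trans (hR 0))
  rcases Set.eq_empty_or_nonempty
    {ω : ∀ k, Fin (g k) → Fin S | initialWord (blockSequence t ℓ ω) w.length = w}
    with hemp | ⟨ω₀, hω₀⟩
  · rw [hemp, measure_empty]; exact zero_le
  change initialWord (blockSequence t ℓ ω₀) w.length = w at hω₀
  obtain ⟨k, hk1, hk2⟩ := exists_block_index (g := g) hℓ w.length
  have hstart := initialWord_blockSequence (t := t) (g := g) hℓ
  -- Either w ends inside the free part of block k, or it contains that part and ends within the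
  -- deterministic word after it.
  rcases le_total w.length (blockEnd g ℓ k + g k) with hN | hN
  · obtain ⟨l, hl⟩ := Nat.exists_eq_add_of_le hk1
    have hlg : l ≤ g k := by omega
    set u := subword (blockSequence t ℓ ω₀) (blockEnd g ℓ k) l with hu
    have hw : w = blockConcat t ℓ ω₀ k ++ u := by
      rw [← hω₀, hl, initialWord_add, hstart]
    have hsub : {ω : ∀ k, Fin (g k) → Fin S | initialWord (blockSequence t ℓ ω) w.length = w} ⊆
        {ω | (∀ j < k, ω j = ω₀ j) ∧ u <+: List.ofFn (ω k)} := by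
      intro ω hω
      change initialWord (blockSequence t ℓ ω) w.length = w at hω
      rw [hl, initialWord_add, hstart, hw] at hω
      obtain ⟨h1, h2⟩ := List.append_inj hω (by rw [length_blockConcat, length_blockConcat])
      refine ⟨blockConcat_injective h1, ?_⟩
      obtain ⟨m, hm⟩ := Nat.exists_eq_add_of_le hlg
      rw [← h2, ← (subword_blockSequence hℓ ω k).1, hm, subword_add]
      exact List.prefix_append _ _
    have hul : u.length = l := length_subword _ _ _
    refine (measure_mono hsub).trans ((h.infinitePi_blockMeasure_le hs g ω₀ k
      (by omega)).trans (ENNReal.ofReal_le_ofReal ?_))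
    have hexp : Real.exp (-(u.length * symbolicPressure D s)) ≤ 1 := by
      rw [Real.exp_le_one_iff]
      have : 0 ≤ (u.length : ℝ) * symbolicPressure D s := by positivity
      linarith
    have hpu := hp u
    have hpW := hp (blockConcat t ℓ ω₀ k)
    calc _ ≤ (R * D (blockConcat t ℓ ω₀ k) ^ s) * (C ^ s * D u ^ s * 1) := by
          refine mul_le_mul ((h.prod_le_blockRatio hs t g ℓ ω₀ k).trans ?_) (by gcongr)
            (by positivity) (by positivity)
          gcongr
          exact hR k
      _ = R * C ^ s * (D (blockConcat t ℓ ω₀ k) ^ s * D u ^ s) := by ring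
      _ ≤ R * C ^ s * (C ^ s * D w ^ s) := by
          rw [hw]
          exact mul_le_mul_of_nonneg_left (h.rpow_append_ge hs _ _) (by positivity)
      _ = _ := by ring
  · have hpre : ∀ ω : ∀ k, Fin (g k) → Fin S,
        initialWord (blockSequence t ℓ ω) (blockEnd g ℓ k + g k) =
          blockConcat t ℓ ω k ++ List.ofFn (ω k) := by
      intro ω
      rw [initialWord_add, hstart, (subword_blockSequence hℓ ω k).1]
    have hsub : {ω : ∀ k, Fin (g k) → Fin S | initialWord (blockSequence t ℓ ω) w.length = w} ⊆
        {ω | (∀ j < k + 1, ω j = ω₀ j) ∧ [] <+: List.ofFn (ω (k + 1))} := by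
      intro ω hω
      change initialWord (blockSequence t ℓ ω) w.length = w at hω
      have h1 := initialWord_prefix (blockSequence t ℓ ω) hN
      have h2 := initialWord_prefix (blockSequence t ℓ ω₀) hN
      rw [hω, hpre] at h1
      rw [hω₀, hpre] at h2
      have hlen : (blockConcat t ℓ ω k ++ List.ofFn (ω k)).length =
          (blockConcat t ℓ ω₀ k ++ List.ofFn (ω₀ k)).length := by
        simp [length_blockConcat]
      have h3 := (List.prefix_of_prefix_length_le h1 h2 hlen.le).eq_of_length hlen
      refine ⟨blockConcat_injective (t := t) (ℓ := ℓ) ?_, List.nil_prefix⟩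
      rw [blockConcat, blockConcat, ← List.append_assoc, h3, List.append_assoc]
    refine (measure_mono hsub).trans ((h.infinitePi_blockMeasure_le hs g ω₀ (k + 1)
      (u := []) (Nat.zero_le _)).trans (ENNReal.ofReal_le_ofReal ?_))
    -- The deterministic letters missing from w carry no probability loss; completing the block only
    -- decreases D.
    have hDw : D (blockConcat t ℓ ω₀ (k + 1)) ≤ D w := by
      have h1 := initialWord_prefix (blockSequence t ℓ ω₀) hk2.le
      rw [hω₀, hstart] at h1
      obtain ⟨c, hc⟩ := h1
      rw [← hc]
      refine (h.append_le w c).trans ?_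
      have := h.le_one c
      have := (h.pos w).le
      nlinarith
    have hpw := hp w
    have h0 : C ^ s * D ([] : List (Fin S)) ^ s *
        Real.exp (-((([] : List (Fin S)).length : ℝ) * symbolicPressure D s)) = C ^ s := by
      simp [h.nil]
    rw [h0]
    calc _ ≤ (R * D w ^ s) * C ^ s := by
          refine mul_le_mul_of_nonneg_right ((h.prod_le_blockRatio hs t g ℓ ω₀ (k + 1)).trans ?_)
            hC0.le
          have := (h.pos (blockConcat t ℓ ω₀ (k + 1))).le
          exact mul_le_mul (hR _) (Real.rpow_le_rpow this hDw hs)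
            (Real.rpow_nonneg this s) hR0
      _ = R * D w ^ s * C ^ s * 1 := (mul_one _).symm
      _ ≤ R * D w ^ s * C ^ s * C ^ s := by gcongr
      _ = _ := by ring

end IsQuasiMultiplicative

end BlockMeasure

/-! ### The lower bound -/

/-- The position of the `k`-th occurrence of the target. -/
def occurrenceStart (θ : ℝ) (K k : ℕ) : ℕ := ⌊θ ^ (K + k)⌋₊

/-- The length of the `k`-th occurrence of the target. -/
def occurrenceLength (θ v : ℝ) (K k : ℕ) : ℕ := ⌊v * θ ^ (K + k + 1)⌋₊

/-- The length of the free block before the `k`-th occurrence of the target. -/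
def freeLength (θ v : ℝ) (K : ℕ) : ℕ → ℕ
  | 0 => occurrenceStart θ K 0
  | k + 1 => occurrenceStart θ K (k + 1) - (occurrenceStart θ K k + occurrenceLength θ v K k)

section Occurrences

variable {S : ℕ} {θ v : ℝ} {K : ℕ}

theorem occurrenceLength_pos (hθ : 1 < θ) (hv : 0 < v) (h1 : 1 ≤ v * θ ^ K) (k : ℕ) :
    0 < occurrenceLength θ v K k := by
  rw [occurrenceLength, Nat.floor_pos]
  refine h1.trans (mul_le_mul_of_nonneg_left ?_ hv.le)
  exact pow_le_pow_right₀ hθ.le (by omega)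

theorem occurrence_add_le (hθ : 1 < θ) (hv : 0 < v) (h2 : 1 ≤ θ ^ K * (θ - 1 - v * θ))
    (k : ℕ) : occurrenceStart θ K k + occurrenceLength θ v K k ≤ occurrenceStart θ K (k + 1) := by
  have hθ0 : 0 < θ := by linarith
  have hA : 0 < θ - 1 - v * θ := by
    have : 0 < θ ^ K := by positivity
    by_contra! hneg
    nlinarith
  refine Nat.le_floor ?_
  push_cast
  have hpow : θ ^ K ≤ θ ^ (K + k) := pow_le_pow_right₀ hθ.le (by omega)
  have h4 : (occurrenceStart θ K k : ℝ) ≤ θ ^ (K + k) := Nat.floor_le (by positivity)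
  have h5 : (occurrenceLength θ v K k : ℝ) ≤ v * θ ^ (K + k + 1) := Nat.floor_le (by positivity)
  have h6 : 1 ≤ θ ^ (K + k) * (θ - 1 - v * θ) := h2.trans (by gcongr)
  rw [← add_assoc, pow_succ]
  rw [pow_succ] at h5
  nlinarith

theorem blockEnd_add_freeLength (hθ : 1 < θ) (hv : 0 < v) (h2 : 1 ≤ θ ^ K * (θ - 1 - v * θ))
    (k : ℕ) : blockEnd (freeLength θ v K) (occurrenceLength θ v K) k + freeLength θ v K k =
      occurrenceStart θ K k := by
  induction k with
  | zero => simp [blockEnd, freeLength]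
  | succ k ih =>
    rw [blockEnd_succ, ← add_assoc, ih, freeLength]
    exact Nat.add_sub_of_le (occurrence_add_le hθ hv h2 k)

variable [NeZero S]

/-- Between consecutive starts the last occurrence has length ⌊vθ^{K+k+1}⌋, at least ⌊vn⌋ for every
time n before the next start. At its own start a it has length at least ⌊θva⌋. -/
theorem blockSequence_mem_Delta (hθ : 1 < θ) (hv : 0 < v) (h1 : 1 ≤ v * θ ^ K)
    (h2 : 1 ≤ θ ^ K * (θ - 1 - v * θ)) (t : ℕ → Fin S)
    (ω : ∀ k, Fin (freeLength θ v K k) → Fin S) :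
    blockSequence t (occurrenceLength θ v K) ω ∈ Delta t θ v := by
  have hθ0 : 0 < θ := by linarith
  set e := blockSequence t (occurrenceLength θ v K) ω
  have hℓ := occurrenceLength_pos (K := K) hθ hv h1
  have hmatch : ∀ k, ∀ i < occurrenceLength θ v K k, e (occurrenceStart θ K k + i) = t i := by
    intro k i hi
    have h := (subword_blockSequence (t := t) hℓ ω k).2
    rw [blockEnd_add_freeLength hθ hv h2] at h
    have h' := subword_congr.1 h i hi
    rwa [zero_add] at h'
  have hmono : StrictMono (occurrenceStart θ K) := strictMono_nat_of_lt_succ fun k => by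
    have h3 := occurrence_add_le hθ hv h2 k
    have h4 := hℓ k
    omega
  have hRe : e ∈ Re v t := by
    refine ⟨occurrenceStart θ K 0, fun n hn => ?_⟩
    classical
    have hex : ∃ k, n < occurrenceStart θ K k := ⟨n + 1, hmono.le_apply⟩
    have h0 : Nat.find hex ≠ 0 := fun h0 => by
      have := Nat.find_spec hex
      rw [h0] at this
      omega
    obtain ⟨k, hk⟩ := Nat.exists_eq_succ_of_ne_zero h0
    have hlt := Nat.find_spec hex
    rw [hk] at hlt
    refine ⟨occurrenceStart θ K k, not_lt.1 (Nat.find_min hex (by omega)), ?_⟩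
    rw [shift_iterate_mem_cylinder]
    intro i hi
    refine hmatch k i (hi.trans_le (Nat.floor_le_floor ?_))
    refine mul_le_mul_of_nonneg_left ?_ hv.le
    exact (Nat.cast_le.2 hlt.le).trans (Nat.floor_le (by positivity))
  have hRs : e ∈ Rs (θ * v) t := by
    intro N
    refine ⟨occurrenceStart θ K N, hmono.le_apply, ?_⟩
    rw [shift_iterate_mem_cylinder]
    intro i hi
    refine hmatch N i (hi.trans_le (Nat.floor_le_floor ?_))
    have h3 : (occurrenceStart θ K N : ℝ) ≤ θ ^ (K + N) := Nat.floor_le (by positivity)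
    have h4 : θ * v * occurrenceStart θ K N ≤ θ * v * θ ^ (K + N) := by gcongr
    rw [pow_succ]
    linarith
  have hve : (v : EReal) ≤ ve e t := le_sSup ⟨v, ⟨hv.le, hRe⟩, rfl⟩
  have hvs : ((θ * v : ℝ) : EReal) ≤ vs e t := le_sSup ⟨θ * v, ⟨by positivity, hRs⟩, rfl⟩
  exact ⟨hve, hvs⟩

end Occurrences

namespace IsQuasiMultiplicative

variable {S : ℕ} {D : List (Fin S) → ℝ} {C κ r : ℝ} [NeZero S] {θ v : ℝ} {K : ℕ}

omit [NeZero S] in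
-- At M = θ^{K+m} the factors of the target word with q < m, and the last one, are exactly the
-- occurrences up to m. The remaining short factors only decrease D.
theorem log_targetWord_le_sum (h : IsQuasiMultiplicative D C κ r) (hθ : 1 < θ)
    (h1 : 1 ≤ v * θ ^ K) (t : ℕ → Fin S) (m : ℕ) :
    Real.log (D (targetWord (θ ^ (K + m)) t θ v)) ≤
      ∑ j ∈ Finset.range (m + 1), Real.log (D (initialWord t (occurrenceLength θ v K j))) := by
  have hθ0 : 0 < θ := by linarith
  set p := maxPower θ v (θ ^ (K + m))
  have hmp : m ≤ p := le_maxPower hθ (by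
    rw [pow_add, ← mul_assoc, mul_div_assoc, div_self (by positivity), mul_one]
    exact h1)
  have hneg : ∀ w, Real.log (D w) ≤ 0 := fun w => Real.log_nonpos (h.pos w).le (h.le_one w)
  rw [targetWord_eq, Finset.sum_range_succ]
  refine (h.log_append_le _ _).trans (add_le_add ?_ (le_of_eq ?_))
  · refine (h.blockWord_le t _ _).trans ?_
    rw [← Finset.sum_range_reflect
      (fun j => Real.log (D (initialWord t (occurrenceLength θ v K j))))]
    calc ∑ q ∈ Finset.range (p + 1), Real.log (D (initialWord t ⌊v * θ ^ (K + m) / θ ^ q⌋₊))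
        ≤ ∑ q ∈ Finset.range m, Real.log (D (initialWord t ⌊v * θ ^ (K + m) / θ ^ q⌋₊)) := by
          refine Finset.sum_le_sum_of_subset_of_nonpos' ?_ ?_
          · exact Finset.range_subset_range.2 (by omega)
          · exact fun q _ _ => hneg _
      _ = _ := by
          refine Finset.sum_congr rfl fun q hq => ?_
          rw [Finset.mem_range] at hq
          rw [occurrenceLength, show K + m = K + (m - 1 - q) + 1 + q by omega, pow_add _ _ q,
            ← mul_assoc, mul_div_assoc, div_self (by positivity), mul_one]
  · rw [occurrenceLength, pow_succ, show θ * v * θ ^ (K + m) = v * (θ ^ (K + m) * θ) by ring]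

omit [NeZero S] in
-- The free letters before an occurrence are its start minus the earlier occurrence lengths, which
-- form a geometric sum.
theorem le_sum_freeLength (hθ : 1 < θ) (hv : 0 < v) (h2 : 1 ≤ θ ^ K * (θ - 1 - v * θ)) (m : ℕ) :
    θ ^ (K + m) * (1 - v * (θ / (θ - 1))) - 1 ≤
      ∑ j ∈ Finset.range (m + 1), (freeLength θ v K j : ℝ) := by
  have hθ0 : 0 < θ := by linarith
  have h3 := blockEnd_add_freeLength hθ hv h2 m
  rw [blockEnd, Finset.sum_add_distrib] at h3
  have h4 : (∑ j ∈ Finset.range m, (freeLength θ v K j : ℝ)) +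
      ∑ j ∈ Finset.range m, (occurrenceLength θ v K j : ℝ) + freeLength θ v K m =
      occurrenceStart θ K m := by exact_mod_cast h3
  have h5 : θ ^ (K + m) - 1 < occurrenceStart θ K m := Nat.sub_one_lt_floor _
  have h6 : ∑ j ∈ Finset.range m, (occurrenceLength θ v K j : ℝ) ≤
      v * θ ^ (K + m) * (θ / (θ - 1)) := by
    have h7 := sum_floor_geometric_le hθ (show 0 ≤ v * θ ^ (K + m) by positivity) 0 m
    rw [pow_zero, div_one] at h7
    refine le_trans (le_of_eq ?_) h7
    push_cast
    rw [← Finset.sum_range_reflect]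
    refine Finset.sum_congr rfl fun q hq => ?_
    rw [Finset.mem_range] at hq
    rw [occurrenceLength, zero_add, show K + m = K + (m - 1 - q) + 1 + q by omega, pow_add _ _ q,
      ← mul_assoc, mul_div_assoc, div_self (by positivity), mul_one]
  rw [Finset.sum_range_succ]
  linarith

omit [NeZero S] in
theorem blockRatio_eq (h : IsQuasiMultiplicative D C κ r) (s : ℝ) (t : ℕ → Fin S) (g ℓ : ℕ → ℕ)
    (k : ℕ) : blockRatio D C s t g ℓ k = Real.exp (k * (3 * s * Real.log C) -
      s * ∑ j ∈ Finset.range k, Real.log (D (initialWord t (ℓ j))) -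
      symbolicPressure D s * ∑ j ∈ Finset.range k, (g j : ℝ)) := by
  have hterm : ∀ j, (C ^ s) ^ 3 * (D (initialWord t (ℓ j)) ^ s)⁻¹ *
      Real.exp (-(g j * symbolicPressure D s)) = Real.exp (3 * s * Real.log C -
        s * Real.log (D (initialWord t (ℓ j))) - symbolicPressure D s * g j) := by
    intro j
    rw [h.rpow_eq_exp, Real.rpow_def_of_pos h.const_pos, ← Real.exp_neg, ← Real.exp_nat_mul,
      ← Real.exp_add, ← Real.exp_add]
    congr 1
    push_cast
    ring
  rw [blockRatio, Finset.prod_congr rfl fun j _ => hterm j, ← Real.exp_sum,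
    Finset.sum_sub_distrib, Finset.sum_sub_distrib, Finset.sum_const, Finset.card_range,
    nsmul_eq_mul, ← Finset.mul_sum, ← Finset.mul_sum]

/-- For suitable starting scales the block ratios stay bounded. -/
theorem exists_blockRatio_le (h : IsQuasiMultiplicative D C κ r) {s : ℝ} (hs : 0 < s)
    (hθ : 1 < θ) (hv : 0 < v) (hA : 0 < θ - 1 - v * θ) (hP : 0 ≤ symbolicPressure D s)
    (t : ℕ → Fin S) (hpos : 0 < symbolicPressure D s * (1 - v * (θ / (θ - 1))) +
      s * liminf (targetRate D t θ v) atTop) :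
    ∃ K : ℕ, 1 ≤ v * θ ^ K ∧ 1 ≤ θ ^ K * (θ - 1 - v * θ) ∧ ∃ R, ∀ k,
      blockRatio D C s t (freeLength θ v K) (occurrenceLength θ v K) k ≤ R := by
  have hθ0 : 0 < θ := by linarith
  set P := symbolicPressure D s
  set A := 1 - v * (θ / (θ - 1))
  set Ω := liminf (targetRate D t θ v) atTop
  set β := (P * A + s * Ω) / 2 with hβ
  have hβ0 : 0 < β := by positivity
  set a := Ω - β / s with ha
  have haΩ : a < Ω := by rw [ha]; have : 0 < β / s := by positivity
                         linarith
  have hPa : P * A + s * a = β := by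
    rw [ha, mul_sub s, mul_div_cancel₀ _ hs.ne', hβ]; ring
  have hpow : Tendsto (fun N : ℕ => θ ^ N) atTop atTop := tendsto_pow_atTop_atTop_of_one_lt hθ
  have hev1 : ∀ᶠ N : ℕ in atTop, 1 / v ≤ θ ^ N := hpow.eventually_ge_atTop _
  have hev2 : ∀ᶠ N : ℕ in atTop, 1 / (θ - 1 - v * θ) ≤ θ ^ N := hpow.eventually_ge_atTop _
  have hev3 : ∀ᶠ N : ℕ in atTop, a < targetRate D t θ v (θ ^ N) :=
    hpow.eventually (h.eventually_lt_targetRate t hθ hv haΩ)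
  -- The number of blocks grows like log M, so the accumulated powers of C are absorbed by half of
  -- the positive rate.
  have hev4 : ∀ᶠ N : ℕ in atTop, ((N : ℝ) + 1) * (3 * s * Real.log C) ≤ β * θ ^ N := by
    have h1 := (tendsto_pow_const_div_const_pow_of_one_lt 1 hθ).add
      (tendsto_pow_const_div_const_pow_of_one_lt 0 hθ)
    have h2 := h1.mul_const (3 * s * Real.log C)
    rw [add_zero, zero_mul] at h2
    filter_upwards [h2.eventually (gt_mem_nhds hβ0)] with N hN
    have hN0 : 0 < θ ^ N := by positivity
    rw [pow_one, pow_zero, ← add_div, div_mul_eq_mul_div, div_lt_iff₀ hN0] at hN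
    exact hN.le
  obtain ⟨K, hK⟩ := eventually_atTop.1 (((hev1.and hev2).and hev3).and hev4)
  obtain ⟨⟨⟨hK1, hK2⟩, -⟩, -⟩ := hK K le_rfl
  rw [div_le_iff₀' hv] at hK1
  rw [div_le_iff₀ hA] at hK2
  -- The bound e^P comes from the rounding loss of 1 in `le_sum_freeLength`.
  refine ⟨K, hK1, hK2, Real.exp P, fun k => ?_⟩
  rw [h.blockRatio_eq, Real.exp_le_exp]
  rcases Nat.eq_zero_or_pos k with rfl | hk
  · simpa using hP
  obtain ⟨m, rfl⟩ := Nat.exists_eq_succ_of_ne_zero hk.ne'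
  rw [Nat.succ_eq_add_one]
  obtain ⟨⟨-, hm3⟩, hm4⟩ := hK (K + m) (by omega)
  have hM0 : 0 < θ ^ (K + m) := by positivity
  rw [targetRate, lt_div_iff₀ hM0] at hm3
  have h3 := hm3.le.trans (h.log_targetWord_le_sum hθ hK1 t m)
  have h4 := le_sum_freeLength hθ hv hK2 m
  have h5 := mul_le_mul_of_nonneg_left h3 hs.le
  have h6 := mul_le_mul_of_nonneg_left h4 hP
  have h7 : ((m + 1 : ℕ) : ℝ) * (3 * s * Real.log C) ≤
      (((K + m : ℕ) : ℝ) + 1) * (3 * s * Real.log C) := by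
    have := h.log_const_nonneg
    gcongr
    push_cast
    have : (0 : ℝ) ≤ K := Nat.cast_nonneg K
    linarith
  have h8 : (P * A + s * a) * θ ^ (K + m) = β * θ ^ (K + m) := by rw [hPa]
  linarith

end IsQuasiMultiplicative

section LowerBound

open MeasureTheory

variable {d S : ℕ} {f : Fin S → EuclideanSpace ℝ (Fin d) → EuclideanSpace ℝ (Fin d)}
  {U Λ : Set (EuclideanSpace ℝ (Fin d))} [Nontrivial (EuclideanSpace ℝ (Fin d))] {C κ r : ℝ}
  [NeZero S]

/-- The lower bound for the dimension of `Δ`. -/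
theorem le_dimH_coding_Delta (hf : IsConformalIFS f U) (hosc : OpenSetCondition f U)
    (hΛ : IsAttractor f U Λ) (hD : IsQuasiMultiplicative (derivNorm f U) C κ r) (t : ℕ → Fin S)
    {v θ s₀ : ℝ} (hv0 : 0 < v) (hv1 : v < 1) (hθ : 1 / (1 - v) ≤ θ)
    (hs₀ : IsExponent f U v θ (OmegaMinus f U t θ v) s₀) :
    ENNReal.ofReal s₀ ≤ dimH (coding f Λ '' Delta t θ v) := by
  have hθ1 : 1 < θ := one_lt_of_one_div_le hv0 hv1 hθ
  set D := derivNorm f U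
  set Ω := liminf (targetRate D t θ v) atTop
  have hΩneg : Ω < 0 := hD.liminf_targetRate_neg t hθ1 hv0
  obtain ⟨hs₀0, heq⟩ := hs₀
  change (θ - θ * v - 1) * symbolicPressure D s₀ = -s₀ * (θ - 1) * Ω at heq
  rcases hs₀0.eq_or_lt with rfl | hs₀0
  · rw [ENNReal.ofReal_zero]; exact zero_le
  rw [div_le_iff₀ (by linarith)] at hθ
  -- For s₀ > 0 the equation has a positive right side; this excludes θ = 1/(1 - v) and makes P(s₀)
  -- positive.
  have hrhs : 0 < -s₀ * (θ - 1) * Ω := by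
    have : 0 < s₀ * (θ - 1) * -Ω :=
      mul_pos (mul_pos hs₀0 (by linarith)) (by linarith)
    linarith
  rw [← heq] at hrhs
  have hA : 0 < θ - θ * v - 1 := by
    refine lt_of_le_of_ne (by linarith) fun h0 => ?_
    rw [← h0, zero_mul] at hrhs
    exact lt_irrefl _ hrhs
  have hP₀ : 0 < symbolicPressure D s₀ := (pos_iff_pos_of_mul_pos hrhs).1 hA
  set A := 1 - v * (θ / (θ - 1)) with hAdef
  have hA' : A * (θ - 1) = θ - θ * v - 1 := by
    have : θ - 1 ≠ 0 := by linarith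
    rw [hAdef]; field_simp; ring
  have hA0 : 0 < A := by
    rw [← hA'] at hA
    exact pos_of_mul_pos_left hA (by linarith)
  have hE : symbolicPressure D s₀ * A + s₀ * Ω = 0 := by
    have : (symbolicPressure D s₀ * A + s₀ * Ω) * (θ - 1) = 0 := by
      rw [← hA'] at heq; linarith
    exact (mul_eq_zero.1 this).resolve_right (by linarith)
  -- Strictness s < s₀ makes the rate positive, as `exists_blockRatio_le` requires; the value s₀ is
  -- reached by a limit.
  have hall : ∀ s, 0 < s → s < s₀ → ENNReal.ofReal s ≤ dimH (coding f Λ '' Delta t θ v) := by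
    intro s hs hss
    have hPs : symbolicPressure D s₀ ≤ symbolicPressure D s := by
      have h1 := (hD.symbolicPressure_sub_mem hs.le hss.le).2
      have h2 := mul_nonpos_of_nonneg_of_nonpos (by linarith : 0 ≤ s₀ - s) hD.log_ratio_neg.le
      linarith
    have hP : 0 ≤ symbolicPressure D s := by linarith
    obtain ⟨K, hK1, hK2, R, hR⟩ := hD.exists_blockRatio_le hs hθ1 hv0 (by linarith) hP t (by
      have h1 : symbolicPressure D s₀ * A ≤ symbolicPressure D s * A := by gcongr
      have h2 : s₀ * Ω < s * Ω := mul_lt_mul_of_neg_right hss hΩneg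
      linarith)
    have hℓ := occurrenceLength_pos (K := K) hθ1 hv0 hK1
    have := fun k => hD.isProbabilityMeasure_blockMeasure s (freeLength θ v K k)
    have hR0 : 0 < R := one_pos.trans_le ((by simp [IsQuasiMultiplicative.blockRatio] :
      (1 : ℝ) ≤ IsQuasiMultiplicative.blockRatio D C s t _ _ 0).trans (hR 0))
    have hC : 0 < C ^ s := Real.rpow_pos_of_pos hD.const_pos s
    exact le_dimH_coding hf hosc hΛ hD hs
      (Measure.infinitePi fun k => blockMeasure D s (freeLength θ v K k))
      (measurable_blockSequence t (freeLength θ v K) (occurrenceLength θ v K))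
      (c := R * (C ^ s) ^ 2) (by positivity)
      (hD.measure_cylinder_le hs.le hP t _ _ hℓ hR)
      (blockSequence_mem_Delta hθ1 hv0 hK1 hK2 t)
  have hlim : Tendsto ENNReal.ofReal (𝓝[<] s₀) (𝓝 (ENNReal.ofReal s₀)) :=
    ENNReal.continuous_ofReal.continuousAt.mono_left nhdsWithin_le_nhds
  refine le_of_tendsto hlim ?_
  filter_upwards [Ioo_mem_nhdsLT hs₀0] with s hs
  exact hall s hs.1 hs.2

end LowerBound

/-! ### Existence and uniqueness of the exponents -/

variable {d S : ℕ} {f : Fin S → EuclideanSpace ℝ (Fin d) → EuclideanSpace ℝ (Fin d)}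
  {U : Set (EuclideanSpace ℝ (Fin d))}

theorem IsQuasiMultiplicative.existsUnique_isExponent [NeZero S] {C κ r : ℝ}
    (hD : IsQuasiMultiplicative (derivNorm f U) C κ r) {v θ Ω : ℝ} (hv0 : 0 < v) (hv1 : v < 1)
    (hθ : 1 / (1 - v) ≤ θ) (hΩ : Ω < 0) : ∃! s : ℝ, IsExponent f U v θ Ω s := by
  have hθ1 := one_lt_of_one_div_le hv0 hv1 hθ
  rw [div_le_iff₀ (by linarith)] at hθ
  have h := hD.existsUnique_exponent (a := θ - θ * v - 1) (b := (θ - 1) * Ω) (by linarith)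
    (mul_neg_of_pos_of_neg (by linarith) hΩ)
  have hiff : ∀ s : ℝ, IsExponent f U v θ Ω s ↔
      (0 ≤ s ∧ (θ - θ * v - 1) * symbolicPressure (derivNorm f U) s + s * ((θ - 1) * Ω) = 0) := by
    intro s
    change (0 ≤ s ∧ (θ - θ * v - 1) * symbolicPressure (derivNorm f U) s =
      -s * (θ - 1) * Ω) ↔ _
    refine and_congr_right fun _ => ⟨fun h => ?_, fun h => ?_⟩ <;> linarith
  simpa only [hiff] using h

theorem isExponent_sSup {v θ Ω : ℝ} (h : ∃! s : ℝ, IsExponent f U v θ Ω s) :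
    IsExponent f U v θ Ω (sSup {s : ℝ | IsExponent f U v θ Ω s}) := by
  obtain ⟨s, hs, huniq⟩ := h
  have : {s : ℝ | IsExponent f U v θ Ω s} = {s} := eq_singleton_iff_unique_mem.2 ⟨hs, huniq⟩
  rwa [this, csSup_singleton]

end ConformalIFS

end

theorem theorem2 {d S : ℕ}
    (f : Fin S → EuclideanSpace ℝ (Fin d) → EuclideanSpace ℝ (Fin d))
    (U Λ : Set (EuclideanSpace ℝ (Fin d)))
    (hf : ConformalIFS.IsConformalIFS f U)
    (hosc : ConformalIFS.OpenSetCondition f U)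
    (hΛ : ConformalIFS.IsAttractor f U Λ)
    (v : ℝ) (hv0 : 0 < v) (hv1 : v < 1)
    (t : ℕ → Fin S) (ht : t ∈ ConformalIFS.admissibleTargets S) :
    (∀ θ : ℝ, 0 < θ → θ < 1 / (1 - v) →
      {e : ℕ → Fin S | (v : EReal) ≤ ConformalIFS.ve e t} ∩
        {e : ℕ → Fin S | ConformalIFS.vs e t = ((θ * v : ℝ) : EReal)} = ∅) ∧
    (∀ θ : ℝ, 1 / (1 - v) ≤ θ →
      (∃! s : ℝ, ConformalIFS.IsExponent f U v θ (ConformalIFS.OmegaPlus f U t θ v) s) ∧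
      (∃! s : ℝ, ConformalIFS.IsExponent f U v θ (ConformalIFS.OmegaMinus f U t θ v) s) ∧
      (∃ c : ℝ, ∃ δ₀ > (0 : ℝ), ∀ δ : ℝ, 0 < δ → δ < δ₀ →
        dimH (ConformalIFS.coding f Λ '' ConformalIFS.Upsilon t θ v δ) ≤
          min (ENNReal.ofReal (ConformalIFS.sPlus f U t v θ + c * δ)) (dimH Λ)) ∧
      min (ENNReal.ofReal (ConformalIFS.sMinus f U t v θ)) (dimH Λ) ≤
        dimH (ConformalIFS.coding f Λ '' ConformalIFS.Delta t θ v)) := by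
  have := hosc.nontrivial hf.two_le
  have : NeZero S := ⟨by have := hf.two_le; omega⟩
  obtain ⟨C, κ, r, hD⟩ := hf.exists_isQuasiMultiplicative hosc
  refine ⟨fun θ hθ hθv => ConformalIFS.ve_inter_vs_eq_empty ht hv0 hv1 hθ hθv, fun θ hθ => ?_⟩
  have hP := hD.existsUnique_isExponent hv0 hv1 hθ
    (hD.limsup_targetRate_neg t (ConformalIFS.one_lt_of_one_div_le hv0 hv1 hθ) hv0)
  have hM := hD.existsUnique_isExponent hv0 hv1 hθ
    (hD.liminf_targetRate_neg t (ConformalIFS.one_lt_of_one_div_le hv0 hv1 hθ) hv0)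
  refine ⟨hP, hM, ?_, ?_⟩
  · obtain ⟨c, δ₀, hδ₀, h⟩ := ConformalIFS.exists_dimH_coding_Upsilon_le hf hΛ hD ht hv0 hv1 hθ
      (ConformalIFS.isExponent_sSup hP)
    exact ⟨c, δ₀, hδ₀, fun δ h0 h1 => le_min (h δ h0 h1)
      (dimH_mono (ConformalIFS.coding_image_subset hf hΛ _))⟩
  · exact (min_le_left _ _).trans (ConformalIFS.le_dimH_coding_Delta hf hosc hΛ hD t hv0 hv1 hθ
      (ConformalIFS.isExponent_sSup hM))
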